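/- Let $n\ge 0$ and let $(M,\varphi,\xi,\eta,g)$ be a paracontact metric manifold of dimension $2n+1$: $M$ is a connected smooth (Hausdorff, second countable) manifold, $g$ is a smooth pseudo-Riemannian metric, $\xi$ is a smooth vector field, $\eta$ is a contact form ($\eta\wedge(d\eta)^n\neq 0$) with $\eta(\xi)=1$ and $d\eta(\xi,\cdot)=0$, and $\varphi$ is a smooth $(1,1)$-tensor field with $$\eta=g(\xi,\cdot),\qquad d\eta(\cdot,\cdot)=g(\cdot,\varphi\,\cdot),\qquad \varphi^2=I-\eta\otimes\xi,$$ where $2\,d\eta(X,Y)=X\eta(Y)-Y\eta(X)-\eta([X,Y])$. Let $\nabla$ be the Levi-Civita connection of $g$, $\varrho$ its Ricci tensor and $Q$ the Ricci operator, $g(QX,Y)=\varrho(X,Y)$. Suppose that $(M,\varphi,\xi,\eta,g)$ is a paracontact Ricci soliton, that is, for some real constant $\lambda$, $$\varrho+\tfrac12 L_\xi g=\lambda g .$$ Then: 1. $Q\xi=\lambda\xi$; 2. $\xi$ is an infinitesimal harmonic transformation, that is, $\mathrm{tr}_g(L_\xi\nabla)=0$; 3. $M$ is $H$-paracontact, that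 is, $\xi$ is a harmonic vector field: for every relatively compact open set $D\subset M$, $\xi$ is a critical point of the energy $E_D(V)=\frac12\int_D \mathrm{tr}_g(V^*g^s)\,dv_g$ ($g^s$ the Sasaki metric on $TM$) with respect to all smooth variations of $\xi$ through vector fields $V$ with $g(V,V)=1$ that agree with $\xi$ outside a compact subset of $D$; 4. $\lambda=-2n$. In particular, for $n\ge1$, $\lambda<0$, that is, the soliton is expanding. -/

import Mathlib

open scoped Manifold ContDiff Bundle Topology
open Bundle Set MeasureTheory

noncomputable section

/-! ## Pseudo-Riemannian metrics -/

/-- A (not necessarily smooth) vector field on an `m`-dimensional manifold. -/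
abbrev VField (m : ℕ) (M : Type*) [TopologicalSpace M]
    [ChartedSpace (EuclideanSpace ℝ (Fin m)) M] : Type _ :=
  (x : M) → TangentSpace (𝓡 m) x

/-- Smoothness of a vector field. -/
def IsSmoothField {m : ℕ} {M : Type*} [TopologicalSpace M]
    [ChartedSpace (EuclideanSpace ℝ (Fin m)) M] [IsManifold (𝓡 m) ∞ M] (X : VField m M) : Prop :=
  ContMDiff (𝓡 m) (𝓡 m).tangent ∞ (fun x => (⟨x, X x⟩ : TangentBundle (𝓡 m) M))

/-- Differentiability of a vector field at a point. -/
def IsDiffFieldAt {m : ℕ} {M : Type*} [TopologicalSpace M]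
    [ChartedSpace (EuclideanSpace ℝ (Fin m)) M] [IsManifold (𝓡 m) ∞ M] (X : VField m M)
    (x : M) : Prop :=
  MDifferentiableAt (𝓡 m) (𝓡 m).tangent (fun y => (⟨y, X y⟩ : TangentBundle (𝓡 m) M)) x

/-- A smooth pseudo-Riemannian (semi-Riemannian) metric: a smooth field of symmetric nondegenerate
bilinear forms on the tangent spaces. No signature is prescribed. -/
structure PseudoRiemannianMetric (m : ℕ) (M : Type*) [TopologicalSpace M]
    [ChartedSpace (EuclideanSpace ℝ (Fin m)) M] [IsManifold (𝓡 m) ∞ M] where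
  inner (x : M) : TangentSpace (𝓡 m) x →L[ℝ] TangentSpace (𝓡 m) x →L[ℝ] ℝ
  symm (x : M) (v w : TangentSpace (𝓡 m) x) : inner x v w = inner x w v
  nondegenerate (x : M) (v : TangentSpace (𝓡 m) x) (hv : ∀ w, inner x v w = 0) : v = 0
  contMDiff : ContMDiff (𝓡 m)
    ((𝓡 m).prod 𝓘(ℝ, EuclideanSpace ℝ (Fin m) →L[ℝ] EuclideanSpace ℝ (Fin m) →L[ℝ] ℝ)) ∞
    (fun x => TotalSpace.mk' (EuclideanSpace ℝ (Fin m) →L[ℝ] EuclideanSpace ℝ (Fin m) →L[ℝ] ℝ)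
      (E := fun x : M => TangentSpace (𝓡 m) x →L[ℝ] TangentSpace (𝓡 m) x →L[ℝ] ℝ) x (inner x))

namespace PseudoRiemannianMetric

variable {m : ℕ} {M : Type*} [TopologicalSpace M]
  [ChartedSpace (EuclideanSpace ℝ (Fin m)) M] [IsManifold (𝓡 m) ∞ M]
  (g : PseudoRiemannianMetric m M)

/-- The function `g(X, Y)` attached to two vector fields. -/
def pair (X Y : VField m M) (x : M) : ℝ := g.inner x (X x) (Y x)

lemma pair_comm (X Y : VField m M) : g.pair X Y = g.pair Y X := by
  funext x; exact g.symm x _ _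

lemma mdifferentiableAt_pair {X Y : VField m M} {x : M}
    (hX : IsDiffFieldAt X x) (hY : IsDiffFieldAt Y x) :
    MDifferentiableAt (𝓡 m) 𝓘(ℝ, ℝ) (g.pair X Y) x := by
  have h := MDifferentiableAt.clm_bundle_apply₂ (IM := 𝓡 m) (IB := 𝓡 m)
    (F₁ := EuclideanSpace ℝ (Fin m)) (F₂ := EuclideanSpace ℝ (Fin m)) (F₃ := ℝ)
    (E₁ := fun x : M => TangentSpace (𝓡 m) x) (E₂ := fun x : M => TangentSpace (𝓡 m) x)
    (E₃ := Bundle.Trivial M ℝ) (b := fun x : M => x)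
    (g.contMDiff.contMDiffAt.mdifferentiableAt (by simp)) hX hY
  simp only [mdifferentiableAt_totalSpace] at h
  exact h.2

/-- The underlying bilinear form on `T_x M`. -/
def bilin (x : M) : LinearMap.BilinForm ℝ (TangentSpace (𝓡 m) x) :=
  LinearMap.mk₂ ℝ (fun v w => g.inner x v w) (by simp) (by simp) (by simp) (by simp)

lemma bilin_apply (x : M) (v w : TangentSpace (𝓡 m) x) : g.bilin x v w = g.inner x v w := rfl

instance instFiniteDimensionalTangentSpace (x : M) : FiniteDimensional ℝ (TangentSpace (𝓡 m) x) :=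
  inferInstanceAs (FiniteDimensional ℝ (EuclideanSpace ℝ (Fin m)))

instance instT2SpaceTangentSpace (x : M) : T2Space (TangentSpace (𝓡 m) x) :=
  inferInstanceAs (T2Space (EuclideanSpace ℝ (Fin m)))

lemma bilin_nondegenerate (x : M) : (g.bilin x).Nondegenerate :=
  ⟨fun v hv => g.nondegenerate x v hv,
    fun v hv => g.nondegenerate x v fun w => (g.symm x v w).trans (hv w)⟩

/-- The musical isomorphism `♯ : T_x^* M → T_x M`, `g(♯α, w) = α(w)`. -/
def sharp (x : M) : (TangentSpace (𝓡 m) x →L[ℝ] ℝ) →ₗ[ℝ] TangentSpace (𝓡 m) x :=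
  ((g.bilin x).toDual (g.bilin_nondegenerate x)).symm.toLinearMap ∘ₗ
    (ContinuousLinearMap.coeLM ℝ)

lemma inner_sharp (x : M) (α : TangentSpace (𝓡 m) x →L[ℝ] ℝ) (w : TangentSpace (𝓡 m) x) :
    g.inner x (g.sharp x α) w = α w := by
  rw [← bilin_apply]
  exact LinearMap.BilinForm.apply_toDual_symm_apply (hB := g.bilin_nondegenerate x) _ _

lemma ext_inner {x : M} {v w : TangentSpace (𝓡 m) x} (h : ∀ u, g.inner x v u = g.inner x w u) :
    v = w := by
  rw [← sub_eq_zero]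
  exact g.nondegenerate x _ fun u => by simp [h u]

/-! ## The Levi-Civita connection -/

/-- Right-hand side of the Koszul formula for `2 g(∇_X Y, Z)`. -/
def koszul (X Y Z : VField m M) (x : M) : ℝ :=
  mvfderiv (𝓡 m) (g.pair Y Z) x (X x) + mvfderiv (𝓡 m) (g.pair Z X) x (Y x)
    - mvfderiv (𝓡 m) (g.pair X Y) x (Z x)
    + g.inner x (VectorField.mlieBracket (𝓡 m) X Y x) (Z x)
    - g.inner x (VectorField.mlieBracket (𝓡 m) Y Z x) (X x)
    + g.inner x (VectorField.mlieBracket (𝓡 m) Z X x) (Y x)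

lemma pair_add_left (X X' Y : VField m M) : g.pair (X + X') Y = g.pair X Y + g.pair X' Y := by
  funext x; simp [pair]

lemma pair_add_right (X Y Y' : VField m M) : g.pair X (Y + Y') = g.pair X Y + g.pair X Y' := by
  funext x; simp [pair]

lemma pair_smul_left (f : M → ℝ) (X Y : VField m M) : g.pair (f • X) Y = f * g.pair X Y := by
  funext x; simp [pair]

lemma pair_smul_right (f : M → ℝ) (X Y : VField m M) : g.pair X (f • Y) = f * g.pair X Y := by
  funext x; simp [pair]

lemma koszul_tensorial_left {Y Z : VField m M} {x : M}
    (hY : IsDiffFieldAt Y x) (hZ : IsDiffFieldAt Z x) :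
    TensorialAt (𝓡 m) (EuclideanSpace ℝ (Fin m)) (fun X : VField m M => g.koszul X Y Z x) x where
  smul := by
    intro f X hf hX
    have h1 := g.mdifferentiableAt_pair hZ hX
    have h2 := g.mdifferentiableAt_pair hX hY
    simp only [koszul, pair_smul_left, pair_smul_right, mvfderiv_mul hf h1, mvfderiv_mul hf h2,
      VectorField.mlieBracket_smul_left hf hX, VectorField.mlieBracket_smul_right hf hX]
    simp [pair, g.symm x (Z x)]
    ring
  add := by
    intro X X' hX hX'
    simp only [koszul, pair_add_left, pair_add_right,
      mvfderiv_add (g.mdifferentiableAt_pair hZ hX) (g.mdifferentiableAt_pair hZ hX'),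
      mvfderiv_add (g.mdifferentiableAt_pair hX hY) (g.mdifferentiableAt_pair hX' hY),
      VectorField.mlieBracket_add_left hX hX', VectorField.mlieBracket_add_right hX hX']
    simp
    ring

lemma koszul_tensorial_right {X Y : VField m M} {x : M}
    (hX : IsDiffFieldAt X x) (hY : IsDiffFieldAt Y x) :
    TensorialAt (𝓡 m) (EuclideanSpace ℝ (Fin m)) (fun Z : VField m M => g.koszul X Y Z x) x where
  smul := by
    intro f Z hf hZ
    have h1 := g.mdifferentiableAt_pair hZ hX
    have h2 := g.mdifferentiableAt_pair hY hZ
    simp only [koszul, pair_smul_left, pair_smul_right, mvfderiv_mul hf h1, mvfderiv_mul hf h2,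
      VectorField.mlieBracket_smul_left hf hZ, VectorField.mlieBracket_smul_right hf hZ]
    simp [pair, g.symm x (Z x)]
    ring
  add := by
    intro Z Z' hZ hZ'
    simp only [koszul, pair_add_left, pair_add_right,
      mvfderiv_add (g.mdifferentiableAt_pair hZ hX) (g.mdifferentiableAt_pair hZ' hX),
      mvfderiv_add (g.mdifferentiableAt_pair hY hZ) (g.mdifferentiableAt_pair hY hZ'),
      VectorField.mlieBracket_add_left hZ hZ', VectorField.mlieBracket_add_right hZ hZ']
    simp
    ring

lemma koszul_add_middle {X Y Y' Z : VField m M} {x : M} (hX : IsDiffFieldAt X x)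
    (hY : IsDiffFieldAt Y x) (hY' : IsDiffFieldAt Y' x) (hZ : IsDiffFieldAt Z x) :
    g.koszul X (Y + Y') Z x = g.koszul X Y Z x + g.koszul X Y' Z x := by
  simp only [koszul, pair_add_left, pair_add_right,
    mvfderiv_add (g.mdifferentiableAt_pair hY hZ) (g.mdifferentiableAt_pair hY' hZ),
    mvfderiv_add (g.mdifferentiableAt_pair hX hY) (g.mdifferentiableAt_pair hX hY'),
    VectorField.mlieBracket_add_left hY hY', VectorField.mlieBracket_add_right hY hY']
  simp
  ring

lemma koszul_smul_middle {X Y Z : VField m M} {f : M → ℝ} {x : M} (hX : IsDiffFieldAt X x)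
    (hf : MDifferentiableAt (𝓡 m) 𝓘(ℝ, ℝ) f x) (hY : IsDiffFieldAt Y x)
    (hZ : IsDiffFieldAt Z x) :
    g.koszul X (f • Y) Z x =
      f x * g.koszul X Y Z x + 2 * (mvfderiv (𝓡 m) f x (X x) * g.inner x (Y x) (Z x)) := by
  have h1 := g.mdifferentiableAt_pair hX hY
  have h2 := g.mdifferentiableAt_pair hY hZ
  simp only [koszul, pair_smul_left, pair_smul_right, mvfderiv_mul hf h1, mvfderiv_mul hf h2,
    VectorField.mlieBracket_smul_left hf hY, VectorField.mlieBracket_smul_right hf hY]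
  simp [pair, g.symm x (X x)]
  ring

open Classical in
/-- The Koszul form at `x` as a bilinear form in the values of `X` and `Z`, for `Y` differentiable
at `x`. -/
def koszulForm (Y : VField m M) (x : M) :
    TangentSpace (𝓡 m) x →L[ℝ] TangentSpace (𝓡 m) x →L[ℝ] ℝ :=
  if hY : IsDiffFieldAt Y x then
    TensorialAt.mkHom₂ (I := 𝓡 m) (F := EuclideanSpace ℝ (Fin m))
      (F' := EuclideanSpace ℝ (Fin m)) (fun X Z : VField m M => g.koszul X Y Z x) x
      (fun _ hZ => g.koszul_tensorial_left hY hZ) (fun _ hX => g.koszul_tensorial_right hX hY)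
  else 0

lemma koszulForm_apply {X Y Z : VField m M} {x : M} (hX : IsDiffFieldAt X x)
    (hY : IsDiffFieldAt Y x) (hZ : IsDiffFieldAt Z x) :
    g.koszulForm Y x (X x) (Z x) = g.koszul X Y Z x := by
  rw [koszulForm, dif_pos hY]
  exact TensorialAt.mkHom₂_apply (Φ := fun X Z : VField m M => g.koszul X Y Z x) _ _ hX hZ

/-- The Levi-Civita covariant derivative, as an operation on all vector fields: `∇_v Y` is the
vector with `2 g(∇_v Y, w)` given by the Koszul formula. The argument order is that of
`CovariantDerivative`: `leviCivitaFun Y x v` is `∇_v Y` at `x`. -/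
def leviCivitaFun (Y : VField m M) (x : M) : TangentSpace (𝓡 m) x →L[ℝ] TangentSpace (𝓡 m) x :=
  LinearMap.toContinuousLinearMap
    (((1 / 2 : ℝ) • g.sharp x) ∘ₗ (g.koszulForm Y x).toLinearMap)

lemma inner_leviCivitaFun_form (Y : VField m M) (x : M) (v w : TangentSpace (𝓡 m) x) :
    g.inner x (g.leviCivitaFun Y x v) w = (1 / 2) * g.koszulForm Y x v w := by
  simp [leviCivitaFun, inner_sharp]

/-- The Koszul formula. -/
lemma inner_leviCivitaFun {X Y Z : VField m M} {x : M} (hX : IsDiffFieldAt X x)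
    (hY : IsDiffFieldAt Y x) (hZ : IsDiffFieldAt Z x) :
    g.inner x (g.leviCivitaFun Y x (X x)) (Z x) = (1 / 2) * g.koszul X Y Z x := by
  rw [inner_leviCivitaFun_form, g.koszulForm_apply hX hY hZ]

/-- Some local smooth extension of a tangent vector to a vector field. -/
def ext {x : M} (v : TangentSpace (𝓡 m) x) : VField m M :=
  FiberBundle.extend (EuclideanSpace ℝ (Fin m)) v

lemma ext_self {x : M} (v : TangentSpace (𝓡 m) x) : ext v x = v := by
  simp [ext]

lemma isDiffFieldAt_ext {x : M} (v : TangentSpace (𝓡 m) x) : IsDiffFieldAt (ext v) x :=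
  FiberBundle.mdifferentiableAt_extend ..

/-- The Levi-Civita connection of a pseudo-Riemannian metric. -/
def leviCivita :
    CovariantDerivative (𝓡 m) (EuclideanSpace ℝ (Fin m)) (TangentSpace (𝓡 m) : M → Type _) where
  toFun := g.leviCivitaFun
  isCovariantDerivativeOnUniv :=
    { add := by
        intro Y Y' x hY hY' _
        ext1 v
        refine g.ext_inner fun w => ?_
        have := g.koszul_add_middle (isDiffFieldAt_ext v) hY hY' (isDiffFieldAt_ext w)
        have hs : IsDiffFieldAt (Y + Y') x := mdifferentiableAt_add_section hY hY'
        rw [← ext_self v, ← ext_self w, g.inner_leviCivitaFun (isDiffFieldAt_ext v) hs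
          (isDiffFieldAt_ext w), this]
        simp only [add_apply, map_add]
        rw [g.inner_leviCivitaFun (isDiffFieldAt_ext v) hY (isDiffFieldAt_ext w),
          g.inner_leviCivitaFun (isDiffFieldAt_ext v) hY' (isDiffFieldAt_ext w)]
        ring
      leibniz := by
        intro Y f x hY hf _
        ext1 v
        refine g.ext_inner fun w => ?_
        have := g.koszul_smul_middle (isDiffFieldAt_ext v) hf hY (isDiffFieldAt_ext w)
        have hs : IsDiffFieldAt (f • Y) x := hf.smul_section hY
        rw [← ext_self v, ← ext_self w, g.inner_leviCivitaFun (isDiffFieldAt_ext v) hs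
          (isDiffFieldAt_ext w), this]
        simp only [add_apply, map_add, smul_apply, map_smul,
          ContinuousLinearMap.smulRight_apply, smul_eq_mul]
        rw [g.inner_leviCivitaFun (isDiffFieldAt_ext v) hY (isDiffFieldAt_ext w)]
        ring }

/-- The Levi-Civita connection is torsion-free. -/
theorem leviCivita_torsion : g.leviCivita.torsion = 0 := by
  rw [CovariantDerivative.torsion_eq_zero_iff]
  intro X Y x hX hY
  refine g.ext_inner fun w => ?_
  have hw := isDiffFieldAt_ext w
  have h1 := g.inner_leviCivitaFun hX hY hw
  have h2 := g.inner_leviCivitaFun hY hX hw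
  have e : ∀ v, g.inner x (g.leviCivita.toFun v x (X x)) = g.inner x (g.leviCivitaFun v x (X x)) :=
    fun _ => rfl
  change g.inner x (g.leviCivitaFun Y x (X x) - g.leviCivitaFun X x (Y x)) w = _
  rw [← ext_self w]
  simp only [map_sub, sub_apply]
  rw [h1, h2]
  simp only [koszul]
  rw [g.pair_comm (ext w) X, g.pair_comm (ext w) Y, g.pair_comm Y X,
    VectorField.mlieBracket_swap_apply (V := Y) (W := X),
    VectorField.mlieBracket_swap_apply (V := X) (W := ext w),
    VectorField.mlieBracket_swap_apply (V := ext w) (W := Y)]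
  simp
  ring

/-- The Levi-Civita connection is metric: `X g(Y, Z) = g(∇_X Y, Z) + g(Y, ∇_X Z)`. -/
theorem leviCivita_metric {Y Z : VField m M} {x : M} (v : TangentSpace (𝓡 m) x)
    (hY : IsDiffFieldAt Y x) (hZ : IsDiffFieldAt Z x) :
    mvfderiv (𝓡 m) (g.pair Y Z) x v =
      g.inner x (g.leviCivita Y x v) (Z x) + g.inner x (Y x) (g.leviCivita Z x v) := by
  have hv := isDiffFieldAt_ext v
  have h1 := g.inner_leviCivitaFun hv hY hZ
  have h2 := g.inner_leviCivitaFun hv hZ hY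
  change _ = g.inner x (g.leviCivitaFun Y x v) (Z x) + g.inner x (Y x) (g.leviCivitaFun Z x v)
  rw [g.symm x (Y x)]
  rw [ext_self] at h1 h2
  rw [h1, h2]
  simp only [koszul]
  rw [g.pair_comm Z Y, g.pair_comm (ext v) Y, g.pair_comm (ext v) Z,
    VectorField.mlieBracket_swap_apply (V := Z) (W := Y),
    VectorField.mlieBracket_swap_apply (V := Y) (W := ext v),
    VectorField.mlieBracket_swap_apply (V := ext v) (W := Z)]
  simp [ext_self]
  ring

/-- The vector field `∇_X Y` of the Levi-Civita connection. -/
def nabla (X Y : VField m M) : VField m M := fun x => g.leviCivita Y x (X x)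

/-! ## Traces -/

/-- A basis of the tangent space `T_x M`. -/
def frame (x : M) : Module.Basis (Fin m) ℝ (TangentSpace (𝓡 m) x) :=
  (EuclideanSpace.basisFun (Fin m) ℝ).toBasis

/-- The `g`-dual basis `(e^i)` of the basis `(e_i)` of `T_x M`: `g(e^i, e_j) = δ_ij`. -/
def dualFrame (x : M) : Module.Basis (Fin m) ℝ (TangentSpace (𝓡 m) x) :=
  (g.bilin x).dualBasis (g.bilin_nondegenerate x) (frame x)

/-- The metric trace `∑ B(e_i, e^i)` of a (possibly vector-valued) bilinear map `B` on `T_x M`. For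
bilinear `B` it does not depend on the basis, and it is `∑ ε_i B(E_i, E_i)` in a pseudo-orthonormal
basis `(E_i)` with `ε_i = g(E_i, E_i)`. -/
def metricTrace {W : Type*} [AddCommMonoid W] (x : M)
    (B : TangentSpace (𝓡 m) x → TangentSpace (𝓡 m) x → W) : W :=
  ∑ i, B (frame x i) (g.dualFrame x i)

/-! ## Curvature -/

/-- The curvature `R(X, Y) Z = ∇_{[X, Y]} Z - [∇_X, ∇_Y] Z`. -/
def curvature (X Y Z : VField m M) : VField m M :=
  g.nabla (VectorField.mlieBracket (𝓡 m) X Y) Z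
    - (g.nabla X (g.nabla Y Z) - g.nabla Y (g.nabla X Z))

/-- The Ricci tensor `ϱ(u, w) = ∑ ε_i g(R(u, E_i) w, E_i)`. The curvature being tensorial, its value
on tangent vectors is computed on smooth extensions of them. -/
def ricci (x : M) (u w : TangentSpace (𝓡 m) x) : ℝ :=
  g.metricTrace x fun a b => g.inner x (g.curvature (ext u) (ext a) (ext w) x) b

/-- The Ricci operator `Q`, given by `g(Q u, w) = ϱ(u, w)`. -/
def ricciOp (x : M) (u : TangentSpace (𝓡 m) x) : TangentSpace (𝓡 m) x :=
  g.metricTrace x fun a b => g.ricci x u a • b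

/-! ## Lie derivatives, Ricci solitons, infinitesimal harmonic transformations -/

/-- `(L_V g)(X, Y) = V g(X, Y) - g([V, X], Y) - g(X, [V, Y])`. -/
def lieMetric (V X Y : VField m M) (x : M) : ℝ :=
  mvfderiv (𝓡 m) (g.pair X Y) x (V x)
    - g.inner x (VectorField.mlieBracket (𝓡 m) V X x) (Y x)
    - g.inner x (X x) (VectorField.mlieBracket (𝓡 m) V Y x)

/-- `(g, V, λ)` is a Ricci soliton: `ϱ + (1/2) L_V g = λ g`. -/
def IsRicciSoliton (V : VField m M) (lam : ℝ) : Prop :=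
  IsSmoothField V ∧ ∀ (x : M) (X Y : VField m M), IsDiffFieldAt X x → IsDiffFieldAt Y x →
    g.ricci x (X x) (Y x) + (1 / 2) * g.lieMetric V X Y x = lam * g.inner x (X x) (Y x)

/-- The Lie derivative of the Levi-Civita connection,
`(L_V ∇)(X, Y) = [V, ∇_X Y] - ∇_{[V, X]} Y - ∇_X [V, Y]`. -/
def lieConnection (V X Y : VField m M) : VField m M :=
  VectorField.mlieBracket (𝓡 m) V (g.nabla X Y)
    - g.nabla (VectorField.mlieBracket (𝓡 m) V X) Y
    - g.nabla X (VectorField.mlieBracket (𝓡 m) V Y)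

/-- `V` is an infinitesimal harmonic transformation: `tr (L_V ∇) = 0`. -/
def IsInfinitesimalHarmonic (V : VField m M) : Prop :=
  IsSmoothField V ∧ ∀ x : M, g.metricTrace x (fun a b => g.lieConnection V (ext a) (ext b) x) = 0

/-! ## The pseudo-Riemannian volume -/

/-- The density `√|det (g(∂_i, ∂_j))|` of `g` in the preferred chart at `c`, at the point of the
chart with coordinates `y`. -/
def volumeDensity (c : M) (y : EuclideanSpace ℝ (Fin m)) : ℝ :=
  let D := mfderiv 𝓘(ℝ, EuclideanSpace ℝ (Fin m)) (𝓡 m)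
    (chartAt (EuclideanSpace ℝ (Fin m)) c).symm y
  Real.sqrt |(Matrix.of fun i j : Fin m =>
    g.inner ((chartAt (EuclideanSpace ℝ (Fin m)) c).symm y)
      (D (EuclideanSpace.single i 1)) (D (EuclideanSpace.single j 1))).det|

/-- A smooth partition of unity subordinate to the preferred charts. -/
def chartPartition (m : ℕ) (M : Type*) [TopologicalSpace M]
    [ChartedSpace (EuclideanSpace ℝ (Fin m)) M] [IsManifold (𝓡 m) ∞ M] [T2Space M]
    [SigmaCompactSpace M] : SmoothPartitionOfUnity M (𝓡 m) M univ :=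
  Classical.choose (SmoothPartitionOfUnity.exists_isSubordinate_chartAt_source (𝓡 m) M)

/-- The volume measure `dv` of `g`: in coordinates it is `√|det g_ij| dy`. The local measures are
glued by a partition of unity; the result does not depend on the partition. -/
def volumeMeasure [T2Space M] [SigmaCompactSpace M] [MeasurableSpace M] : Measure M :=
  Measure.sum fun c : M =>
    (((volume : Measure (EuclideanSpace ℝ (Fin m))).restrict
        (chartAt (EuclideanSpace ℝ (Fin m)) c).target).withDensity fun y =>
          ENNReal.ofReal (chartPartition m M c ((chartAt (EuclideanSpace ℝ (Fin m)) c).symm y)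
            * g.volumeDensity c y)).map
      (chartAt (EuclideanSpace ℝ (Fin m)) c).symm

/-! ## Energy and harmonic vector fields -/

/-- The pull-back `V^* g^s` of the Sasaki metric `g^s` by a vector field `V : M → TM`. The
horizontal and vertical parts of `dV(u)` are the lifts of `u` and of `∇_u V`, hence
`(V^* g^s)(u, w) = g(u, w) + g(∇_u V, ∇_w V)`. -/
def sasakiPullback (V : VField m M) (x : M) (u w : TangentSpace (𝓡 m) x) : ℝ :=
  g.inner x u w + g.inner x (g.leviCivita V x u) (g.leviCivita V x w)

/-- The energy `E_D(V) = (1/2) ∫_D tr_g (V^* g^s) dv` of `V` over `D`. -/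
def energy [T2Space M] [SigmaCompactSpace M] [MeasurableSpace M] (D : Set M) (V : VField m M) : ℝ :=
  (1 / 2) * ∫ x in D, g.metricTrace x (g.sasakiPullback V x) ∂g.volumeMeasure

/-- `V` has constant length: `‖V‖² = r`. -/
def HasSquaredLength (V : VField m M) (r : ℝ) : Prop := ∀ x, g.inner x (V x) (V x) = r

/-- `W` is a smooth variation `(W_t)`, `|t| < ε`, of `V` through vector fields with `‖W_t‖² = r`,
which agrees with `V` off a compact subset of `D`. -/
structure IsVariation (V : VField m M) (r : ℝ) (D : Set M) (ε : ℝ) (W : ℝ → VField m M) :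
    Prop where
  smooth : ContMDiffOn (𝓘(ℝ, ℝ).prod (𝓡 m)) (𝓡 m).tangent ∞
    (fun p : ℝ × M => (⟨p.2, W p.1 p.2⟩ : TangentBundle (𝓡 m) M)) (Ioo (-ε) ε ×ˢ univ)
  zero : W 0 = V
  length : ∀ t ∈ Ioo (-ε) ε, g.HasSquaredLength (W t) r
  support : ∃ K : Set M, IsCompact K ∧ K ⊆ D ∧ ∀ t ∈ Ioo (-ε) ε, ∀ x ∉ K, W t x = V x

/-- `V` is a harmonic vector field: it is smooth, of constant squared length `r ≠ 0`, and a critical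
point of the energy restricted to the vector fields of squared length `r`; the energy is taken over
relatively compact open sets `D`, with variations supported in `D` (if `M` is compact, `D = M` is
allowed). -/
def IsHarmonicField [T2Space M] [SigmaCompactSpace M] [MeasurableSpace M] (V : VField m M) : Prop :=
  IsSmoothField V ∧ ∃ r : ℝ, r ≠ 0 ∧ g.HasSquaredLength V r ∧
    ∀ (D : Set M), IsOpen D → IsCompact (closure D) → ∀ ε > 0, ∀ W : ℝ → VField m M,
      g.IsVariation V r D ε W → HasDerivAt (fun t => g.energy D (W t)) 0 0

end PseudoRiemannianMetric

/-! ## Paracontact metric manifolds -/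

/-- The exterior derivative of a one-form, with the convention
`2 dη(X, Y) = X η(Y) - Y η(X) - η([X, Y])`. -/
def oneFormDeriv {m : ℕ} {M : Type*} [TopologicalSpace M]
    [ChartedSpace (EuclideanSpace ℝ (Fin m)) M] [IsManifold (𝓡 m) ∞ M]
    (η : (x : M) → TangentSpace (𝓡 m) x →L[ℝ] ℝ) (X Y : VField m M) (x : M) : ℝ :=
  (1 / 2) * (mvfderiv (𝓡 m) (fun y => η y (Y y)) x (X x)
    - mvfderiv (𝓡 m) (fun y => η y (X y)) x (Y x)
    - η x (VectorField.mlieBracket (𝓡 m) X Y x))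

/-- A paracontact metric structure `(φ, ξ, η, g)` on a `(2n+1)`-dimensional manifold. The one-form
`η = g(ξ, ·)` is automatically smooth, and the contact condition `η ∧ (dη)ⁿ ≠ 0`, that is, the
nondegeneracy of `dη` on `ker η`, follows from the axioms: see
`ParacontactMetricStructure.contact`. -/
structure ParacontactMetricStructure (n : ℕ) (M : Type*) [TopologicalSpace M]
    [ChartedSpace (EuclideanSpace ℝ (Fin (2 * n + 1))) M] [IsManifold (𝓡 (2 * n + 1)) ∞ M] where
  g : PseudoRiemannianMetric (2 * n + 1) M
  φ : (x : M) → TangentSpace (𝓡 (2 * n + 1)) x →L[ℝ] TangentSpace (𝓡 (2 * n + 1)) x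
  ξ : VField (2 * n + 1) M
  η : (x : M) → TangentSpace (𝓡 (2 * n + 1)) x →L[ℝ] ℝ
  contMDiff_φ : ContMDiff (𝓡 (2 * n + 1))
    ((𝓡 (2 * n + 1)).prod 𝓘(ℝ, EuclideanSpace ℝ (Fin (2 * n + 1)) →L[ℝ]
      EuclideanSpace ℝ (Fin (2 * n + 1)))) ∞
    (fun x => TotalSpace.mk' (EuclideanSpace ℝ (Fin (2 * n + 1)) →L[ℝ]
      EuclideanSpace ℝ (Fin (2 * n + 1)))
      (E := fun x : M => TangentSpace (𝓡 (2 * n + 1)) x →L[ℝ] TangentSpace (𝓡 (2 * n + 1)) x)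
      x (φ x))
  smooth_ξ : IsSmoothField ξ
  η_ξ : ∀ x, η x (ξ x) = 1
  dη_ξ : ∀ (x : M) (Y : VField (2 * n + 1) M), IsDiffFieldAt Y x → oneFormDeriv η ξ Y x = 0
  η_eq : ∀ x v, η x v = g.inner x (ξ x) v
  dη_eq : ∀ (x : M) (X Y : VField (2 * n + 1) M), IsDiffFieldAt X x → IsDiffFieldAt Y x →
    oneFormDeriv η X Y x = g.inner x (X x) (φ x (Y x))
  φ_sq : ∀ x v, φ x (φ x v) = v - η x v • ξ x

namespace ParacontactMetricStructure

variable {n : ℕ} {M : Type*} [TopologicalSpace M]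
  [ChartedSpace (EuclideanSpace ℝ (Fin (2 * n + 1))) M] [IsManifold (𝓡 (2 * n + 1)) ∞ M]

/-- The contact condition: `dη` is nondegenerate on `ker η`. -/
theorem contact (S : ParacontactMetricStructure n M) (x : M) (X : VField (2 * n + 1) M)
    (hX : IsDiffFieldAt X x) (h0 : S.η x (X x) = 0)
    (h : ∀ Y : VField (2 * n + 1) M, IsDiffFieldAt Y x → S.η x (Y x) = 0 →
      oneFormDeriv S.η X Y x = 0) : X x = 0 := by
  -- first, `φ ξ = 0` and `η ∘ φ = 0`
  have h3 : ∀ v, S.η x v • S.φ x (S.ξ x) = S.η x (S.φ x v) • S.ξ x := by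
    intro v
    have e := S.φ_sq x (S.φ x v)
    rw [S.φ_sq x v, map_sub, map_smul] at e
    exact sub_right_injective e
  have hc := h3 (S.ξ x)
  rw [S.η_ξ, one_smul] at hc
  have hcc : S.φ x (S.φ x (S.ξ x)) = 0 := by rw [S.φ_sq, S.η_ξ, one_smul, sub_self]
  have hηξ : S.η x (S.φ x (S.ξ x)) = 0 := by
    have e := congrArg (S.η x) hcc
    rw [hc, map_smul, hc] at e
    simpa [S.η_ξ] using e
  have hξ : S.φ x (S.ξ x) = 0 := by rw [hc, hηξ, zero_smul]
  have hφ : ∀ v, S.η x (S.φ x v) = 0 := by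
    intro v
    have e := congrArg (S.η x) (h3 v)
    simpa [hξ, S.η_ξ] using e.symm
  refine S.g.nondegenerate x _ fun w => ?_
  have hY := PseudoRiemannianMetric.isDiffFieldAt_ext (S.φ x w)
  have e := S.dη_eq x X _ hX hY
  rw [h _ hY (by rw [PseudoRiemannianMetric.ext_self]; exact hφ w),
    PseudoRiemannianMetric.ext_self, S.φ_sq] at e
  have h1 : S.g.inner x (X x) (S.ξ x) = 0 := by rw [S.g.symm, ← S.η_eq, h0]
  simpa [h1] using e.symm

/-- A paracontact metric manifold is `H`-paracontact if its Reeb vector field is harmonic. -/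
def IsHParacontact [T2Space M] [SigmaCompactSpace M] [MeasurableSpace M]
    (S : ParacontactMetricStructure n M) : Prop :=
  S.g.IsHarmonicField S.ξ

/-- A paracontact Ricci soliton with constant `λ`: the Ricci soliton equation holds for the Reeb
vector field. -/
def IsRicciSoliton (S : ParacontactMetricStructure n M) (lam : ℝ) : Prop :=
  S.g.IsRicciSoliton S.ξ lam

end ParacontactMetricStructure

end

noncomputable section

set_option maxSynthPendingDepth 3

/-! ## Pseudo-Riemannian geometry on an open subset of a vector space -/

namespace FlatModel

variable {E : Type*} [NormedAddCommGroup E] [NormedSpace ℝ E]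

/-! Write A = ∇ξ and let A* be its adjoint. The relation dη = g(·, φ·) says A* = A + 2φ, so S = A +
φ is self-adjoint, φ is skew, A = S - φ, and (1/2) L_ξ g = g(S·, ·). The soliton equation becomes
Ric = λ g - g(S·, ·). Moreover Aξ = φξ = 0, hence Sξ = 0 and Qξ = λξ.

Three divergences determine the rest. (a) tr S = 0: closedness of dη gives ∇_ξφ = -(Sφ + φS), and
differentiating φ² = I - η ⊗ ξ along ξ then gives Sφ² + 2φSφ + φ²S = 0, whose trace is 4 tr S
(`tr_symm`). The scalar curvature is therefore constant, and the contracted second Bianchi identity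
yields div S = 0 (`divEnd_eq_zero_of_ricci`). (b) div φ = -2n ξ, from contracting the closedness of
dη with φ (`divEnd_phi`). (c) The contracted Ricci identity, with tr A = 0, gives Ric(·, ξ) = g(·,
div A*) (`ricci_reeb`). Since A* = S + φ, comparison gives λξ = div S + div φ = -2n ξ, so λ = -2n.
Since A = S - φ, also div A = -λξ (`soliton_constant`).

The trace of L_ξ∇ is div A + Qξ = -λξ + λξ = 0. For harmonicity, let V be the velocity of a
variation through unit fields; then g(V, ξ) = 0. The energy density has derivative 2 ∑ g(∇_{e_i} V,
A e^i) = 2 div(A*V) - 2 g(V, div A) at ξ, before the factor 1/2 in the energy. The last term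
vanishes because div A is a multiple of ξ, and the divergence theorem disposes of the first.

The tensor calculus is done on open subsets of a vector space, with the metric and its Christoffel
symbols as functions; charts transport every object of the statement there. The divergence theorem
is proved for the volume measure glued from charts: the logarithmic derivative of √|det g_ij| is the
trace of the connection, and chart integrals agree on overlaps by change of variables. -/

/-- A metric `G` on an open set `U` of a vector space, with its Christoffel symbols `Γ`. -/
structure IsLocalMetric (U : Set E) (G : E → E →L[ℝ] E →L[ℝ] ℝ)
    (Γ : E → E →L[ℝ] E →L[ℝ] E) : Prop where
  isOpen : IsOpen U
  smooth : ContDiffOn ℝ ∞ G U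
  smooth_conn : ContDiffOn ℝ ∞ Γ U
  symm : ∀ y ∈ U, ∀ a c, G y a c = G y c a
  nondeg : ∀ y ∈ U, ∀ a, (∀ c, G y a c = 0) → a = 0
  torsion : ∀ y ∈ U, ∀ a c, Γ y a c = Γ y c a
  compat : ∀ y ∈ U, ∀ u a c,
    fderiv ℝ G y u a c = G y (Γ y u a) c + G y a (Γ y u c)

/-- The curvature `[∇_u, ∇_v] w` of a connection in coordinates. -/
def curv (Γ : E → E →L[ℝ] E →L[ℝ] E) (y u v w : E) : E :=
  fderiv ℝ Γ y u v w - fderiv ℝ Γ y v u w + Γ y u (Γ y v w) - Γ y v (Γ y u w)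

/-- The covariant derivative of a vector field in coordinates. -/
def covVec (Γ : E → E →L[ℝ] E →L[ℝ] E) (X : E → E) (y : E) : E →L[ℝ] E :=
  fderiv ℝ X y + (Γ y).flip (X y)

/-- The covariant derivative of a field of endomorphisms in coordinates. -/
def covEnd (Γ : E → E →L[ℝ] E →L[ℝ] E) (B : E → E →L[ℝ] E) (y u : E) : E →L[ℝ] E :=
  fderiv ℝ B y u + Γ y u ∘L B y - B y ∘L Γ y u

lemma covVec_apply (Γ : E → E →L[ℝ] E →L[ℝ] E) (X : E → E) (y u : E) :
    covVec Γ X y u = fderiv ℝ X y u + Γ y u (X y) := rfl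

lemma covEnd_apply (Γ : E → E →L[ℝ] E →L[ℝ] E) (B : E → E →L[ℝ] E) (y u a : E) :
    covEnd Γ B y u a = fderiv ℝ B y u a + Γ y u (B y a) - B y (Γ y u a) := rfl

lemma hasFDerivAt_of_contDiffOn {F : Type*} [NormedAddCommGroup F] [NormedSpace ℝ F] {U : Set E}
    (hU : IsOpen U) {f : E → F} (hf : ContDiffOn ℝ ∞ f U) {y : E} (hy : y ∈ U) :
    HasFDerivAt f (fderiv ℝ f y) y :=
  ((hf.contDiffAt (hU.mem_nhds hy)).differentiableAt (by simp)).hasFDerivAt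

lemma hasFDerivAt_fderiv_of_contDiffOn {F : Type*} [NormedAddCommGroup F] [NormedSpace ℝ F]
    {U : Set E} (hU : IsOpen U) {f : E → F} (hf : ContDiffOn ℝ ∞ f U) {y : E} (hy : y ∈ U) :
    HasFDerivAt (fderiv ℝ f) (fderiv ℝ (fderiv ℝ f) y) y :=
  hasFDerivAt_of_contDiffOn hU (hf.fderiv_of_isOpen hU (by simp)) hy

lemma fderiv_fderiv_comm {F : Type*} [NormedAddCommGroup F] [NormedSpace ℝ F] {U : Set E}
    (hU : IsOpen U) {f : E → F} (hf : ContDiffOn ℝ ∞ f U) {y : E} (hy : y ∈ U) (u v : E) :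
    fderiv ℝ (fderiv ℝ f) y u v = fderiv ℝ (fderiv ℝ f) y v u :=
  ((hf.contDiffAt (hU.mem_nhds hy)).isSymmSndFDerivAt
    (by rw [minSmoothness_of_isRCLikeNormedField]
        exact WithTop.coe_le_coe.2 (le_top : (2 : ℕ∞) ≤ ⊤))).eq u v

/-- Two functions which agree on an open set have the same derivatives there. -/
lemma fderiv_apply_eq {F : Type*} [NormedAddCommGroup F] [NormedSpace ℝ F] {U : Set E}
    (hU : IsOpen U) {f f' : E → F} (h : ∀ y ∈ U, f y = f' y) {y : E} (hy : y ∈ U)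
    {L L' : E →L[ℝ] F} (hf : HasFDerivAt f L y) (hf' : HasFDerivAt f' L' y) (u : E) :
    L u = L' u := by
  have : f =ᶠ[𝓝 y] f' := by
    filter_upwards [hU.mem_nhds hy] with z hz using h z hz
  rw [hf.unique (hf'.congr_of_eventuallyEq this)]

variable {U : Set E} {G : E → E →L[ℝ] E →L[ℝ] ℝ} {Γ : E → E →L[ℝ] E →L[ℝ] E}

namespace IsLocalMetric

lemma hasFDerivAt_metric (h : IsLocalMetric U G Γ) {y : E} (hy : y ∈ U) :
    HasFDerivAt G (fderiv ℝ G y) y := hasFDerivAt_of_contDiffOn h.isOpen h.smooth hy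

lemma hasFDerivAt_conn (h : IsLocalMetric U G Γ) {y : E} (hy : y ∈ U) :
    HasFDerivAt Γ (fderiv ℝ Γ y) y := hasFDerivAt_of_contDiffOn h.isOpen h.smooth_conn hy

lemma ext_metric (h : IsLocalMetric U G Γ) {y : E} (hy : y ∈ U) {a a' : E}
    (H : ∀ c, G y a c = G y a' c) : a = a' := by
  rw [← sub_eq_zero]
  exact h.nondeg y hy _ fun c => by simp [H c]

lemma contDiffOn_covVec (h : IsLocalMetric U G Γ) {X : E → E} (hX : ContDiffOn ℝ ∞ X U) :
    ContDiffOn ℝ ∞ (covVec Γ X) U := by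
  refine (hX.fderiv_of_isOpen h.isOpen (by simp)).add ?_
  exact ((ContinuousLinearMap.flipₗᵢ ℝ E E E).contDiff.comp_contDiffOn h.smooth_conn).clm_apply hX

lemma fderiv_conn_symm (h : IsLocalMetric U G Γ) {y : E} (hy : y ∈ U) (u a c : E) :
    fderiv ℝ Γ y u a c = fderiv ℝ Γ y u c a := by
  have hΓ := h.hasFDerivAt_conn hy
  have := fderiv_apply_eq h.isOpen (f := fun z => Γ z a c) (f' := fun z => Γ z c a)
    (fun z hz => h.torsion z hz a c) hy
    ((hΓ.clm_apply (hasFDerivAt_const a y)).clm_apply (hasFDerivAt_const c y))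
    ((hΓ.clm_apply (hasFDerivAt_const c y)).clm_apply (hasFDerivAt_const a y)) u
  simpa using this

lemma curv_swap (Γ : E → E →L[ℝ] E →L[ℝ] E) (y u v w : E) :
    curv Γ y u v w = - curv Γ y v u w := by
  simp only [curv]; abel

/-- The first Bianchi identity. -/
lemma bianchi_first (h : IsLocalMetric U G Γ) {y : E} (hy : y ∈ U) (u v w : E) :
    curv Γ y u v w + curv Γ y v w u + curv Γ y w u v = 0 := by
  simp only [curv]
  rw [h.fderiv_conn_symm hy u v w, h.fderiv_conn_symm hy v u w, h.fderiv_conn_symm hy w u v,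
    h.torsion y hy v w, h.torsion y hy u w, h.torsion y hy v u]
  abel

/-- The curvature operators are skew-adjoint. -/
lemma curv_skew (h : IsLocalMetric U G Γ) {y : E} (hy : y ∈ U) (u v a c : E) :
    G y (curv Γ y u v a) c = - G y a (curv Γ y u v c) := by
  have hG := h.hasFDerivAt_metric hy
  have hΓ := h.hasFDerivAt_conn hy
  -- Differentiating the compatibility condition once more expresses the second derivatives of the
  -- metric through Γ and its derivative; their symmetry in `u`, `v` is the skewness of the
  -- curvature.
  have key : ∀ u v, fderiv ℝ (fderiv ℝ G) y u v a c =
      fderiv ℝ G y u (Γ y v a) c + G y (fderiv ℝ Γ y u v a) c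
        + fderiv ℝ G y u a (Γ y v c) + G y a (fderiv ℝ Γ y u v c) := by
    intro u v
    have hΓa : ∀ a, HasFDerivAt (fun z => Γ z v a) _ y := fun a =>
      (hΓ.clm_apply (hasFDerivAt_const v y)).clm_apply (hasFDerivAt_const a y)
    have := fderiv_apply_eq h.isOpen (f := fun z => fderiv ℝ G z v a c)
      (f' := fun z => G z (Γ z v a) c + G z a (Γ z v c))
      (fun z hz => h.compat z hz v a c) hy
      ((((hasFDerivAt_fderiv_of_contDiffOn h.isOpen h.smooth hy).clm_apply
        (hasFDerivAt_const v y)).clm_apply (hasFDerivAt_const a y)).clm_apply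
          (hasFDerivAt_const c y))
      (((hG.clm_apply (hΓa a)).clm_apply (hasFDerivAt_const c y)).add
        ((hG.clm_apply (hasFDerivAt_const a y)).clm_apply (hΓa c))) u
    simp at this
    rw [this]; ring
  have e := fderiv_fderiv_comm h.isOpen h.smooth hy u v
  have e' := congrArg (fun L : E →L[ℝ] E →L[ℝ] ℝ => L a c) e
  simp only [key, h.compat y hy] at e'
  simp only [curv, map_add, map_sub, add_apply, sub_apply]
  linarith

/-- The covariant derivative of the curvature tensor. -/
def covCurv (Γ : E → E →L[ℝ] E →L[ℝ] E) (y x u v w : E) : E :=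
  fderiv ℝ (fun z => curv Γ z u v w) y x + Γ y x (curv Γ y u v w) - curv Γ y (Γ y x u) v w
    - curv Γ y u (Γ y x v) w - curv Γ y u v (Γ y x w)

lemma hasFDerivAt_curv (h : IsLocalMetric U G Γ) {y : E} (hy : y ∈ U) (u v w : E) :
    HasFDerivAt (fun z => curv Γ z u v w) (fderiv ℝ (fun z => curv Γ z u v w) y) y := by
  have hΓ := h.smooth_conn
  have hΓ' := hΓ.fderiv_of_isOpen h.isOpen (m := ∞) (by simp)
  refine hasFDerivAt_of_contDiffOn h.isOpen ?_ hy
  have e1 : ∀ u v, ContDiffOn ℝ ∞ (fun z => Γ z u v) U := fun u v =>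
    (hΓ.clm_apply contDiffOn_const).clm_apply contDiffOn_const
  have e2 : ∀ u v, ContDiffOn ℝ ∞ (fun z => fderiv ℝ Γ z u v w) U := fun u v =>
    ((hΓ'.clm_apply contDiffOn_const).clm_apply contDiffOn_const).clm_apply contDiffOn_const
  have e3 : ∀ u v, ContDiffOn ℝ ∞ (fun z => Γ z u (Γ z v w)) U := fun u v =>
    (hΓ.clm_apply contDiffOn_const).clm_apply (e1 v w)
  exact (((e2 u v).sub (e2 v u)).add (e3 u v)).sub (e3 v u)

/-- Makes the second derivatives of Γ visible, so that the second Bianchi identity becomes a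
cancellation of symmetric terms. -/
lemma fderiv_curv (h : IsLocalMetric U G Γ) {y : E} (hy : y ∈ U) (x u v w : E) :
    fderiv ℝ (fun z => curv Γ z u v w) y x =
      fderiv ℝ (fderiv ℝ Γ) y x u v w - fderiv ℝ (fderiv ℝ Γ) y x v u w
      + (fderiv ℝ Γ y x u (Γ y v w) + Γ y u (fderiv ℝ Γ y x v w))
      - (fderiv ℝ Γ y x v (Γ y u w) + Γ y v (fderiv ℝ Γ y x u w)) := by
  have hΓ := h.hasFDerivAt_conn hy
  have hΓ' := hasFDerivAt_fderiv_of_contDiffOn h.isOpen h.smooth_conn hy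
  have e1 : ∀ u v, HasFDerivAt (fun z => Γ z u v) _ y := fun u v =>
    (hΓ.clm_apply (hasFDerivAt_const u y)).clm_apply (hasFDerivAt_const v y)
  have e2 : ∀ u v, HasFDerivAt (fun z => fderiv ℝ Γ z u v w) _ y := fun u v =>
    ((hΓ'.clm_apply (hasFDerivAt_const u y)).clm_apply (hasFDerivAt_const v y)).clm_apply
      (hasFDerivAt_const w y)
  have e3 : ∀ u v, HasFDerivAt (fun z => Γ z u (Γ z v w)) _ y := fun u v =>
    (hΓ.clm_apply (hasFDerivAt_const u y)).clm_apply (e1 v w)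
  have := (((((e2 u v).sub (e2 v u)).add (e3 u v)).sub (e3 v u))).fderiv
  have t : fderiv ℝ (fun z => curv Γ z u v w) y = _ := this
  rw [t]
  simp
  abel

/-- The second Bianchi identity. -/
lemma bianchi_second (h : IsLocalMetric U G Γ) {y : E} (hy : y ∈ U) (u v w a : E) :
    covCurv Γ y u v w a + covCurv Γ y v w u a + covCurv Γ y w u v a = 0 := by
  -- Besides torsion-freeness, the symmetry of second derivatives of Γ is the only input; all other
  -- terms cancel algebraically.
  have s : ∀ u v w, fderiv ℝ (fderiv ℝ Γ) y u v w a = fderiv ℝ (fderiv ℝ Γ) y v u w a :=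
    fun u v w => by rw [fderiv_fderiv_comm h.isOpen h.smooth_conn hy u v]
  simp only [covCurv, h.fderiv_curv hy]
  rw [s u v w, s u w v, s v w u, h.torsion y hy v u, h.torsion y hy w u, h.torsion y hy w v]
  simp only [curv, map_add, map_sub]
  abel

lemma covCurv_swap (h : IsLocalMetric U G Γ) {y : E} (hy : y ∈ U) (x u v a : E) :
    covCurv Γ y x u v a = - covCurv Γ y x v u a := by
  simp only [covCurv, h.fderiv_curv hy]
  simp only [curv, map_add, map_sub]
  abel

/-- Differentiate `curv_skew`: since the metric is parallel, skewness passes to the covariant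
derivative. -/
lemma covCurv_skew (h : IsLocalMetric U G Γ) {y : E} (hy : y ∈ U) (x u v a c : E) :
    G y (covCurv Γ y x u v a) c = - G y a (covCurv Γ y x u v c) := by
  have hG := h.hasFDerivAt_metric hy
  have := fderiv_apply_eq h.isOpen (f := fun z => G z (curv Γ z u v a) c)
      (f' := fun z => - G z a (curv Γ z u v c))
      (fun z hz => h.curv_skew hz u v a c) hy
      ((hG.clm_apply (h.hasFDerivAt_curv hy u v a)).clm_apply (hasFDerivAt_const c y))
      ((hG.clm_apply (hasFDerivAt_const a y)).clm_apply (h.hasFDerivAt_curv hy u v c)).neg x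
  simp [h.compat y hy] at this
  simp only [covCurv, map_add, map_sub]
  simp only [add_apply, sub_apply]
  have s := h.curv_skew hy
  linarith [s (Γ y x u) v a c, s u (Γ y x v) a c, s u v (Γ y x a) c, s u v a (Γ y x c)]

/-- The Ricci identity for vector fields. -/
lemma ricci_identity (h : IsLocalMetric U G Γ) {X : E → E} (hX : ContDiffOn ℝ ∞ X U) {y : E}
    (hy : y ∈ U) (u v : E) :
    covEnd Γ (covVec Γ X) y u v - covEnd Γ (covVec Γ X) y v u = curv Γ y u v (X y) := by
  have hΓ := h.hasFDerivAt_conn hy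
  have hX' := hasFDerivAt_fderiv_of_contDiffOn h.isOpen hX hy
  have hX0 := hasFDerivAt_of_contDiffOn h.isOpen hX hy
  -- Of the second covariant derivative of `X`, the part D²X is symmetric and drops out of the
  -- antisymmetrisation; the terms in Γ and its derivative assemble into the curvature.
  have key : ∀ u v, fderiv ℝ (covVec Γ X) y u v =
      fderiv ℝ (fderiv ℝ X) y u v + fderiv ℝ Γ y u v (X y) + Γ y v (fderiv ℝ X y u) := by
    intro u v
    have := fderiv_apply_eq h.isOpen (f := fun z => covVec Γ X z v)
      (f' := fun z => fderiv ℝ X z v + Γ z v (X z)) (fun z hz => rfl) hy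
      ((hasFDerivAt_of_contDiffOn h.isOpen (h.contDiffOn_covVec hX) hy).clm_apply
        (hasFDerivAt_const v y))
      ((hX'.clm_apply (hasFDerivAt_const v y)).add
        ((hΓ.clm_apply (hasFDerivAt_const v y)).clm_apply hX0)) u
    simp at this
    rw [this]; abel
  have e := fderiv_fderiv_comm h.isOpen hX hy u v
  simp only [covEnd_apply, key, covVec_apply, curv, map_add, e, h.torsion y hy v u]
  abel

/-- The metric is parallel, so taking adjoints commutes with covariant differentiation. -/
lemma covEnd_adjoint (h : IsLocalMetric U G Γ) {B C : E → E →L[ℝ] E} (hB : ContDiffOn ℝ ∞ B U)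
    (hC : ContDiffOn ℝ ∞ C U) (H : ∀ y ∈ U, ∀ a c, G y (B y a) c = G y a (C y c)) {y : E}
    (hy : y ∈ U) (u a c : E) : G y (covEnd Γ B y u a) c = G y a (covEnd Γ C y u c) := by
  have hG := h.hasFDerivAt_metric hy
  have hB' := hasFDerivAt_of_contDiffOn h.isOpen hB hy
  have hC' := hasFDerivAt_of_contDiffOn h.isOpen hC hy
  have := fderiv_apply_eq h.isOpen (f := fun z => G z (B z a) c) (f' := fun z => G z a (C z c))
      (fun z hz => H z hz a c) hy
      ((hG.clm_apply (hB'.clm_apply (hasFDerivAt_const a y))).clm_apply (hasFDerivAt_const c y))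
      ((hG.clm_apply (hasFDerivAt_const a y)).clm_apply (hC'.clm_apply (hasFDerivAt_const c y))) u
  simp [h.compat y hy] at this
  simp only [covEnd_apply, map_add, map_sub, add_apply, sub_apply, H y hy] at this ⊢
  linarith [H y hy (Γ y u a) c]

lemma covEnd_add (h : IsLocalMetric U G Γ) {B C : E → E →L[ℝ] E} (hB : ContDiffOn ℝ ∞ B U)
    (hC : ContDiffOn ℝ ∞ C U) {y : E} (hy : y ∈ U) (u : E) :
    covEnd Γ (fun z => B z + C z) y u = covEnd Γ B y u + covEnd Γ C y u := by
  have hB' := hasFDerivAt_of_contDiffOn h.isOpen hB hy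
  have hC' := hasFDerivAt_of_contDiffOn h.isOpen hC hy
  ext a
  simp [covEnd_apply, fderiv_fun_add hB'.differentiableAt hC'.differentiableAt]
  abel

/-- The Leibniz rule for the value of an endomorphism field on a vector field. -/
lemma covVec_apply_field (h : IsLocalMetric U G Γ) {B : E → E →L[ℝ] E} {X : E → E}
    (hB : ContDiffOn ℝ ∞ B U) (hX : ContDiffOn ℝ ∞ X U) {y : E} (hy : y ∈ U) (u : E) :
    covVec Γ (fun z => B z (X z)) y u = covEnd Γ B y u (X y) + B y (covVec Γ X y u) := by
  have hB' := hasFDerivAt_of_contDiffOn h.isOpen hB hy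
  have hX' := hasFDerivAt_of_contDiffOn h.isOpen hX hy
  have : fderiv ℝ (fun z => B z (X z)) y = _ := (hB'.clm_apply hX').fderiv
  simp [covEnd_apply, covVec_apply, this]
  abel

/-- Differentiation of the scalar product of two vector fields. -/
lemma fderiv_metric (h : IsLocalMetric U G Γ) {X Y : E → E} {y : E} (hy : y ∈ U)
    (hX : DifferentiableAt ℝ X y) (hY : DifferentiableAt ℝ Y y) (u : E) :
    fderiv ℝ (fun z => G z (X z) (Y z)) y u =
      G y (covVec Γ X y u) (Y y) + G y (X y) (covVec Γ Y y u) := by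
  have : fderiv ℝ (fun z => G z (X z) (Y z)) y = _ :=
    (((h.hasFDerivAt_metric hy).clm_apply hX.hasFDerivAt).clm_apply hY.hasFDerivAt).fderiv
  simp [this, covVec_apply, h.compat y hy]
  ring

end IsLocalMetric

end FlatModel

/-! ### Traces, metric contractions and the contracted second Bianchi identity -/

namespace FlatModel

variable {E : Type*} [NormedAddCommGroup E] [NormedSpace ℝ E]
  {ι : Type*} (b : Module.Basis ι ℝ E)
  {U : Set E} {G : E → E →L[ℝ] E →L[ℝ] ℝ} {Γ : E → E →L[ℝ] E →L[ℝ] E}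

/-- The coordinate functionals of a basis are differentiable. -/
lemma hasFDerivAt_repr [FiniteDimensional ℝ E] {f : E → E} {f' : E →L[ℝ] E} {y : E}
    (hf : HasFDerivAt f f' y) (i : ι) :
    HasFDerivAt (fun z => b.repr (f z) i)
      ((LinearMap.toContinuousLinearMap (b.coord i)) ∘L f') y :=
  (LinearMap.toContinuousLinearMap (b.coord i)).hasFDerivAt.comp y hf

variable [Fintype ι]

/-- The trace of an endomorphism in terms of a basis. -/
def tr (L : E → E) : ℝ := ∑ i, b.repr (L (b i)) i

/-- Brings in the invariant trace, and with it cyclicity and independence of the basis, although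
`tr` accepts arbitrary maps. -/
lemma tr_eq_trace (L : E →ₗ[ℝ] E) : tr b L = LinearMap.trace ℝ E L := by
  classical
  rw [LinearMap.trace_eq_matrix_trace ℝ b]
  simp [tr, Matrix.trace, LinearMap.toMatrix_apply]

lemma tr_mul_comm (B C : E →L[ℝ] E) : tr b (fun a => B (C a)) = tr b (fun a => C (B a)) := by
  have := LinearMap.trace_mul_comm ℝ (B : E →ₗ[ℝ] E) (C : E →ₗ[ℝ] E)
  rw [← tr_eq_trace b, ← tr_eq_trace b] at this
  exact this

lemma tr_add (L L' : E → E) : tr b (fun a => L a + L' a) = tr b L + tr b L' := by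
  simp [tr, Finset.sum_add_distrib]

lemma tr_sub (L L' : E → E) : tr b (fun a => L a - L' a) = tr b L - tr b L' := by
  simp [tr, Finset.sum_sub_distrib]

lemma tr_neg (L : E → E) : tr b (fun a => - L a) = - tr b L := by
  simp [tr]

lemma tr_id : tr b (fun a => a) = Fintype.card ι := by
  classical
  simp [tr]

lemma tr_smul_right (α : E →L[ℝ] ℝ) (v : E) : tr b (fun a => α a • v) = α v := by
  have := congrArg α (b.sum_repr v)
  rw [map_sum] at this
  rw [← this]
  simp [tr, mul_comm]

lemma hasFDerivAt_tr [FiniteDimensional ℝ E] {F : E → E → E} {F' : E → E →L[ℝ] E} {y : E}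
    (hF : ∀ a, HasFDerivAt (fun z => F z a) (F' a) y) :
    HasFDerivAt (fun z => tr b (F z))
      (∑ i, (LinearMap.toContinuousLinearMap (b.coord i)) ∘L F' (b i)) y :=
  HasFDerivAt.fun_sum fun i _ => hasFDerivAt_repr b (hF (b i)) i

/-- If the trace of a field of endomorphisms vanishes, so does that of its derivative. -/
lemma tr_covEnd_eq_zero [FiniteDimensional ℝ E] (h : IsLocalMetric U G Γ) {B : E → E →L[ℝ] E}
    (hB : ContDiffOn ℝ ∞ B U) (H : ∀ y ∈ U, tr b (B y) = 0) {y : E} (hy : y ∈ U) (u : E) :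
    tr b (covEnd Γ B y u) = 0 := by
  have hB' := hasFDerivAt_of_contDiffOn h.isOpen hB hy
  have := fderiv_apply_eq h.isOpen (f := fun z => tr b (B z)) (f' := fun _ => 0) H hy
    (hasFDerivAt_tr b fun a => hB'.clm_apply (hasFDerivAt_const a y)) (hasFDerivAt_const 0 y) u
  have e : tr b (fderiv ℝ B y u) = 0 := by simpa [tr] using this
  have : tr b (covEnd Γ B y u) = tr b (fun a => fderiv ℝ B y u a + Γ y u (B y a)
    - B y (Γ y u a)) := rfl
  -- The Christoffel terms form a commutator, which has trace zero.
  rw [this, tr_sub, tr_add, e, tr_mul_comm]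
  ring

/-- The family `b'` is dual to the basis `b` with respect to the bilinear form `g`. -/
def IsDual (g : E →L[ℝ] E →L[ℝ] ℝ) (b' : ι → E) : Prop := ∀ w i, g w (b' i) = b.repr w i

section Dual

variable {b} {g : E →L[ℝ] E →L[ℝ] ℝ} {b' : ι → E}

lemma IsDual.tr_eq (hb : IsDual b g b') (L : E → E) : tr b L = ∑ i, g (L (b i)) (b' i) := by
  simp [tr, hb _ _]

lemma IsDual.sum_smul_basis (hb : IsDual b g b') (w : E) : ∑ i, g w (b' i) • b i = w := by
  simp only [hb w, b.sum_repr]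

lemma IsDual.sum_smul_dual (hb : IsDual b g b') (hs : ∀ a c, g a c = g c a)
    (hn : ∀ a, (∀ c, g a c = 0) → a = 0) (w : E) : ∑ i, g w (b i) • b' i = w := by
  rw [← sub_eq_zero]
  refine hn _ fun c => ?_
  simp only [map_sub, map_sum, map_smul, sub_apply, sum_apply, smul_apply, smul_eq_mul,
    hs _ c, hb c]
  have := congrArg (g w) (b.sum_repr c)
  rw [map_sum] at this
  rw [sub_eq_zero, hs c w, ← this]
  simp [mul_comm]

/-- A metric contraction is symmetric in the contracted slots. -/
lemma IsDual.sum_swap (hb : IsDual b g b') (hs : ∀ a c, g a c = g c a) {W : Type*}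
    [AddCommGroup W] [Module ℝ W] (T : E →ₗ[ℝ] E →ₗ[ℝ] W) :
    ∑ i, T (b' i) (b i) = ∑ i, T (b i) (b' i) := by
  -- The coefficients `g (b' i) (b' j)` form the inverse Gram matrix; its symmetry is what permits
  -- the swap.
  have e : ∀ i, b' i = ∑ j, g (b' i) (b' j) • b j := fun i => (hb.sum_smul_basis (b' i)).symm
  have l : ∀ i, T (b' i) (b i) = ∑ j, g (b' i) (b' j) • T (b j) (b i) := fun i => by
    conv_lhs => rw [e i]
    simp
  have r : ∀ i, T (b i) (b' i) = ∑ j, g (b' i) (b' j) • T (b i) (b j) := fun i => by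
    conv_lhs => rw [e i]
    simp
  simp only [l, r]
  rw [Finset.sum_comm]
  refine Finset.sum_congr rfl fun i _ => Finset.sum_congr rfl fun j _ => ?_
  rw [hs]

/-- An endomorphism moves to the other slot of a metric contraction as its adjoint. -/
lemma IsDual.sum_adjoint (hb : IsDual b g b') (hs : ∀ a c, g a c = g c a)
    (hn : ∀ a, (∀ c, g a c = 0) → a = 0) {W : Type*} [AddCommGroup W] [Module ℝ W]
    (T : E →ₗ[ℝ] E →ₗ[ℝ] W) {B C : E → E} (H : ∀ a c, g (B a) c = g a (C c)) :
    ∑ i, T (b i) (B (b' i)) = ∑ i, T (C (b i)) (b' i) := by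
  have l : ∀ i, T (b i) (B (b' i)) = ∑ j, g (C (b j)) (b' i) • T (b i) (b' j) := fun i => by
    conv_lhs => rw [← hb.sum_smul_dual hs hn (B (b' i))]
    simp [H, hs (b' i)]
  have r : ∀ i, T (C (b i)) (b' i) = ∑ j, g (C (b i)) (b' j) • T (b j) (b' i) := fun i => by
    conv_lhs => rw [← hb.sum_smul_basis (C (b i))]
    simp
  simp only [l, r]
  rw [Finset.sum_comm]

lemma IsDual.tr_adjoint (hb : IsDual b g b') (hs : ∀ a c, g a c = g c a) (B C : E →L[ℝ] E)
    (H : ∀ a c, g (B a) c = g a (C c)) : tr b B = tr b C := by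
  rw [hb.tr_eq, hb.tr_eq]
  have := hb.sum_swap hs (LinearMap.mk₂ ℝ (fun a c => g (C a) c) (by simp) (by simp) (by simp)
    (by simp))
  simp only [LinearMap.mk₂_apply] at this
  rw [← this]
  exact Finset.sum_congr rfl fun i _ => by rw [H, hs]

end Dual

/-- The divergence of a field of endomorphisms. -/
def divEnd (Γ : E → E →L[ℝ] E →L[ℝ] E) (b' : ι → E) (B : E → E →L[ℝ] E) (y : E) : E :=
  ∑ i, covEnd Γ B y (b i) (b' i)

/-- The contracted second Bianchi identity: if the Ricci tensor is `lam g - g(S ·, ·)` with a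
symmetric trace-free tensor `S`, then `S` is divergence-free. -/
theorem divEnd_eq_zero_of_ricci [FiniteDimensional ℝ E] (h : IsLocalMetric U G Γ)
    {S : E → E →L[ℝ] E} (hS : ContDiffOn ℝ ∞ S U)
    (hsymm : ∀ y ∈ U, ∀ a c, G y (S y a) c = G y a (S y c)) (htr : ∀ y ∈ U, tr b (S y) = 0)
    {lam : ℝ} (hric : ∀ y ∈ U, ∀ u w, tr b (fun v => curv Γ y v u w) =
      lam * G y u w - G y (S y u) w) {y : E} (hy : y ∈ U) {b' : ι → E} (hb : IsDual b (G y) b') :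
    divEnd b Γ b' S y = 0 := by
  have hG := h.hasFDerivAt_metric hy
  have hS' := hasFDerivAt_of_contDiffOn h.isOpen hS hy
  have hs := h.symm y hy
  -- the covariant derivative of the Ricci tensor
  have key : ∀ x u w, tr b (fun v => IsLocalMetric.covCurv Γ y x v u w) =
      - G y (covEnd Γ S y x u) w := by
    intro x u w
    have e := fderiv_apply_eq h.isOpen (f := fun z => tr b (fun v => curv Γ z v u w))
      (f' := fun z => lam * G z u w - G z (S z u) w) (fun z hz => hric z hz u w) hy
      (hasFDerivAt_tr b fun v => h.hasFDerivAt_curv hy v u w)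
      ((((hG.clm_apply (hasFDerivAt_const u y)).clm_apply (hasFDerivAt_const w y)).const_mul
        lam).sub ((hG.clm_apply (hS'.clm_apply (hasFDerivAt_const u y))).clm_apply
          (hasFDerivAt_const w y))) x
    have e' : tr b (fun v => fderiv ℝ (fun z => curv Γ z v u w) y x) =
        lam * fderiv ℝ G y x u w - (G y (fderiv ℝ S y x u) w + fderiv ℝ G y x (S y u) w) := by
      simpa [tr] using e
    -- The connection term outside the curvature cancels the one in the traced slot, by cyclicity;
    -- hence the trace of the covariant derivative is the covariant derivative of the Ricci tensor,
    -- and λ g contributes nothing.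
    have comm : tr b (fun v => Γ y x (curv Γ y v u w)) =
        tr b (fun v => curv Γ y (Γ y x v) u w) := by
      let L : E →L[ℝ] E := LinearMap.toContinuousLinearMap
        { toFun := fun v => curv Γ y v u w
          map_add' := fun v v' => by
            simp only [curv, map_add, add_apply]; abel
          map_smul' := fun r v => by
            simp only [curv, map_smul, smul_apply, RingHom.id_apply, smul_sub, smul_add] }
      exact tr_mul_comm b (Γ y x) L
    simp only [IsLocalMetric.covCurv, tr_sub, tr_add, e', comm, hric y hy, h.compat y hy,
      covEnd_apply, map_sub, map_add, sub_apply, add_apply]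
    ring
  refine h.nondeg y hy _ fun c => ?_
  -- The second Bianchi identity contracted twice. Two of the three sums equal -g(div S, c); the
  -- remaining one is the derivative of the scalar curvature, here of tr S.
  have cyc : ∑ j, ∑ i, (G y (IsLocalMetric.covCurv Γ y (b i) c (b j) (b' j)) (b' i)
      + G y (IsLocalMetric.covCurv Γ y c (b j) (b i) (b' j)) (b' i)
      + G y (IsLocalMetric.covCurv Γ y (b j) (b i) c (b' j)) (b' i)) = 0 := by
    refine Finset.sum_eq_zero fun j _ => Finset.sum_eq_zero fun i _ => ?_
    rw [← add_apply, ← add_apply, ← map_add, ← map_add, h.bianchi_second hy]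
    simp
  simp only [Finset.sum_add_distrib] at cyc
  have t3 : ∑ j, ∑ i, G y (IsLocalMetric.covCurv Γ y (b j) (b i) c (b' j)) (b' i) =
      - G y (divEnd b Γ b' S y) c := by
    simp only [divEnd, map_sum, sum_apply, ← Finset.sum_neg_distrib]
    refine Finset.sum_congr rfl fun j _ => ?_
    rw [← hb.tr_eq (fun v => IsLocalMetric.covCurv Γ y (b j) v c (b' j)), key,
      h.covEnd_adjoint hS hS hsymm hy, hs]
  have t1 : ∑ j, ∑ i, G y (IsLocalMetric.covCurv Γ y (b i) c (b j) (b' j)) (b' i) =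
      - G y (divEnd b Γ b' S y) c := by
    -- Exchanging the two summation indices and using both skew symmetries of the curvature
    -- identifies this sum with the third one.
    rw [← t3, Finset.sum_comm]
    refine Finset.sum_congr rfl fun j _ => Finset.sum_congr rfl fun i _ => ?_
    rw [h.covCurv_skew hy, h.covCurv_swap hy, hs]
    simp
  have t2 : ∑ j, ∑ i, G y (IsLocalMetric.covCurv Γ y c (b j) (b i) (b' j)) (b' i) = 0 := by
    have : ∀ j, ∑ i, G y (IsLocalMetric.covCurv Γ y c (b j) (b i) (b' j)) (b' i) =
        G y (covEnd Γ S y c (b j)) (b' j) := fun j => by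
      have e := hb.tr_eq (fun v => IsLocalMetric.covCurv Γ y c v (b j) (b' j))
      rw [key] at e
      rw [eq_comm, ← neg_inj, e, ← Finset.sum_neg_distrib]
      refine Finset.sum_congr rfl fun i _ => ?_
      rw [h.covCurv_swap hy]
      simp
    simp only [this]
    rw [← hb.tr_eq, tr_covEnd_eq_zero b h hS htr hy]
  linarith

end FlatModel

/-! ### Paracontact identities and the soliton constant in one coordinate domain -/

namespace FlatModel

variable {E : Type*} [NormedAddCommGroup E] [NormedSpace ℝ E]

/-- A paracontact metric structure in coordinates: `ξ` is the Reeb field, `φ` the structure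
endomorphism, and `2 dη = 2 g(·, φ ·)` is written with the covariant derivative of `ξ`. -/
structure IsLocalParacontact (U : Set E) (G : E → E →L[ℝ] E →L[ℝ] ℝ)
    (Γ : E → E →L[ℝ] E →L[ℝ] E) (ξ : E → E) (φ : E → E →L[ℝ] E) : Prop
    extends IsLocalMetric U G Γ where
  smooth_reeb : ContDiffOn ℝ ∞ ξ U
  smooth_phi : ContDiffOn ℝ ∞ φ U
  unit : ∀ y ∈ U, G y (ξ y) (ξ y) = 1
  phi_sq : ∀ y ∈ U, ∀ a, φ y (φ y a) = a - G y (ξ y) a • ξ y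
  deta : ∀ y ∈ U, ∀ a c, G y (covVec Γ ξ y a) c - G y a (covVec Γ ξ y c) = 2 * G y a (φ y c)
  eta_phi : ∀ y ∈ U, ∀ a, G y (ξ y) (φ y a) = 0

variable {U : Set E} {G : E → E →L[ℝ] E →L[ℝ] ℝ} {Γ : E → E →L[ℝ] E →L[ℝ] E}
  {ξ : E → E} {φ : E → E →L[ℝ] E}

namespace IsLocalParacontact

variable (h : IsLocalParacontact U G Γ ξ φ) {y : E} (hy : y ∈ U)
include h hy

/-- The left side of `deta` changes sign when its arguments are exchanged, hence so does the right
side. -/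
lemma phi_skew (a c : E) : G y (φ y a) c = - G y a (φ y c) := by
  have e1 := h.deta y hy a c
  have e2 := h.deta y hy c a
  rw [h.symm y hy c (covVec Γ ξ y a), h.symm y hy (covVec Γ ξ y c) a, h.symm y hy c] at e2
  linarith

lemma phi_reeb : φ y (ξ y) = 0 :=
  h.nondeg y hy _ fun c => by rw [h.phi_skew hy, h.eta_phi y hy, neg_zero]

/-- Differentiate g(ξ, ξ) = 1. -/
lemma metric_nabla_reeb (a : E) : G y (ξ y) (covVec Γ ξ y a) = 0 := by
  have hξ := hasFDerivAt_of_contDiffOn h.isOpen h.smooth_reeb hy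
  have e := h.fderiv_metric hy hξ.differentiableAt hξ.differentiableAt a
  have e' := fderiv_apply_eq h.isOpen (f' := fun _ => (1 : ℝ)) h.unit hy
    (((h.hasFDerivAt_metric hy).clm_apply hξ).clm_apply hξ).differentiableAt.hasFDerivAt
    (hasFDerivAt_const 1 y) a
  rw [e', h.symm y hy _ (ξ y), zero_apply] at e
  linarith

/-- Put `ξ` in the first slot of `deta`: η ∘ ∇ξ and η ∘ φ both vanish. So the Reeb field is
geodesic. -/
lemma nabla_reeb_reeb : covVec Γ ξ y (ξ y) = 0 := by
  refine h.nondeg y hy _ fun c => ?_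
  have e := h.deta y hy (ξ y) c
  rw [h.metric_nabla_reeb hy, h.eta_phi y hy] at e
  linarith

/-- Reads `deta` as A* = A + 2φ for A = ∇ξ. This adjoint is the one whose divergence is the Ricci
curvature and whose value on a variation is the energy flux. -/
lemma nabla_adjoint (a c : E) :
    G y (covVec Γ ξ y a) c = G y a (covVec Γ ξ y c + φ y c + φ y c) := by
  have e := h.deta y hy a c
  simp only [map_add]
  linarith

/-- S = ∇ξ + φ is the symmetric part of ∇ξ, that is, half of L_ξ g as an endomorphism. -/
lemma symm_adjoint (a c : E) :
    G y (covVec Γ ξ y a + φ y a) c = G y a (covVec Γ ξ y c + φ y c) := by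
  rw [map_add, add_apply, h.phi_skew hy, h.nabla_adjoint hy]
  simp only [map_add]
  ring

lemma covEnd_phi_skew (u a c : E) : G y (covEnd Γ φ y u a) c = - G y a (covEnd Γ φ y u c) := by
  have := h.covEnd_adjoint (C := fun z => - φ z) h.smooth_phi h.smooth_phi.neg
    (fun z hz a c => by simpa using h.phi_skew hz a c) hy u a c
  rw [this, ← map_neg]
  congr 1
  simp only [covEnd_apply, neg_apply, map_neg]
  have : fderiv ℝ (fun z => - φ z) y = - fderiv ℝ φ y := fderiv_neg
  rw [this]
  simp only [neg_apply]
  abel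

/-- The covariant derivative of `deta`. -/
lemma covEnd_nabla_sub_adjoint (u a c : E) :
    G y (covEnd Γ (covVec Γ ξ) y u a) c - G y a (covEnd Γ (covVec Γ ξ) y u c)
      = 2 * G y a (covEnd Γ φ y u c) := by
  have hA := h.contDiffOn_covVec h.smooth_reeb
  have := h.covEnd_adjoint (B := covVec Γ ξ) (C := fun z => (covVec Γ ξ z + φ z) + φ z) hA
    ((hA.add h.smooth_phi).add h.smooth_phi) (fun z hz a c => h.nabla_adjoint hz a c) hy u a c
  rw [this, h.covEnd_add (hA.add h.smooth_phi) h.smooth_phi hy,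
    h.covEnd_add hA h.smooth_phi hy]
  simp only [add_apply, map_add]
  ring

/-- The fundamental two-form is closed. -/
lemma closed (a c d : E) : G y c (covEnd Γ φ y a d) + G y d (covEnd Γ φ y c a)
    + G y a (covEnd Γ φ y d c) = 0 := by
  -- Here d(dη) = 0 becomes the first Bianchi identity: antisymmetrised second derivatives of `ξ`
  -- are curvatures, and their cyclic sum vanishes.
  have r : ∀ u v w, G y (covEnd Γ (covVec Γ ξ) y u v) w - G y (covEnd Γ (covVec Γ ξ) y v u) w
      = - G y (ξ y) (curv Γ y u v w) := fun u v w => by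
    rw [← h.curv_skew hy, ← h.ricci_identity h.smooth_reeb hy]
    simp
  have b : G y (ξ y) (curv Γ y a c d) + G y (ξ y) (curv Γ y c d a) + G y (ξ y) (curv Γ y d a c) = 0
      := by rw [← map_add, ← map_add, h.bianchi_first hy, map_zero]
  have e1 := h.covEnd_nabla_sub_adjoint hy a c d
  have e2 := h.covEnd_nabla_sub_adjoint hy c d a
  have e3 := h.covEnd_nabla_sub_adjoint hy d a c
  rw [h.symm y hy c] at e1
  rw [h.symm y hy d] at e2
  rw [h.symm y hy a] at e3
  linarith [r a c d, r c d a, r d a c]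

/-- Differentiate φξ = 0. -/
lemma covEnd_phi_reeb (u : E) : covEnd Γ φ y u (ξ y) = - φ y (covVec Γ ξ y u) := by
  have hξ := h.smooth_reeb
  have e := h.covVec_apply_field h.smooth_phi hξ hy u
  have e' := fderiv_apply_eq h.isOpen (f := fun z => φ z (ξ z)) (f' := fun _ => (0 : E))
    (fun z hz => h.phi_reeb hz) hy
    ((hasFDerivAt_of_contDiffOn h.isOpen h.smooth_phi hy).clm_apply
      (hasFDerivAt_of_contDiffOn h.isOpen hξ hy)).differentiableAt.hasFDerivAt
    (hasFDerivAt_const 0 y) u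
  rw [covVec_apply, e', h.phi_reeb hy] at e
  rw [eq_neg_iff_add_eq_zero, ← e]
  simp

/-- Differentiate φ² = I - η ⊗ ξ. -/
lemma covEnd_phi_phi (u a : E) : covEnd Γ φ y u (φ y a) + φ y (covEnd Γ φ y u a) =
    - (G y (covVec Γ ξ y u) a • ξ y + G y (ξ y) a • covVec Γ ξ y u) := by
  have hξ := hasFDerivAt_of_contDiffOn h.isOpen h.smooth_reeb hy
  have hφ := hasFDerivAt_of_contDiffOn h.isOpen h.smooth_phi hy
  have hG := h.hasFDerivAt_metric hy
  have e := fderiv_apply_eq h.isOpen (f := fun z => φ z (φ z a))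
    (f' := fun z => a - G z (ξ z) a • ξ z) (fun z hz => h.phi_sq z hz a) hy
    (hφ.clm_apply (hφ.clm_apply (hasFDerivAt_const a y)))
    ((hasFDerivAt_const a y).sub (((hG.clm_apply hξ).clm_apply (hasFDerivAt_const a y)).smul hξ)) u
  simp [h.compat y hy] at e
  have e2 := h.phi_sq y hy (Γ y u a)
  simp only [covEnd_apply, map_sub, map_add, covVec_apply, add_apply, h.phi_sq y hy a, smul_add,
    map_smul]
  rw [e2, ← sub_eq_zero]
  rw [add_comm, ← sub_eq_zero] at e
  rw [← e]
  module

/-- Closedness with one argument equal to `ξ`: in the other two terms ∇φ meets `ξ` and reduces to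
∇ξ. The right side is -(Sφ + φS) with S = ∇ξ + φ. -/
lemma nabla_reeb_phi (c : E) : covEnd Γ φ y (ξ y) c =
    - ((covVec Γ ξ y (φ y c) + φ y (φ y c)) + φ y (covVec Γ ξ y c + φ y c)) := by
  refine h.ext_metric hy fun a => ?_
  have e := h.closed hy (ξ y) a c
  have e1 : G y c (covEnd Γ φ y a (ξ y)) = G y (φ y c) (covVec Γ ξ y a) := by
    rw [h.covEnd_phi_reeb hy, map_neg, h.phi_skew hy]
  have e2 : G y (ξ y) (covEnd Γ φ y c a) = G y (φ y (covVec Γ ξ y c)) a := by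
    rw [← neg_eq_iff_eq_neg.2 (h.covEnd_phi_skew hy c (ξ y) a), h.covEnd_phi_reeb hy]
    simp
  have e3 : G y (φ y c) (covVec Γ ξ y a) = G y (covVec Γ ξ y (φ y c) + φ y (φ y c) + φ y (φ y c)) a
      := by
    rw [h.symm y hy _ a, ← h.nabla_adjoint hy, h.symm y hy]
  rw [e1, e2, e3, h.symm y hy a] at e
  simp only [map_add, map_neg, add_apply, neg_apply] at e ⊢
  linarith

end IsLocalParacontact

namespace IsLocalParacontact

variable {ι : Type*} [Fintype ι] (b : Module.Basis ι ℝ E) {b' : ι → E}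
  (h : IsLocalParacontact U G Γ ξ φ) {y : E} (hy : y ∈ U) (hb : IsDual b (G y) b')
include h hy hb

lemma tr_phi : tr b (φ y) = 0 := by
  have := hb.tr_adjoint (h.symm y hy) (φ y) (-φ y) fun a c => by
    simpa using h.phi_skew hy a c
  have e : tr b (-φ y : E →L[ℝ] E) = - tr b (φ y) := tr_neg b _
  linarith

/-- The adjoint of φS is -Sφ, so tr(φS) = -tr(Sφ) = -tr(φS). -/
lemma tr_phi_symm : tr b (fun a => φ y (covVec Γ ξ y a + φ y a)) = 0 := by
  have := hb.tr_adjoint (h.symm y hy) (φ y ∘L (covVec Γ ξ y + φ y))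
    (-((covVec Γ ξ y + φ y) ∘L φ y)) fun a c => by
      simp only [ContinuousLinearMap.comp_apply, neg_apply, add_apply, map_neg]
      rw [h.phi_skew hy, h.symm_adjoint hy]
  have e : tr b (-((covVec Γ ξ y + φ y) ∘L φ y) : E →L[ℝ] E) =
    - tr b (fun a => (covVec Γ ξ y + φ y) (φ y a)) := tr_neg b _
  have e' := tr_mul_comm b (φ y) (covVec Γ ξ y + φ y)
  change tr b (fun a => φ y ((covVec Γ ξ y + φ y) a)) = _ at this
  change tr b (fun a => φ y ((covVec Γ ξ y + φ y) a)) = 0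
  linarith

omit hb in
-- Insert ∇_ξφ = -(Sφ + φS) into the derivative of φ² along the geodesic field `ξ`: Sφ² + 2φSφ + φ²S
-- = 0. By cyclicity each of the four terms has trace tr(Sφ²), which is tr S because Sξ = 0.
lemma tr_symm : tr b (fun a => covVec Γ ξ y a + φ y a) = 0 := by
  set S := covVec Γ ξ y + φ y with hS
  have hSξ : S (ξ y) = 0 := by
    simp [hS, h.nabla_reeb_reeb hy, h.phi_reeb hy]
  have e : ∀ a, S (φ y (φ y a)) + φ y (S (φ y a)) + (φ y (S (φ y a)) + φ y (φ y (S a))) = 0 := by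
    intro a
    have := h.covEnd_phi_phi hy (ξ y) a
    rw [h.nabla_reeb_reeb hy, h.nabla_reeb_phi hy, h.nabla_reeb_phi hy] at this
    simp only [map_zero, zero_apply, zero_smul, smul_zero, map_neg, add_zero, neg_zero] at this
    rw [← neg_add, neg_eq_zero] at this
    rw [← this]
    simp only [hS, add_apply, map_add]
  have t : tr b (fun a => S (φ y (φ y a)) + φ y (S (φ y a)) + (φ y (S (φ y a)) + φ y (φ y (S a))))
      = 0 := by simp [e, tr]
  rw [tr_add, tr_add, tr_add] at t
  have c1 : tr b (fun a => φ y (S (φ y a))) = tr b (fun a => S (φ y (φ y a))) :=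
    tr_mul_comm b (φ y) (S ∘L φ y)
  have c2 : tr b (fun a => φ y (φ y (S a))) = tr b (fun a => S (φ y (φ y a))) :=
    tr_mul_comm b (φ y ∘L φ y) S
  have c3 : tr b (fun a => S (φ y (φ y a))) = tr b S := by
    congr 1
    funext a
    rw [h.phi_sq y hy]
    simp [hSξ]
  change tr b S = 0
  linarith

lemma tr_nabla_reeb : tr b (covVec Γ ξ y) = 0 := by
  have := h.tr_symm b hy
  rw [tr_add, h.tr_phi b hy hb] at this
  linarith

/-- The divergence of the structure endomorphism of a paracontact metric manifold. -/
lemma divEnd_phi : divEnd b Γ b' φ y = - ((Fintype.card ι : ℝ) - 1) • ξ y := by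
  set D := divEnd b Γ b' φ y with hD
  have hs := h.symm y hy
  have hn := h.nondeg y hy
  -- the three sums of the contracted closedness identity
  have s2 : ∀ X, ∑ i, G y (φ y (b' i)) (covEnd Γ φ y (b i) X) = G y (φ y D) X := by
    intro X
    have : ∀ i, G y (φ y (b' i)) (covEnd Γ φ y (b i) X) = G y (φ y (covEnd Γ φ y (b i) (b' i))) X
        + G y (covVec Γ ξ y (b i)) (b' i) * G y (ξ y) X
        + G y (G y (ξ y) (b' i) • covVec Γ ξ y (b i)) X := by
      intro i
      have e := h.covEnd_phi_phi hy (b i) (b' i)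
      rw [← neg_eq_iff_eq_neg.2 (h.covEnd_phi_skew hy (b i) (φ y (b' i)) X),
        eq_sub_of_add_eq e]
      simp
      ring
    simp only [this, Finset.sum_add_distrib, ← Finset.sum_mul]
    rw [← hb.tr_eq, h.tr_nabla_reeb b hy hb]
    have e1 : ∑ i, G y (φ y (covEnd Γ φ y (b i) (b' i))) X = G y (φ y D) X := by
      simp [hD, divEnd]
    -- The sum contracts to ∇_ξ ξ, which is zero; the other correction term carried the divergence
    -- of `ξ`.
    have e2 : ∑ i, G y (G y (ξ y) (b' i) • covVec Γ ξ y (b i)) X = 0 := by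
      rw [← sum_apply, ← map_sum]
      simp only [← map_smul, ← map_sum, hb.sum_smul_basis, h.nabla_reeb_reeb hy]
      simp
    rw [e1, e2]
    ring
  -- This is tr(φ ∇_Xφ), half the trace of the derivative of φ² = I - η ⊗ ξ; that trace is -2
  -- g(∇_Xξ, ξ) = 0.
  have s1 : ∀ X, ∑ i, G y (b i) (covEnd Γ φ y X (φ y (b' i))) = 0 := by
    intro X
    have : ∀ i, G y (b i) (covEnd Γ φ y X (φ y (b' i))) =
        G y ((φ y ∘L covEnd Γ φ y X) (b i)) (b' i) := fun i => by
      rw [← neg_eq_iff_eq_neg.2 (h.covEnd_phi_skew hy X (b i) (φ y (b' i)))]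
      rw [ContinuousLinearMap.comp_apply, h.phi_skew hy]
    simp only [this]
    rw [← hb.tr_eq]
    have c := tr_mul_comm b (φ y) (covEnd Γ φ y X)
    have t : tr b (fun a => covEnd Γ φ y X (φ y a) + φ y (covEnd Γ φ y X a)) = 0 := by
      simp only [h.covEnd_phi_phi hy, tr_neg, tr_add]
      have e1 := tr_smul_right b (G y (covVec Γ ξ y X)) (ξ y)
      have e2 := tr_smul_right b (G y (ξ y)) (covVec Γ ξ y X)
      rw [e1, e2, hs (covVec Γ ξ y X), h.metric_nabla_reeb hy]
      simp
    rw [tr_add] at t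
    change tr b (fun a => φ y (covEnd Γ φ y X a)) = 0
    linarith
  -- Moving φ across the contraction costs one sign and the skewness of ∇φ another, so this sum
  -- equals the second one.
  have s3 : ∀ X, ∑ i, G y X (covEnd Γ φ y (φ y (b' i)) (b i)) = G y (φ y D) X := by
    intro X
    let T : E →ₗ[ℝ] E →ₗ[ℝ] E := LinearMap.mk₂ ℝ (fun a c => covEnd Γ φ y c a)
      (by simp) (by simp)
      (by intro a c c'; simp only [covEnd_apply, map_add, add_apply]; abel)
      (by intro r a c; simp only [covEnd_apply, map_smul, smul_apply, smul_sub, smul_add])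
    have t1 := hb.sum_adjoint hs hn T (B := φ y) (C := fun a => - φ y a)
      (fun a c => by simpa using h.phi_skew hy a c)
    let T' : E →ₗ[ℝ] E →ₗ[ℝ] E := T ∘ₗ (φ y : E →ₗ[ℝ] E)
    have t2 := hb.sum_swap hs T'
    have t3 : ∑ i, covEnd Γ φ y (φ y (b' i)) (b i) = - ∑ i, covEnd Γ φ y (b i) (φ y (b' i)) := by
      have l1 : ∑ i, covEnd Γ φ y (φ y (b' i)) (b i) = ∑ i, T (b i) (φ y (b' i)) := rfl
      have l2 : ∑ i, covEnd Γ φ y (b i) (φ y (b' i)) = ∑ i, T' (b' i) (b i) := rfl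
      have l3 : ∑ i, T (- φ y (b i)) (b' i) = - ∑ i, T' (b i) (b' i) := by
        rw [← Finset.sum_neg_distrib]
        refine Finset.sum_congr rfl fun i _ => ?_
        rw [map_neg]; rfl
      rw [l1, l2, t1, l3, t2]
    rw [← s2, ← map_sum, t3, map_neg, map_sum, ← Finset.sum_neg_distrib]
    refine Finset.sum_congr rfl fun i _ => ?_
    rw [hs X, h.covEnd_phi_skew hy, neg_neg]
  -- The contracted closedness identity now reads 0 + φD + φD = 0, so D is a multiple of `ξ`.
  have hφD : φ y D = 0 := by
    refine hn _ fun X => ?_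
    have e : ∑ i, (G y (b i) (covEnd Γ φ y X (φ y (b' i)))
        + G y (φ y (b' i)) (covEnd Γ φ y (b i) X)
        + G y X (covEnd Γ φ y (φ y (b' i)) (b i))) = 0 :=
      Finset.sum_eq_zero fun i _ => h.closed hy X (b i) (φ y (b' i))
    rw [Finset.sum_add_distrib, Finset.sum_add_distrib, s1, s2, s3] at e
    linarith
  -- The coefficient is η(D) = tr(φ∇ξ) = tr(φS) - tr(φ²), where tr(φS) = 0 and tr(φ²) = dim - 1.
  have hη : G y (ξ y) D = - ((Fintype.card ι : ℝ) - 1) := by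
    have e : G y (ξ y) D = tr b (fun a => φ y (covVec Γ ξ y a)) := by
      rw [hD, divEnd, map_sum, hb.tr_eq]
      refine Finset.sum_congr rfl fun i _ => ?_
      rw [← neg_eq_iff_eq_neg.2 (h.covEnd_phi_skew hy (b i) (ξ y) (b' i)), h.covEnd_phi_reeb hy]
      simp
    have t := h.tr_phi_symm b hy hb
    have t2 : tr b (fun a => φ y (φ y a)) = Fintype.card ι - 1 := by
      simp only [h.phi_sq y hy, tr_sub, tr_id]
      rw [tr_smul_right, h.unit y hy]
    simp only [map_add, tr_add] at t
    rw [e]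
    linarith
  have e := h.phi_sq y hy D
  rw [hφD, map_zero, hη] at e
  exact sub_eq_zero.1 e.symm

/-- The Ricci curvature in the Reeb direction is a divergence. -/
lemma ricci_reeb [FiniteDimensional ℝ E] (hall : ∀ z ∈ U, ∃ b'' : ι → E, IsDual b (G z) b'')
    (u : E) : tr b (fun v => curv Γ y v u (ξ y)) =
      G y u (divEnd b Γ b' (fun z => covVec Γ ξ z + φ z + φ z) y) := by
  have hA := h.contDiffOn_covVec h.smooth_reeb
  have e : ∀ v, curv Γ y v u (ξ y) =
      covEnd Γ (covVec Γ ξ) y v u - covEnd Γ (covVec Γ ξ) y u v := fun v =>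
    (h.ricci_identity h.smooth_reeb hy v u).symm
  -- One of the two contracted second derivatives is the differential of div ξ. Its vanishing needs
  -- tr ∇ξ = 0 on all of `U`, hence dual families at every point.
  have t : tr b (fun v => covEnd Γ (covVec Γ ξ) y u v) = 0 :=
    tr_covEnd_eq_zero b h.toIsLocalMetric hA (fun z hz => by
      obtain ⟨b'', hb''⟩ := hall z hz
      exact h.tr_nabla_reeb b hz hb'') hy u
  simp only [e, tr_sub]
  rw [t, hb.tr_eq, divEnd, map_sum, sub_zero]
  refine Finset.sum_congr rfl fun i _ => ?_
  exact h.covEnd_adjoint hA ((hA.add h.smooth_phi).add h.smooth_phi)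
    (fun z hz a c => h.nabla_adjoint hz a c) hy (b i) u (b' i)

/-- The constant of a paracontact Ricci soliton and the rough Laplacian of its Reeb field. -/
theorem soliton_constant [FiniteDimensional ℝ E]
    (hall : ∀ z ∈ U, ∃ b'' : ι → E, IsDual b (G z) b'') {lam : ℝ}
    (hric : ∀ z ∈ U, ∀ u w, tr b (fun v => curv Γ z v u w) =
      lam * G z u w - G z (covVec Γ ξ z u + φ z u) w) :
    lam = - ((Fintype.card ι : ℝ) - 1) ∧ divEnd b Γ b' (covVec Γ ξ) y = - lam • ξ y := by
  have hA := h.contDiffOn_covVec h.smooth_reeb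
  have dS := divEnd_eq_zero_of_ricci b h.toIsLocalMetric (S := fun z => covVec Γ ξ z + φ z)
    (hA.add h.smooth_phi) (fun z hz => h.symm_adjoint hz)
    (fun z hz => h.tr_symm b hz) hric hy hb
  have dφ := h.divEnd_phi b hy hb
  -- On `ξ` the soliton equation reduces to Ric(·, ξ) = λη, because Sξ = 0.
  have dT : divEnd b Γ b' (fun z => covVec Γ ξ z + φ z + φ z) y = lam • ξ y := by
    refine h.ext_metric hy fun u => ?_
    rw [h.symm y hy _ u, ← h.ricci_reeb b hy hb hall, hric y hy, h.symm_adjoint hy,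
      h.nabla_reeb_reeb hy, h.phi_reeb hy, h.symm y hy u]
    simp
  have a1 : divEnd b Γ b' (fun z => covVec Γ ξ z + φ z + φ z) y =
      divEnd b Γ b' (fun z => covVec Γ ξ z + φ z) y + divEnd b Γ b' φ y := by
    simp only [divEnd, h.covEnd_add (hA.add h.smooth_phi) h.smooth_phi hy, add_apply,
      Finset.sum_add_distrib]
  have a2 : divEnd b Γ b' (fun z => covVec Γ ξ z + φ z) y =
      divEnd b Γ b' (covVec Γ ξ) y + divEnd b Γ b' φ y := by
    simp only [divEnd, h.covEnd_add hA h.smooth_phi hy, add_apply,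
      Finset.sum_add_distrib]
  rw [a1, dS, zero_add, dφ] at dT
  have hl : lam = - ((Fintype.card ι : ℝ) - 1) := by
    have := congrArg (G y (ξ y)) dT
    rw [map_smul, map_smul, h.unit y hy] at this
    simpa using this.symm
  refine ⟨hl, ?_⟩
  rw [a2, dφ, ← hl] at dS
  rw [neg_smul, eq_neg_iff_add_eq_zero, dS]

end IsLocalParacontact

end FlatModel

/-! ## Coordinates -/

namespace Coordinates

variable {m : ℕ} {M : Type*} [TopologicalSpace M]
  [ChartedSpace (EuclideanSpace ℝ (Fin m)) M]

/-- The inverse of the preferred chart at `c`. -/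
def inv (m : ℕ) {M : Type*} [TopologicalSpace M] [ChartedSpace (EuclideanSpace ℝ (Fin m)) M]
    (c : M) : EuclideanSpace ℝ (Fin m) → M :=
  (chartAt (EuclideanSpace ℝ (Fin m)) c).symm

/-- The target of the preferred chart at `c`. -/
def dom (m : ℕ) {M : Type*} [TopologicalSpace M] [ChartedSpace (EuclideanSpace ℝ (Fin m)) M]
    (c : M) : Set (EuclideanSpace ℝ (Fin m)) :=
  (chartAt (EuclideanSpace ℝ (Fin m)) c).target

lemma isOpen_dom (c : M) : IsOpen (dom m c) := (chartAt (EuclideanSpace ℝ (Fin m)) c).open_target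

lemma inv_mem (c : M) {y : EuclideanSpace ℝ (Fin m)} (hy : y ∈ dom m c) :
    inv m c y ∈ (chartAt (EuclideanSpace ℝ (Fin m)) c).source :=
  (chartAt (EuclideanSpace ℝ (Fin m)) c).map_target hy

lemma exists_inv_eq {c x : M} (hx : x ∈ (chartAt (EuclideanSpace ℝ (Fin m)) c).source) :
    ∃ y ∈ dom m c, inv m c y = x :=
  ⟨chartAt _ c x, (chartAt _ c).map_source hx, (chartAt _ c).left_inv hx⟩

lemma exists_coord (m : ℕ) {M : Type*} [TopologicalSpace M]
    [ChartedSpace (EuclideanSpace ℝ (Fin m)) M] (x : M) :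
    ∃ (c : M) (y : EuclideanSpace ℝ (Fin m)), y ∈ dom m c ∧ inv m c y = x :=
  ⟨x, exists_inv_eq (mem_chart_source _ x)⟩

lemma chart_inv (c : M) {y : EuclideanSpace ℝ (Fin m)} (hy : y ∈ dom m c) :
    chartAt (EuclideanSpace ℝ (Fin m)) c (inv m c y) = y :=
  (chartAt (EuclideanSpace ℝ (Fin m)) c).right_inv hy

lemma eventually_inv_chart (c : M) {x : M}
    (hx : x ∈ (chartAt (EuclideanSpace ℝ (Fin m)) c).source) :
    ∀ᶠ z in 𝓝 x, inv m c (chartAt (EuclideanSpace ℝ (Fin m)) c z) = z := by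
  filter_upwards [(chartAt _ c).open_source.mem_nhds hx] with z hz
  exact (chartAt _ c).left_inv hz

variable [IsManifold (𝓡 m) ∞ M]

/-- The differential of the chart at `c`, that is, the coordinates of tangent vectors at `x`. -/
def toCoord (c x : M) : TangentSpace (𝓡 m) x →L[ℝ] EuclideanSpace ℝ (Fin m) :=
  (trivializationAt (EuclideanSpace ℝ (Fin m)) (TangentSpace (𝓡 m)) c).continuousLinearMapAt ℝ x

/-- The tangent vector at `x` with given coordinates in the chart at `c`. -/
def ofCoord (c x : M) : EuclideanSpace ℝ (Fin m) →L[ℝ] TangentSpace (𝓡 m) x :=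
  (trivializationAt (EuclideanSpace ℝ (Fin m)) (TangentSpace (𝓡 m)) c).symmL ℝ x

lemma ofCoord_toCoord {c x : M} (hx : x ∈ (chartAt (EuclideanSpace ℝ (Fin m)) c).source)
    (v : TangentSpace (𝓡 m) x) : ofCoord c x (toCoord c x v) = v :=
  (trivializationAt (EuclideanSpace ℝ (Fin m)) (TangentSpace (𝓡 m)) c).symmL_continuousLinearMapAt
    hx v

lemma toCoord_ofCoord {c x : M} (hx : x ∈ (chartAt (EuclideanSpace ℝ (Fin m)) c).source)
    (v : EuclideanSpace ℝ (Fin m)) : toCoord c x (ofCoord c x v) = v :=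
  (trivializationAt (EuclideanSpace ℝ (Fin m)) (TangentSpace (𝓡 m)) c).continuousLinearMapAt_symmL
    hx v

lemma toCoord_eq_mfderiv {c x : M} (hx : x ∈ (chartAt (EuclideanSpace ℝ (Fin m)) c).source) :
    toCoord c x = mfderiv (𝓡 m) 𝓘(ℝ, EuclideanSpace ℝ (Fin m))
      (chartAt (EuclideanSpace ℝ (Fin m)) c) x :=
  TangentBundle.continuousLinearMapAt_trivializationAt hx

lemma ofCoord_eq_mfderiv {c : M} {y : EuclideanSpace ℝ (Fin m)} (hy : y ∈ dom m c) :
    ofCoord c (inv m c y) = mfderiv 𝓘(ℝ, EuclideanSpace ℝ (Fin m)) (𝓡 m) (inv m c) y := by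
  have h := TangentBundle.symmL_trivializationAt (I := 𝓡 m) (𝕜 := ℝ) (inv_mem c hy)
  have e : extChartAt (𝓡 m) c (inv m c y) = y :=
    (chartAt (EuclideanSpace ℝ (Fin m)) c).right_inv hy
  rw [e, modelWithCornersSelf_coe, range_id, mfderivWithin_univ] at h
  exact h

/-- The coordinate representation of a vector field in the chart at `c`. -/
def coord (c : M) (X : VField m M) (y : EuclideanSpace ℝ (Fin m)) : EuclideanSpace ℝ (Fin m) :=
  toCoord c (inv m c y) (X (inv m c y))

/-- The vector field with constant coordinates in the chart at `c`. -/
def constField (c : M) (a : EuclideanSpace ℝ (Fin m)) : VField m M := fun x => ofCoord c x a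

lemma coord_constField (c : M) (a : EuclideanSpace ℝ (Fin m)) {y : EuclideanSpace ℝ (Fin m)}
    (hy : y ∈ dom m c) : coord c (constField c a) y = a :=
  toCoord_ofCoord (inv_mem c hy) a

lemma contMDiffOn_inv (c : M) :
    ContMDiffOn 𝓘(ℝ, EuclideanSpace ℝ (Fin m)) (𝓡 m) ∞ (inv m c) (dom m c) :=
  contMDiffOn_chart_symm

lemma contMDiffAt_inv (c : M) {y : EuclideanSpace ℝ (Fin m)} (hy : y ∈ dom m c) :
    ContMDiffAt 𝓘(ℝ, EuclideanSpace ℝ (Fin m)) (𝓡 m) ∞ (inv m c) y :=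
  (contMDiffOn_inv c).contMDiffAt ((isOpen_dom c).mem_nhds hy)

lemma contMDiffAt_chart (c : M) {x : M} (hx : x ∈ (chartAt (EuclideanSpace ℝ (Fin m)) c).source) :
    ContMDiffAt (𝓡 m) 𝓘(ℝ, EuclideanSpace ℝ (Fin m)) ∞ (chartAt (EuclideanSpace ℝ (Fin m)) c) x :=
  contMDiffOn_chart.contMDiffAt ((chartAt _ c).open_source.mem_nhds hx)

section Functions

variable {F : Type*} [NormedAddCommGroup F] [NormedSpace ℝ F]

lemma mdifferentiableAt_iff {c : M} {f : M → F} {y : EuclideanSpace ℝ (Fin m)} (hy : y ∈ dom m c) :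
    MDifferentiableAt (𝓡 m) 𝓘(ℝ, F) f (inv m c y) ↔ DifferentiableAt ℝ (f ∘ inv m c) y := by
  rw [← mdifferentiableAt_iff_differentiableAt]
  constructor
  · intro h
    exact h.comp y ((contMDiffAt_inv c hy).mdifferentiableAt (by simp))
  · intro h
    have h' : MDifferentiableAt 𝓘(ℝ, EuclideanSpace ℝ (Fin m)) 𝓘(ℝ, F) (f ∘ inv m c)
      (chartAt (EuclideanSpace ℝ (Fin m)) c (inv m c y)) := by rwa [chart_inv c hy]
    refine (h'.comp _ ((contMDiffAt_chart c (inv_mem c hy)).mdifferentiableAt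
      (by simp))).congr_of_eventuallyEq ?_
    filter_upwards [eventually_inv_chart c (inv_mem c hy)] with z hz
    simp [hz]

lemma mvfderiv_eq {c : M} {f : M → F} {y : EuclideanSpace ℝ (Fin m)} (hy : y ∈ dom m c)
    (hf : MDifferentiableAt (𝓡 m) 𝓘(ℝ, F) f (inv m c y)) (v : TangentSpace (𝓡 m) (inv m c y)) :
    mvfderiv (𝓡 m) f (inv m c y) v = fderiv ℝ (f ∘ inv m c) y (toCoord c (inv m c y) v) := by
  have h1 := mfderiv_comp y hf ((contMDiffAt_inv c hy).mdifferentiableAt (by simp))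
  rw [← ofCoord_eq_mfderiv hy, mfderiv_eq_fderiv] at h1
  have h2 := congrArg (fun L : EuclideanSpace ℝ (Fin m) →L[ℝ] F => L (toCoord c (inv m c y) v)) h1
  have h3 : fderiv ℝ (f ∘ inv m c) y (toCoord c (inv m c y) v) =
    mfderiv (𝓡 m) 𝓘(ℝ, F) f (inv m c y) (ofCoord c (inv m c y) (toCoord c (inv m c y) v)) := h2
  rw [h3, ofCoord_toCoord (inv_mem c hy)]
  rfl

lemma contMDiffAt_iff {c : M} {f : M → F} {n : WithTop ℕ∞} (hn : n ≤ ∞)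
    {y : EuclideanSpace ℝ (Fin m)} (hy : y ∈ dom m c) :
    ContMDiffAt (𝓡 m) 𝓘(ℝ, F) n f (inv m c y) ↔ ContDiffAt ℝ n (f ∘ inv m c) y := by
  rw [← contMDiffAt_iff_contDiffAt]
  constructor
  · intro h
    exact h.comp y ((contMDiffAt_inv c hy).of_le hn)
  · intro h
    have h' : ContMDiffAt 𝓘(ℝ, EuclideanSpace ℝ (Fin m)) 𝓘(ℝ, F) n (f ∘ inv m c)
      (chartAt (EuclideanSpace ℝ (Fin m)) c (inv m c y)) := by rwa [chart_inv c hy]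
    refine (h'.comp _ ((contMDiffAt_chart c (inv_mem c hy)).of_le hn)).congr_of_eventuallyEq ?_
    filter_upwards [eventually_inv_chart c (inv_mem c hy)] with z hz
    simp [hz]

end Functions

section Fields

lemma section_eq {c x : M} (hx : x ∈ (chartAt (EuclideanSpace ℝ (Fin m)) c).source)
    (X : VField m M) :
    (trivializationAt (EuclideanSpace ℝ (Fin m)) (TangentSpace (𝓡 m)) c ⟨x, X x⟩).2 =
      toCoord c x (X x) := by
  rw [toCoord, Trivialization.continuousLinearMapAt_apply, Trivialization.linearMapAt_apply]
  exact (if_pos hx).symm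

lemma isDiffFieldAt_iff {c : M} {X : VField m M} {y : EuclideanSpace ℝ (Fin m)}
    (hy : y ∈ dom m c) : IsDiffFieldAt X (inv m c y) ↔ DifferentiableAt ℝ (coord c X) y := by
  have h := (trivializationAt (EuclideanSpace ℝ (Fin m))
    (TangentSpace (𝓡 m)) c).mdifferentiableAt_section_iff (𝓡 m) X (inv_mem c hy)
  rw [IsDiffFieldAt, h, mdifferentiableAt_iff hy]
  refine Filter.EventuallyEq.differentiableAt_iff ?_
  filter_upwards [(isOpen_dom c).mem_nhds hy] with z hz
  exact section_eq (inv_mem c hz) X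

lemma contMDiffAt_field_iff {c : M} {X : VField m M} {y : EuclideanSpace ℝ (Fin m)}
    (hy : y ∈ dom m c) : ContMDiffAt (𝓡 m) (𝓡 m).tangent ∞
      (fun x => (⟨x, X x⟩ : TangentBundle (𝓡 m) M)) (inv m c y) ↔
        ContDiffAt ℝ ∞ (coord c X) y := by
  have h := (trivializationAt (EuclideanSpace ℝ (Fin m))
    (TangentSpace (𝓡 m)) c).contMDiffAt_section_iff (IB := 𝓡 m) (n := ∞) (s := X) (inv_mem c hy)
  refine h.trans ?_
  rw [contMDiffAt_iff le_rfl hy]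
  have e : (fun x => (trivializationAt (EuclideanSpace ℝ (Fin m)) (TangentSpace (𝓡 m)) c
      ⟨x, X x⟩).2) ∘ inv m c =ᶠ[𝓝 y] coord c X := by
    filter_upwards [(isOpen_dom c).mem_nhds hy] with z hz
    exact section_eq (inv_mem c hz) X
  exact ⟨fun h => h.congr_of_eventuallyEq e.symm, fun h => h.congr_of_eventuallyEq e⟩

lemma _root_.IsSmoothField.contDiffOn_coord {X : VField m M} (hX : IsSmoothField X) (c : M) :
    ContDiffOn ℝ ∞ (coord c X) (dom m c) := fun _ hy =>
  ((contMDiffAt_field_iff hy).1 (hX _)).contDiffWithinAt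

lemma isDiffFieldAt_of_contDiffOn {c : M} {X : VField m M}
    (hX : ContDiffOn ℝ ∞ (coord c X) (dom m c)) {y : EuclideanSpace ℝ (Fin m)}
    (hy : y ∈ dom m c) : IsDiffFieldAt X (inv m c y) :=
  (isDiffFieldAt_iff hy).2 ((hX.contDiffAt ((isOpen_dom c).mem_nhds hy)).differentiableAt (by simp))

lemma contDiffOn_coord_constField (c : M) (a : EuclideanSpace ℝ (Fin m)) :
    ContDiffOn ℝ ∞ (coord c (constField c a)) (dom m c) :=
  contDiffOn_const.congr fun _ hy => coord_constField c a hy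

lemma isDiffFieldAt_constField (c : M) (a : EuclideanSpace ℝ (Fin m))
    {y : EuclideanSpace ℝ (Fin m)} (hy : y ∈ dom m c) :
    IsDiffFieldAt (constField c a) (inv m c y) :=
  isDiffFieldAt_of_contDiffOn (contDiffOn_coord_constField c a) hy

/-- Lets coordinate expressions inherit the naturality of the Lie bracket under pull-back. -/
lemma mpullback_inv {c : M} (X : VField m M) {y : EuclideanSpace ℝ (Fin m)} (hy : y ∈ dom m c) :
    VectorField.mpullback 𝓘(ℝ, EuclideanSpace ℝ (Fin m)) (𝓡 m) (inv m c) X y = coord c X y := by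
  have hi : (ofCoord c (inv m c y)).inverse = toCoord c (inv m c y) :=
    ContinuousLinearMap.inverse_eq (by ext1 v; exact ofCoord_toCoord (inv_mem c hy) v)
      (by ext1 v; exact toCoord_ofCoord (inv_mem c hy) v)
  have e : VectorField.mpullback 𝓘(ℝ, EuclideanSpace ℝ (Fin m)) (𝓡 m) (inv m c) X y =
      (ofCoord c (inv m c y)).inverse (X (inv m c y)) := by
    rw [ofCoord_eq_mfderiv hy]
    rfl
  rw [e, hi]
  rfl

lemma mlieBracket_eq_lieBracket {F : Type*} [NormedAddCommGroup F] [NormedSpace ℝ F]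
    (V W : (x : F) → TangentSpace 𝓘(ℝ, F) x) :
    VectorField.mlieBracket 𝓘(ℝ, F) V W = VectorField.lieBracket ℝ V W := by
  rw [← VectorField.mlieBracketWithin_univ, VectorField.mlieBracketWithin_eq_lieBracketWithin]
  exact VectorField.lieBracketWithin_univ

lemma coord_mlieBracket {c : M} {X Y : VField m M} {y : EuclideanSpace ℝ (Fin m)}
    (hy : y ∈ dom m c) (hX : IsDiffFieldAt X (inv m c y)) (hY : IsDiffFieldAt Y (inv m c y)) :
    coord c (VectorField.mlieBracket (𝓡 m) X Y) y =
      fderiv ℝ (coord c Y) y (coord c X y) - fderiv ℝ (coord c X) y (coord c Y y) := by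
  have : IsManifold (𝓡 m) (minSmoothness ℝ 2) M := by
    rw [minSmoothness_of_isRCLikeNormedField]
    exact IsManifold.of_le (n := ∞) (WithTop.coe_le_coe.2 (le_top : (2 : ℕ∞) ≤ ⊤))
  have h := VectorField.mpullback_mlieBracket (I := 𝓘(ℝ, EuclideanSpace ℝ (Fin m)))
    (n := ∞) (f := inv m c) hX hY (contMDiffAt_inv c hy)
    (by rw [minSmoothness_of_isRCLikeNormedField]
        exact WithTop.coe_le_coe.2 (le_top : (2 : ℕ∞) ≤ ⊤))
  rw [mpullback_inv _ hy] at h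
  refine h.trans ?_
  refine (Filter.EventuallyEq.mlieBracket_vectorField_eq
    (V := VectorField.mpullback 𝓘(ℝ, EuclideanSpace ℝ (Fin m)) (𝓡 m) (inv m c) X)
    (W := VectorField.mpullback 𝓘(ℝ, EuclideanSpace ℝ (Fin m)) (𝓡 m) (inv m c) Y)
    (V₁ := coord c X) (W₁ := coord c Y) ?_ ?_).symm.trans ?_
  · filter_upwards [(isOpen_dom c).mem_nhds hy] with z hz using (mpullback_inv X hz).symm
  · filter_upwards [(isOpen_dom c).mem_nhds hy] with z hz using (mpullback_inv Y hz).symm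
  · exact congrFun (mlieBracket_eq_lieBracket (coord c X) (coord c Y)) y

end Fields

end Coordinates

/-! ### The metric, its inverse and its Christoffel symbols in a chart -/

namespace PseudoRiemannianMetric

open Coordinates FlatModel

variable {m : ℕ} {M : Type*} [TopologicalSpace M]
  [ChartedSpace (EuclideanSpace ℝ (Fin m)) M] [IsManifold (𝓡 m) ∞ M]
  (g : PseudoRiemannianMetric m M)

/-- The coefficients of the metric in the chart at `c`. -/
def localMetric (c : M) (y : EuclideanSpace ℝ (Fin m)) :
    EuclideanSpace ℝ (Fin m) →L[ℝ] EuclideanSpace ℝ (Fin m) →L[ℝ] ℝ :=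
  ContinuousLinearMap.precomp ℝ (ofCoord c (inv m c y)) ∘L g.inner (inv m c y) ∘L
    ofCoord c (inv m c y)

lemma localMetric_apply (c : M) (y a b : EuclideanSpace ℝ (Fin m)) :
    g.localMetric c y a b = g.inner (inv m c y) (ofCoord c (inv m c y) a)
      (ofCoord c (inv m c y) b) := rfl

lemma localMetric_toCoord {c : M} {y : EuclideanSpace ℝ (Fin m)} (hy : y ∈ dom m c)
    (v w : TangentSpace (𝓡 m) (inv m c y)) :
    g.localMetric c y (toCoord c _ v) (toCoord c _ w) = g.inner (inv m c y) v w := by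
  rw [localMetric_apply, ofCoord_toCoord (inv_mem c hy), ofCoord_toCoord (inv_mem c hy)]

lemma pair_comp_inv {c : M} {y : EuclideanSpace ℝ (Fin m)} (hy : y ∈ dom m c) (X Y : VField m M) :
    g.pair X Y (inv m c y) = g.localMetric c y (coord c X y) (coord c Y y) :=
  (g.localMetric_toCoord hy _ _).symm

lemma contMDiffAt_constField (c : M) (a : EuclideanSpace ℝ (Fin m))
    {y : EuclideanSpace ℝ (Fin m)} (hy : y ∈ dom m c) : ContMDiffAt (𝓡 m) (𝓡 m).tangent ∞
      (fun x => (⟨x, constField c a x⟩ : TangentBundle (𝓡 m) M)) (inv m c y) :=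
  (contMDiffAt_field_iff hy).2
    ((contDiffOn_coord_constField c a).contDiffAt ((isOpen_dom c).mem_nhds hy))

lemma contDiffOn_localMetric (c : M) : ContDiffOn ℝ ∞ (g.localMetric c) (dom m c) := by
  refine contDiffOn_clm_apply.2 fun a => contDiffOn_clm_apply.2 fun b => fun y hy => ?_
  have h := ContMDiffAt.clm_bundle_apply₂ (IM := 𝓡 m) (IB := 𝓡 m)
    (F₁ := EuclideanSpace ℝ (Fin m)) (F₂ := EuclideanSpace ℝ (Fin m)) (F₃ := ℝ)
    (E₁ := fun x : M => TangentSpace (𝓡 m) x) (E₂ := fun x : M => TangentSpace (𝓡 m) x)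
    (E₃ := Bundle.Trivial M ℝ) (b := fun x : M => x) g.contMDiff.contMDiffAt
    (contMDiffAt_constField c a hy) (contMDiffAt_constField c b hy)
  rw [contMDiffAt_totalSpace] at h
  have h2 : ContMDiffAt (𝓡 m) 𝓘(ℝ, ℝ) ∞ (fun x => g.inner x (constField c a x) (constField c b x))
    (inv m c y) := h.2
  exact ((contMDiffAt_iff le_rfl hy).1 h2).contDiffWithinAt

lemma localMetric_symm (c : M) (y a b : EuclideanSpace ℝ (Fin m)) :
    g.localMetric c y a b = g.localMetric c y b a := g.symm _ _ _

lemma localMetric_nondeg {c : M} {y : EuclideanSpace ℝ (Fin m)} (hy : y ∈ dom m c)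
    (a : EuclideanSpace ℝ (Fin m)) (h : ∀ b, g.localMetric c y a b = 0) : a = 0 := by
  have e : ofCoord c (inv m c y) a = 0 := by
    refine g.nondegenerate _ _ fun w => ?_
    have := h (toCoord c _ w)
    rwa [localMetric_apply, ofCoord_toCoord (inv_mem c hy)] at this
  rw [← toCoord_ofCoord (inv_mem c hy) a, e, map_zero]

/-- Nondegeneracy in the form required for smoothness of the inverse metric: inversion of continuous
linear maps is smooth at an equivalence. -/
lemma exists_equiv_localMetric {c : M} {y : EuclideanSpace ℝ (Fin m)} (hy : y ∈ dom m c) :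
    ∃ e : EuclideanSpace ℝ (Fin m) ≃L[ℝ] (EuclideanSpace ℝ (Fin m) →L[ℝ] ℝ),
      (e : EuclideanSpace ℝ (Fin m) →L[ℝ] _) = g.localMetric c y := by
  refine ⟨ContinuousLinearEquiv.ofBijective (g.localMetric c y) ?_ ?_,
    ContinuousLinearEquiv.coe_ofBijective _ _ _⟩
  · refine LinearMap.ker_eq_bot'.2 fun a ha => g.localMetric_nondeg hy a fun b => ?_
    exact DFunLike.congr_fun (F := EuclideanSpace ℝ (Fin m) →L[ℝ] ℝ) ha b
  · refine LinearMap.range_eq_top.2 fun α => ?_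
    refine ⟨toCoord c _ (g.sharp _ (α ∘L toCoord c (inv m c y))), ?_⟩
    ext1 b
    change g.localMetric c y _ b = α b
    rw [localMetric_apply, ofCoord_toCoord (inv_mem c hy), inner_sharp]
    simp [toCoord_ofCoord (inv_mem c hy)]

/-- The inverse of the metric in the chart at `c`: the musical isomorphism `♯`. -/
def localSharp (c : M) (y : EuclideanSpace ℝ (Fin m)) :
    (EuclideanSpace ℝ (Fin m) →L[ℝ] ℝ) →L[ℝ] EuclideanSpace ℝ (Fin m) :=
  (g.localMetric c y).inverse

lemma localMetric_localSharp {c : M} {y : EuclideanSpace ℝ (Fin m)} (hy : y ∈ dom m c)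
    (α : EuclideanSpace ℝ (Fin m) →L[ℝ] ℝ) : g.localMetric c y (g.localSharp c y α) = α := by
  obtain ⟨e, he⟩ := g.exists_equiv_localMetric hy
  rw [localSharp, ← he, ContinuousLinearMap.inverse_equiv]
  exact e.apply_symm_apply α

lemma contDiffOn_localSharp (c : M) : ContDiffOn ℝ ∞ (g.localSharp c) (dom m c) := by
  intro y hy
  obtain ⟨e, he⟩ := g.exists_equiv_localMetric hy
  have h : ContDiffAt ℝ ∞ ContinuousLinearMap.inverse (g.localMetric c y) := by
    rw [← he]
    exact contDiffAt_map_inverse e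
  exact h.comp_contDiffWithinAt y (g.contDiffOn_localMetric c y hy)

/-- The Christoffel symbols of the first kind. -/
def christoffelLower (c : M) (y : EuclideanSpace ℝ (Fin m)) : EuclideanSpace ℝ (Fin m) →L[ℝ]
    EuclideanSpace ℝ (Fin m) →L[ℝ] EuclideanSpace ℝ (Fin m) →L[ℝ] ℝ :=
  (1 / 2 : ℝ) • (fderiv ℝ (g.localMetric c) y + (fderiv ℝ (g.localMetric c) y).flip
    - (ContinuousLinearMap.flipₗᵢ ℝ (EuclideanSpace ℝ (Fin m)) (EuclideanSpace ℝ (Fin m))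
        ℝ).toContinuousLinearEquiv.toContinuousLinearMap ∘L (fderiv ℝ (g.localMetric c) y).flip)

lemma christoffelLower_apply (c : M) (y a b z : EuclideanSpace ℝ (Fin m)) :
    g.christoffelLower c y a b z = (1 / 2) * (fderiv ℝ (g.localMetric c) y a b z
      + fderiv ℝ (g.localMetric c) y b a z - fderiv ℝ (g.localMetric c) y z a b) := rfl

/-- The Christoffel symbols. -/
def christoffel (c : M) (y : EuclideanSpace ℝ (Fin m)) : EuclideanSpace ℝ (Fin m) →L[ℝ]
    EuclideanSpace ℝ (Fin m) →L[ℝ] EuclideanSpace ℝ (Fin m) :=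
  ContinuousLinearMap.compL ℝ _ _ _ (g.localSharp c y) ∘L g.christoffelLower c y

lemma localMetric_christoffel {c : M} {y : EuclideanSpace ℝ (Fin m)} (hy : y ∈ dom m c)
    (a b z : EuclideanSpace ℝ (Fin m)) :
    g.localMetric c y (g.christoffel c y a b) z = g.christoffelLower c y a b z :=
  DFunLike.congr_fun (g.localMetric_localSharp hy (g.christoffelLower c y a b)) z

lemma contDiffOn_christoffelLower (c : M) :
    ContDiffOn ℝ ∞ (g.christoffelLower c) (dom m c) := by
  have h1 : ContDiffOn ℝ ∞ (fderiv ℝ (g.localMetric c)) (dom m c) :=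
    (g.contDiffOn_localMetric c).fderiv_of_isOpen (isOpen_dom c) (by simp)
  have h2 : ∀ a b z : EuclideanSpace ℝ (Fin m),
      ContDiffOn ℝ ∞ (fun y => fderiv ℝ (g.localMetric c) y a b z) (dom m c) := fun a b z =>
    ((h1.clm_apply contDiffOn_const).clm_apply contDiffOn_const).clm_apply contDiffOn_const
  refine contDiffOn_clm_apply.2 fun a => contDiffOn_clm_apply.2 fun b =>
    contDiffOn_clm_apply.2 fun z => ?_
  simp only [christoffelLower_apply]
  exact contDiffOn_const.mul (((h2 a b z).add (h2 b a z)).sub (h2 z a b))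

lemma contDiffOn_christoffel (c : M) : ContDiffOn ℝ ∞ (g.christoffel c) (dom m c) :=
  contDiffOn_clm_apply.2 fun _ => contDiffOn_clm_apply.2 fun _ =>
    (g.contDiffOn_localSharp c).clm_apply
      (((g.contDiffOn_christoffelLower c).clm_apply contDiffOn_const).clm_apply contDiffOn_const)

lemma fderiv_localMetric_symm {c : M} {y : EuclideanSpace ℝ (Fin m)} (hy : y ∈ dom m c)
    (u a b : EuclideanSpace ℝ (Fin m)) :
    fderiv ℝ (g.localMetric c) y u a b = fderiv ℝ (g.localMetric c) y u b a := by
  have hG := hasFDerivAt_of_contDiffOn (isOpen_dom c) (g.contDiffOn_localMetric c) hy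
  have := fderiv_apply_eq (isOpen_dom c) (f := fun z => g.localMetric c z a b)
    (f' := fun z => g.localMetric c z b a) (fun z _ => g.localMetric_symm c z a b) hy
    ((hG.clm_apply (hasFDerivAt_const a y)).clm_apply (hasFDerivAt_const b y))
    ((hG.clm_apply (hasFDerivAt_const b y)).clm_apply (hasFDerivAt_const a y)) u
  simpa using this

/-- The Christoffel symbols are given by the Koszul formula for constant fields. Torsion-freeness
and compatibility are then index symmetries of the first derivatives of the metric. -/
theorem isLocalMetric (c : M) : IsLocalMetric (dom m c) (g.localMetric c) (g.christoffel c) where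
  isOpen := isOpen_dom c
  smooth := g.contDiffOn_localMetric c
  smooth_conn := g.contDiffOn_christoffel c
  symm y _ := g.localMetric_symm c y
  nondeg _ hy := g.localMetric_nondeg hy
  torsion y hy a b := by
    rw [← sub_eq_zero]
    refine g.localMetric_nondeg hy _ fun z => ?_
    rw [map_sub, sub_apply, g.localMetric_christoffel hy, g.localMetric_christoffel hy,
      christoffelLower_apply, christoffelLower_apply, g.fderiv_localMetric_symm hy z a b]
    ring
  compat y hy u a b := by
    rw [g.localMetric_christoffel hy, g.localMetric_symm c y a, g.localMetric_christoffel hy,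
      christoffelLower_apply, christoffelLower_apply, g.fderiv_localMetric_symm hy a u b,
      g.fderiv_localMetric_symm hy b u a, g.fderiv_localMetric_symm hy u b a]
    ring

/-- The Levi-Civita connection in coordinates. -/
theorem toCoord_leviCivita {c : M} {y : EuclideanSpace ℝ (Fin m)} (hy : y ∈ dom m c)
    {Y : VField m M} (hY : IsDiffFieldAt Y (inv m c y)) (v : TangentSpace (𝓡 m) (inv m c y)) :
    toCoord c (inv m c y) (g.leviCivita Y (inv m c y) v) =
      covVec (g.christoffel c) (coord c Y) y (toCoord c (inv m c y) v) := by
  have hL := g.isLocalMetric c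
  have hYd := (isDiffFieldAt_iff hy).1 hY
  have hG := hL.hasFDerivAt_metric hy
  have hd : ∀ X Z : VField m M, IsDiffFieldAt X (inv m c y) → IsDiffFieldAt Z (inv m c y) →
      ∀ w, mvfderiv (𝓡 m) (g.pair X Z) (inv m c y) w =
      fderiv ℝ (fun z => g.localMetric c z (coord c X z) (coord c Z z)) y
        (toCoord c (inv m c y) w) := by
    intro X Z hX hZ w
    rw [mvfderiv_eq hy (g.mdifferentiableAt_pair hX hZ) w]
    congr 1
    refine Filter.EventuallyEq.fderiv_eq ?_
    filter_upwards [(isOpen_dom c).mem_nhds hy] with z hz using g.pair_comp_inv hz X Z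
  refine hL.ext_metric hy fun z => ?_
  set a := toCoord c (inv m c y) v with ha
  -- The Koszul expression is tensorial in the direction and in the test field, so both may have
  -- constant coordinates, and only derivatives of `Y` and of the metric remain.
  have hX := isDiffFieldAt_constField c a hy
  have hZ := isDiffFieldAt_constField c z hy
  have hXd := (isDiffFieldAt_iff hy).1 hX
  have hZd := (isDiffFieldAt_iff hy).1 hZ
  have hX0 := coord_constField c a hy
  have hZ0 := coord_constField c z hy
  have hc : ∀ a : EuclideanSpace ℝ (Fin m), fderiv ℝ (coord c (constField c a)) y = 0 := by
    intro a
    have : coord c (constField c a) =ᶠ[𝓝 y] fun _ => a := by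
      filter_upwards [(isOpen_dom c).mem_nhds hy] with z hz using coord_constField c a hz
    rw [this.fderiv_eq, fderiv_const_apply]
  have k := g.inner_leviCivitaFun hX hY hZ
  have hv : constField c a (inv m c y) = v := ofCoord_toCoord (inv_mem c hy) v
  have k2 : g.localMetric c y (toCoord c (inv m c y) (g.leviCivita Y (inv m c y) v)) z
      = (1 / 2) * g.koszul (constField c a) Y (constField c z) (inv m c y) := by
    rw [← k, hv, localMetric_apply, ofCoord_toCoord (inv_mem c hy)]
    rfl
  have br : ∀ A B C : VField m M, g.inner (inv m c y)
      (VectorField.mlieBracket (𝓡 m) A B (inv m c y)) (C (inv m c y)) =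
      g.localMetric c y (coord c (VectorField.mlieBracket (𝓡 m) A B) y) (coord c C y) :=
    fun A B C => (g.localMetric_toCoord hy _ _).symm
  rw [k2, koszul, br, br, br, hd _ _ hY hZ, hd _ _ hZ hX, hd _ _ hX hY,
    hL.fderiv_metric hy hYd hZd, hL.fderiv_metric hy hZd hXd, hL.fderiv_metric hy hXd hYd,
    coord_mlieBracket hy hX hY, coord_mlieBracket hy hY hZ, coord_mlieBracket hy hZ hX]
  change 1 / 2 * (_ + _ - _ + _ - _ + _) = _
  have t1 : toCoord c (inv m c y) (constField c a (inv m c y)) = a := hX0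
  have t2 : toCoord c (inv m c y) (Y (inv m c y)) = coord c Y y := rfl
  have t3 : toCoord c (inv m c y) (constField c z (inv m c y)) = z := hZ0
  rw [t1, t2, t3, hX0, hZ0]
  simp only [covVec_apply, hc, hX0, hZ0, zero_apply, zero_add, map_add, add_apply,
    zero_sub, sub_zero, map_zero, neg_apply, map_neg]
  have s := g.localMetric_symm c y
  rw [hL.torsion y hy (coord c Y y) a, hL.torsion y hy z a, hL.torsion y hy (coord c Y y) z,
    s a (fderiv ℝ (coord c Y) y z), s z (g.christoffel c y a (coord c Y y)),
    s (coord c Y y) (g.christoffel c y a z), s a (g.christoffel c y z (coord c Y y))]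
  ring

lemma coord_nabla {c : M} {y : EuclideanSpace ℝ (Fin m)} (hy : y ∈ dom m c)
    (X : VField m M) {Y : VField m M} (hY : IsDiffFieldAt Y (inv m c y)) :
    coord c (g.nabla X Y) y = covVec (g.christoffel c) (coord c Y) y (coord c X y) :=
  g.toCoord_leviCivita hy hY _

end PseudoRiemannianMetric

/-! ### Curvature, Ricci tensor and Lie derivative of the connection in a chart -/

namespace PseudoRiemannianMetric

open Coordinates FlatModel

variable {m : ℕ} {M : Type*} [TopologicalSpace M]
  [ChartedSpace (EuclideanSpace ℝ (Fin m)) M] [IsManifold (𝓡 m) ∞ M]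
  (g : PseudoRiemannianMetric m M)

/-- The extensions of tangent vectors used to define curvature and trace are known to be smooth only
on part of a chart, so the coordinate formulas are needed on smaller open sets. -/
lemma _root_.FlatModel.IsLocalMetric.mono {E : Type*} [NormedAddCommGroup E] [NormedSpace ℝ E]
    {U V : Set E} {G : E → E →L[ℝ] E →L[ℝ] ℝ} {Γ : E → E →L[ℝ] E →L[ℝ] E}
    (h : IsLocalMetric U G Γ) (hV : IsOpen V) (hVU : V ⊆ U) : IsLocalMetric V G Γ where
  isOpen := hV
  smooth := h.smooth.mono hVU
  smooth_conn := h.smooth_conn.mono hVU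
  symm y hy := h.symm y (hVU hy)
  nondeg y hy := h.nondeg y (hVU hy)
  torsion y hy := h.torsion y (hVU hy)
  compat y hy := h.compat y (hVU hy)

section Curvature

variable {c : M} {V : Set (EuclideanSpace ℝ (Fin m))} (hV : IsOpen V) (hVU : V ⊆ dom m c)
include hV hVU

lemma isDiffFieldAt_of_contDiffOn_subset {X : VField m M} (hX : ContDiffOn ℝ ∞ (coord c X) V)
    {y : EuclideanSpace ℝ (Fin m)} (hy : y ∈ V) : IsDiffFieldAt X (inv m c y) :=
  (isDiffFieldAt_iff (hVU hy)).2 ((hX.contDiffAt (hV.mem_nhds hy)).differentiableAt (by simp))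

lemma eqOn_coord_nabla (X : VField m M) {Y : VField m M} (hY : ContDiffOn ℝ ∞ (coord c Y) V) :
    EqOn (coord c (g.nabla X Y)) (fun y => covVec (g.christoffel c) (coord c Y) y (coord c X y)) V :=
  fun _ hy => g.coord_nabla (hVU hy) X (isDiffFieldAt_of_contDiffOn_subset hV hVU hY hy)

lemma contDiffOn_coord_nabla {X Y : VField m M} (hX : ContDiffOn ℝ ∞ (coord c X) V)
    (hY : ContDiffOn ℝ ∞ (coord c Y) V) : ContDiffOn ℝ ∞ (coord c (g.nabla X Y)) V :=
  (((g.isLocalMetric c).mono hV hVU).contDiffOn_covVec hY |>.clm_apply hX).congr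
    (g.eqOn_coord_nabla hV hVU X hY)

/-- Second covariant derivatives in coordinates. -/
lemma coord_nabla_nabla {X Y Z : VField m M} (hY : ContDiffOn ℝ ∞ (coord c Y) V)
    (hZ : ContDiffOn ℝ ∞ (coord c Z) V) {y : EuclideanSpace ℝ (Fin m)} (hy : y ∈ V) :
    coord c (g.nabla X (g.nabla Y Z)) y =
      covEnd (g.christoffel c) (covVec (g.christoffel c) (coord c Z)) y (coord c X y)
        (coord c Y y) + covVec (g.christoffel c) (coord c Z) y
          (covVec (g.christoffel c) (coord c Y) y (coord c X y)) := by
  have hL := (g.isLocalMetric c).mono hV hVU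
  rw [g.coord_nabla (hVU hy) X (isDiffFieldAt_of_contDiffOn_subset hV hVU
    (g.contDiffOn_coord_nabla hV hVU hY hZ) hy),
    ← hL.covVec_apply_field (hL.contDiffOn_covVec hZ) hY hy]
  have e : coord c (g.nabla Y Z) =ᶠ[𝓝 y]
      fun z => covVec (g.christoffel c) (coord c Z) z (coord c Y z) := by
    filter_upwards [hV.mem_nhds hy] with z hz using g.eqOn_coord_nabla hV hVU Y hZ hz
  simp only [covVec_apply, e.fderiv_eq, e.eq_of_nhds]

lemma coord_mlieBracket_eq_sub {X Y : VField m M} (hX : ContDiffOn ℝ ∞ (coord c X) V)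
    (hY : ContDiffOn ℝ ∞ (coord c Y) V) {y : EuclideanSpace ℝ (Fin m)} (hy : y ∈ V) :
    coord c (VectorField.mlieBracket (𝓡 m) X Y) y =
      coord c (g.nabla X Y) y - coord c (g.nabla Y X) y := by
  have hd := fun {X : VField m M} (hX : ContDiffOn ℝ ∞ (coord c X) V) =>
    isDiffFieldAt_of_contDiffOn_subset hV hVU hX hy
  simp only [coord_mlieBracket (hVU hy) (hd hX) (hd hY), g.coord_nabla (hVU hy) _ (hd hX),
    g.coord_nabla (hVU hy) _ (hd hY), covVec_apply,
    (g.isLocalMetric c).torsion y (hVU hy) (coord c X y)]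
  abel

/-- The curvature in coordinates. -/
lemma coord_curvature {X Y Z : VField m M} (hX : ContDiffOn ℝ ∞ (coord c X) V)
    (hY : ContDiffOn ℝ ∞ (coord c Y) V) (hZ : ContDiffOn ℝ ∞ (coord c Z) V)
    {y : EuclideanSpace ℝ (Fin m)} (hy : y ∈ V) :
    coord c (g.curvature X Y Z) y =
      - curv (g.christoffel c) y (coord c X y) (coord c Y y) (coord c Z y) := by
  have hL := (g.isLocalMetric c).mono hV hVU
  have hd := fun {X : VField m M} (hX : ContDiffOn ℝ ∞ (coord c X) V) =>
    isDiffFieldAt_of_contDiffOn_subset hV hVU hX hy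
  have e : coord c (g.curvature X Y Z) y =
      coord c (g.nabla (VectorField.mlieBracket (𝓡 m) X Y) Z) y
        - (coord c (g.nabla X (g.nabla Y Z)) y - coord c (g.nabla Y (g.nabla X Z)) y) := by
    simp only [coord, curvature, Pi.sub_apply, map_sub]
  -- The terms beyond the second covariant derivative of `Z` cancel against ∇_{[X, Y]} Z by
  -- torsion-freeness. The minus sign in front of `curv` is the convention of `curvature`.
  rw [e, g.coord_nabla_nabla hV hVU hY hZ hy, g.coord_nabla_nabla hV hVU hX hZ hy,
    g.coord_nabla (hVU hy) _ (hd hZ), g.coord_mlieBracket_eq_sub hV hVU hX hY hy,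
    ← hL.ricci_identity hZ hy, g.coord_nabla (hVU hy) _ (hd hX),
    g.coord_nabla (hVU hy) _ (hd hY), map_sub]
  abel

/-- The Lie derivative of the connection in coordinates. -/
lemma coord_lieConnection {W X Y : VField m M} (hW : ContDiffOn ℝ ∞ (coord c W) V)
    (hX : ContDiffOn ℝ ∞ (coord c X) V) (hY : ContDiffOn ℝ ∞ (coord c Y) V)
    {y : EuclideanSpace ℝ (Fin m)} (hy : y ∈ V) : coord c (g.lieConnection W X Y) y =
      covEnd (g.christoffel c) (covVec (g.christoffel c) (coord c W)) y (coord c X y) (coord c Y y)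
        + curv (g.christoffel c) y (coord c W y) (coord c X y) (coord c Y y) := by
  have hL := (g.isLocalMetric c).mono hV hVU
  have hd := fun {X : VField m M} (hX : ContDiffOn ℝ ∞ (coord c X) V) =>
    isDiffFieldAt_of_contDiffOn_subset hV hVU hX hy
  have hn := fun {X Y : VField m M} (hX : ContDiffOn ℝ ∞ (coord c X) V)
    (hY : ContDiffOn ℝ ∞ (coord c Y) V) => g.contDiffOn_coord_nabla hV hVU hX hY
  have hB : ContDiffOn ℝ ∞ (coord c (VectorField.mlieBracket (𝓡 m) W Y)) V :=
    ((hn hW hY).sub (hn hY hW)).congr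
      fun _ hz => g.coord_mlieBracket_eq_sub hV hVU hW hY hz
  have e1 : coord c (g.nabla X (VectorField.mlieBracket (𝓡 m) W Y)) y =
      coord c (g.nabla X (g.nabla W Y)) y - coord c (g.nabla X (g.nabla Y W)) y := by
    have e : coord c (VectorField.mlieBracket (𝓡 m) W Y) =ᶠ[𝓝 y]
        fun z => coord c (g.nabla W Y) z - coord c (g.nabla Y W) z := by
      filter_upwards [hV.mem_nhds hy] with z hz
      exact g.coord_mlieBracket_eq_sub hV hVU hW hY hz
    have d := fun {X : VField m M} (hX : ContDiffOn ℝ ∞ (coord c X) V) =>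
      (isDiffFieldAt_iff (hVU hy)).1 (hd hX)
    rw [g.coord_nabla (hVU hy) _ (hd hB), g.coord_nabla (hVU hy) _ (hd (hn hW hY)),
      g.coord_nabla (hVU hy) _ (hd (hn hY hW))]
    simp only [covVec_apply, e.fderiv_eq, e.eq_of_nhds, map_sub]
    rw [fderiv_fun_sub (d (hn hW hY)) (d (hn hY hW)), sub_apply]
    abel
  have t : coord c (g.lieConnection W X Y) y =
      coord c (VectorField.mlieBracket (𝓡 m) W (g.nabla X Y)) y
      - coord c (g.nabla (VectorField.mlieBracket (𝓡 m) W X) Y) y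
      - coord c (g.nabla X (VectorField.mlieBracket (𝓡 m) W Y)) y := by
    simp only [coord, lieConnection, Pi.sub_apply, map_sub]
  -- Every bracket with `W` is a difference of covariant derivatives; after cancellation there
  -- remain ∇²_{X, Y} W and the curvature of W, X applied to Y.
  rw [t, e1, g.coord_mlieBracket_eq_sub hV hVU hW (hn hX hY) hy,
    g.coord_nabla_nabla hV hVU hX hY hy, g.coord_nabla_nabla hV hVU hW hY hy,
    g.coord_nabla_nabla hV hVU hY hW hy, g.coord_nabla (hVU hy) _ (hd hY),
    g.coord_nabla (hVU hy) _ (hd hW), g.coord_mlieBracket_eq_sub hV hVU hW hX hy,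
    ← hL.ricci_identity hY hy, g.coord_nabla (hVU hy) _ (hd hX),
    g.coord_nabla (hVU hy) _ (hd hY), g.coord_nabla (hVU hy) _ (hd hW), map_sub]
  abel

end Curvature

/-- The part of the chart at `c` which is covered by the chart at `x`. -/
def overlap (m : ℕ) {M : Type*} [TopologicalSpace M] [ChartedSpace (EuclideanSpace ℝ (Fin m)) M]
    (c x : M) : Set (EuclideanSpace ℝ (Fin m)) :=
  dom m c ∩ inv m c ⁻¹' (chartAt (EuclideanSpace ℝ (Fin m)) x).source

lemma isOpen_overlap (c x : M) : IsOpen (overlap m c x) :=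
  (contMDiffOn_inv c).continuousOn.isOpen_inter_preimage (isOpen_dom c) (chartAt _ x).open_source

/-- The abstract extension of a vector has constant coordinates in the preferred chart at its base
point. -/
lemma ext_eq_constField {x : M} (v : TangentSpace (𝓡 m) x) {z : M}
    (hz : z ∈ (chartAt (EuclideanSpace ℝ (Fin m)) x).source) :
    ext v z = constField x (toCoord x x v) z := by
  have e := section_eq (mem_chart_source (EuclideanSpace ℝ (Fin m)) x) (fun z : M => ext v z)
  rw [ext_self] at e
  rw [← e]
  exact (Trivialization.symmL_apply (R := ℝ) _ hz _).symm

/-- Curvature differentiates the extensions twice, so differentiability at the base point alone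
would not suffice. -/
lemma contDiffOn_coord_ext (c : M) {x : M} (v : TangentSpace (𝓡 m) x) :
    ContDiffOn ℝ ∞ (coord c (ext v)) (overlap m c x) := by
  have h : ContDiffOn ℝ ∞ (coord c (constField x (toCoord x x v))) (overlap m c x) := by
    intro y hy
    obtain ⟨z, hz, hzy⟩ := exists_inv_eq hy.2
    have h := contMDiffAt_constField x (toCoord x x v) hz
    rw [hzy] at h
    exact ((contMDiffAt_field_iff hy.1).1 h).contDiffWithinAt
  exact h.congr fun y hy => by rw [coord, coord, ext_eq_constField v hy.2]

lemma coord_ext {c : M} {y : EuclideanSpace ℝ (Fin m)} (v : TangentSpace (𝓡 m) (inv m c y)) :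
    coord c (ext v) y = toCoord c (inv m c y) v := by
  rw [coord, ext_self]

section Traces

/-- The differential of a chart as a linear equivalence. -/
def toCoordEquiv {c x : M} (hx : x ∈ (chartAt (EuclideanSpace ℝ (Fin m)) c).source) :
    TangentSpace (𝓡 m) x ≃ₗ[ℝ] EuclideanSpace ℝ (Fin m) :=
  LinearEquiv.ofLinearMap (toCoord c x).toLinearMap (ofCoord c x).toLinearMap
    (LinearMap.ext fun v => toCoord_ofCoord hx v) (LinearMap.ext fun v => ofCoord_toCoord hx v)

/-- The frame of the tangent space at a point, in the chart at `c`. -/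
def coordFrame {c x : M} (hx : x ∈ (chartAt (EuclideanSpace ℝ (Fin m)) c).source) :
    Module.Basis (Fin m) ℝ (EuclideanSpace ℝ (Fin m)) := (frame x).map (toCoordEquiv hx)

lemma coordFrame_apply {c x : M} (hx : x ∈ (chartAt (EuclideanSpace ℝ (Fin m)) c).source)
    (i : Fin m) : coordFrame hx i = toCoord c x (frame x i) := rfl

lemma inner_dualFrame (x : M) (i j : Fin m) :
    g.inner x (g.dualFrame x i) (frame x j) = if j = i then 1 else 0 :=
  LinearMap.BilinForm.apply_dualBasis_left (B := g.bilin x) (hB := g.bilin_nondegenerate x) _ i j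

lemma isDual_coordFrame {c : M} {y : EuclideanSpace ℝ (Fin m)} (hy : y ∈ dom m c) :
    IsDual (coordFrame (inv_mem c hy)) (g.localMetric c y)
      fun i => toCoord c (inv m c y) (g.dualFrame (inv m c y) i) := by
  intro w i
  conv_lhs => rw [← (coordFrame (inv_mem c hy)).sum_repr w]
  simp [coordFrame_apply, g.localMetric_toCoord hy, g.symm _ (frame _ _), inner_dualFrame]

lemma metricTrace_eq_sum {W : Type*} [AddCommMonoid W] {c : M} {y : EuclideanSpace ℝ (Fin m)}
    (hy : y ∈ dom m c) {B : TangentSpace (𝓡 m) (inv m c y) → TangentSpace (𝓡 m) (inv m c y) → W}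
    {B' : EuclideanSpace ℝ (Fin m) → EuclideanSpace ℝ (Fin m) → W}
    (h : ∀ u v, B u v = B' (toCoord c _ u) (toCoord c _ v)) :
    g.metricTrace (inv m c y) B = ∑ i, B' (coordFrame (inv_mem c hy) i)
      (toCoord c (inv m c y) (g.dualFrame (inv m c y) i)) := by
  simp only [metricTrace, h, coordFrame_apply]

lemma exists_isDual {ι : Type*} [Fintype ι] (b : Module.Basis ι ℝ (EuclideanSpace ℝ (Fin m)))
    {c : M} {y : EuclideanSpace ℝ (Fin m)} (hy : y ∈ dom m c) :
    ∃ b' : ι → EuclideanSpace ℝ (Fin m), IsDual b (g.localMetric c y) b' := by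
  refine ⟨fun i => g.localSharp c y (LinearMap.toContinuousLinearMap (b.coord i)), fun w i => ?_⟩
  rw [localMetric_symm, g.localMetric_localSharp hy]
  rfl

end Traces

/-- The endomorphism `v ↦ curv v u w` is linear, so its trace may be computed in any basis. -/
lemma _root_.FlatModel.tr_curv_eq {E : Type*} [NormedAddCommGroup E] [NormedSpace ℝ E]
    {ι κ : Type*} [Fintype ι] [Fintype κ] (b : Module.Basis ι ℝ E) (b₁ : Module.Basis κ ℝ E)
    (Γ : E → E →L[ℝ] E →L[ℝ] E) (y u w : E) :
    tr b (fun v => curv Γ y v u w) = tr b₁ (fun v => curv Γ y v u w) := by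
  let L : E →ₗ[ℝ] E :=
    { toFun := fun v => curv Γ y v u w
      map_add' := fun v v' => by simp only [curv, map_add, add_apply]; abel
      map_smul' := fun r v => by
        simp only [curv, map_smul, smul_apply, RingHom.id_apply, smul_sub, smul_add] }
  exact (tr_eq_trace b L).trans (tr_eq_trace b₁ L).symm

/-- The Ricci tensor in coordinates. -/
lemma ricci_eq_tr {ι : Type*} [Fintype ι] (b : Module.Basis ι ℝ (EuclideanSpace ℝ (Fin m)))
    {c : M} {y : EuclideanSpace ℝ (Fin m)} (hy : y ∈ dom m c)
    (u w : TangentSpace (𝓡 m) (inv m c y)) :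
    g.ricci (inv m c y) u w = tr b (fun v =>
      curv (g.christoffel c) y v (toCoord c _ u) (toCoord c _ w)) := by
  have hyV : y ∈ overlap m c (inv m c y) := ⟨hy, mem_chart_source _ _⟩
  have e := g.metricTrace_eq_sum hy
    (B := fun a b => g.inner _ (g.curvature (ext u) (ext a) (ext w) (inv m c y)) b)
    (B' := fun a b => g.localMetric c y
      (curv (g.christoffel c) y a (toCoord c _ u) (toCoord c _ w)) b) fun a b => by
      rw [← g.localMetric_toCoord hy]
      have k := g.coord_curvature (isOpen_overlap c (inv m c y)) inter_subset_left
        (contDiffOn_coord_ext c u) (contDiffOn_coord_ext c a) (contDiffOn_coord_ext c w) hyV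
      -- The sign of `curvature` is absorbed by exchanging the first two arguments, which puts the
      -- traced vector first.
      rw [coord_ext, coord_ext, coord_ext, ← IsLocalMetric.curv_swap] at k
      rw [← k]
      rfl
  rw [ricci, e, FlatModel.tr_curv_eq b (coordFrame (inv_mem c hy)),
    (g.isDual_coordFrame hy).tr_eq]

/-! ### Lie derivatives and one-forms -/

lemma nabla_sub_nabla {X Y : VField m M} {x : M} (hX : IsDiffFieldAt X x) (hY : IsDiffFieldAt Y x) :
    g.nabla X Y x - g.nabla Y X x = VectorField.mlieBracket (𝓡 m) X Y x :=
  ((CovariantDerivative.torsion_eq_zero_iff _).1 g.leviCivita_torsion) hX hY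

/-- With a metric torsion-free connection, L_V g is the symmetrisation of ∇V. -/
lemma lieMetric_eq {V X Y : VField m M} {x : M} (hV : IsDiffFieldAt V x) (hX : IsDiffFieldAt X x)
    (hY : IsDiffFieldAt Y x) : g.lieMetric V X Y x =
      g.inner x (g.leviCivita V x (X x)) (Y x) + g.inner x (X x) (g.leviCivita V x (Y x)) := by
  rw [lieMetric, g.leviCivita_metric _ hX hY, ← g.nabla_sub_nabla hV hX, ← g.nabla_sub_nabla hV hY]
  simp only [nabla, map_sub, sub_apply]
  ring

/-- Likewise dη, for η = g(V, ·), is the antisymmetrisation of ∇V; the convention with 1/2 accounts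
for the factor 2. -/
lemma oneFormDeriv_eq {η : (x : M) → TangentSpace (𝓡 m) x →L[ℝ] ℝ} {V X Y : VField m M} {x : M}
    (hη : ∀ x v, η x v = g.inner x (V x) v) (hV : IsDiffFieldAt V x) (hX : IsDiffFieldAt X x)
    (hY : IsDiffFieldAt Y x) : 2 * oneFormDeriv η X Y x =
      g.inner x (g.leviCivita V x (X x)) (Y x) - g.inner x (X x) (g.leviCivita V x (Y x)) := by
  have e : ∀ Z : VField m M, (fun y => η y (Z y)) = g.pair V Z := fun Z => by
    funext y; exact hη y _
  rw [oneFormDeriv, e, e, g.leviCivita_metric _ hV hX, g.leviCivita_metric _ hV hY, hη,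
    ← g.nabla_sub_nabla hX hY, g.symm x (X x)]
  simp only [nabla, map_sub]
  ring

end PseudoRiemannianMetric

/-! ### Paracontact solitons on the manifold: Qξ, λ and the trace of L_ξ∇ -/

namespace ParacontactMetricStructure

open Coordinates FlatModel PseudoRiemannianMetric

variable {n : ℕ} {M : Type*} [TopologicalSpace M]
  [ChartedSpace (EuclideanSpace ℝ (Fin (2 * n + 1))) M] [IsManifold (𝓡 (2 * n + 1)) ∞ M]
  (S : ParacontactMetricStructure n M)

/-- The structure endomorphism in the chart at `c`. -/
def localPhi (c : M) (y : EuclideanSpace ℝ (Fin (2 * n + 1))) :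
    EuclideanSpace ℝ (Fin (2 * n + 1)) →L[ℝ] EuclideanSpace ℝ (Fin (2 * n + 1)) :=
  toCoord c (inv _ c y) ∘L S.φ (inv _ c y) ∘L ofCoord c (inv _ c y)

lemma localPhi_apply (c : M) (y a : EuclideanSpace ℝ (Fin (2 * n + 1))) :
    S.localPhi c y a = toCoord c (inv _ c y) (S.φ (inv _ c y) (ofCoord c (inv _ c y) a)) := rfl

lemma contDiffOn_localPhi (c : M) : ContDiffOn ℝ ∞ (S.localPhi c) (dom (2 * n + 1) c) := by
  refine contDiffOn_clm_apply.2 fun a y hy => ?_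
  have h := ContMDiffAt.clm_bundle_apply (IM := 𝓡 (2 * n + 1)) (IB := 𝓡 (2 * n + 1))
    (F₁ := EuclideanSpace ℝ (Fin (2 * n + 1))) (F₂ := EuclideanSpace ℝ (Fin (2 * n + 1)))
    (E₁ := fun x : M => TangentSpace (𝓡 (2 * n + 1)) x)
    (E₂ := fun x : M => TangentSpace (𝓡 (2 * n + 1)) x) (b := fun x : M => x)
    S.contMDiff_φ.contMDiffAt (contMDiffAt_constField c a hy)
  exact ((contMDiffAt_field_iff hy (X := fun x => S.φ x (constField c a x))).1
    h).contDiffWithinAt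

/-- Combines dη(ξ, ·) = 0 with dη = g(·, φ·). -/
lemma inner_reeb_phi (x : M) (v : TangentSpace (𝓡 (2 * n + 1)) x) :
    S.g.inner x (S.ξ x) (S.φ x v) = 0 := by
  have hv := isDiffFieldAt_ext v
  have e := S.dη_eq x S.ξ _ (S.smooth_ξ.mdifferentiableAt (by simp)) hv
  rw [S.dη_ξ x _ hv, ext_self] at e
  exact e.symm

theorem isLocalParacontact (c : M) : IsLocalParacontact (dom (2 * n + 1) c) (S.g.localMetric c)
    (S.g.christoffel c) (coord c S.ξ) (S.localPhi c) where
  toIsLocalMetric := S.g.isLocalMetric c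
  smooth_reeb := S.smooth_ξ.contDiffOn_coord c
  smooth_phi := S.contDiffOn_localPhi c
  unit y hy := by
    rw [coord, S.g.localMetric_toCoord hy, ← S.η_eq, S.η_ξ]
  phi_sq y hy a := by
    rw [localPhi_apply, localPhi_apply, ofCoord_toCoord (inv_mem c hy), S.φ_sq, map_sub, map_smul,
      toCoord_ofCoord (inv_mem c hy), S.η_eq, ← S.g.localMetric_toCoord hy,
      toCoord_ofCoord (inv_mem c hy)]
    rfl
  deta y hy a b := by
    have hξ : IsDiffFieldAt S.ξ (inv _ c y) := S.smooth_ξ.mdifferentiableAt (by simp)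
    have ha := isDiffFieldAt_constField c a hy
    have hb := isDiffFieldAt_constField c b hy
    have e := oneFormDeriv_eq S.g S.η_eq hξ ha hb
    rw [S.dη_eq _ _ _ ha hb, ← S.g.localMetric_toCoord hy, ← S.g.localMetric_toCoord hy,
      ← S.g.localMetric_toCoord hy, S.g.toCoord_leviCivita hy hξ, S.g.toCoord_leviCivita hy hξ]
      at e
    simp only [constField, toCoord_ofCoord (inv_mem c hy)] at e
    exact e.symm
  eta_phi y hy a := by
    rw [coord, localPhi_apply, S.g.localMetric_toCoord hy, S.inner_reeb_phi]

variable {S} {lam : ℝ} (hsol : S.IsRicciSoliton lam)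
include hsol

/-- The soliton equation with (1/2) L_ξ g replaced by g(S·, ·), S = ∇ξ + φ, the form in which
Bianchi applies. -/
lemma IsRicciSoliton.ricci_eq {c : M} {y : EuclideanSpace ℝ (Fin (2 * n + 1))}
    (hy : y ∈ dom (2 * n + 1) c) (u w : TangentSpace (𝓡 (2 * n + 1)) (inv _ c y)) :
    S.g.ricci (inv _ c y) u w =
      lam * S.g.localMetric c y (toCoord c _ u) (toCoord c _ w) - S.g.localMetric c y
        (covVec (S.g.christoffel c) (coord c S.ξ) y (toCoord c _ u)
          + S.localPhi c y (toCoord c _ u)) (toCoord c _ w) := by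
  have hξ : IsDiffFieldAt S.ξ (inv _ c y) := S.smooth_ξ.mdifferentiableAt (by simp)
  have hu := isDiffFieldAt_ext u
  have hw := isDiffFieldAt_ext w
  have e := hsol.2 _ _ _ hu hw
  rw [S.g.lieMetric_eq hξ hu hw] at e
  simp only [ext_self] at e
  rw [← S.g.localMetric_toCoord hy, ← S.g.localMetric_toCoord hy,
    ← S.g.localMetric_toCoord hy, S.g.toCoord_leviCivita hy hξ, S.g.toCoord_leviCivita hy hξ] at e
  have h := S.isLocalParacontact c
  have d := h.deta y hy (toCoord c _ u) (toCoord c _ w)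
  have s := h.phi_skew hy (toCoord c _ u) (toCoord c _ w)
  simp only [map_add, add_apply]
  linarith

lemma IsRicciSoliton.tr_curv {c : M} {y : EuclideanSpace ℝ (Fin (2 * n + 1))}
    (hy : y ∈ dom (2 * n + 1) c) {ι : Type*} [Fintype ι]
    (b : Module.Basis ι ℝ (EuclideanSpace ℝ (Fin (2 * n + 1))))
    (u w : EuclideanSpace ℝ (Fin (2 * n + 1))) :
    tr b (fun v => curv (S.g.christoffel c) y v u w) =
      lam * S.g.localMetric c y u w - S.g.localMetric c y
        (covVec (S.g.christoffel c) (coord c S.ξ) y u + S.localPhi c y u) w := by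
  have e1 := S.g.ricci_eq_tr b hy (ofCoord c _ u) (ofCoord c _ w)
  have e2 := hsol.ricci_eq hy (ofCoord c _ u) (ofCoord c _ w)
  simp only [toCoord_ofCoord (inv_mem c hy)] at e1 e2
  rw [← e1, e2]

/-- The soliton constant and the rough Laplacian of the Reeb field. -/
lemma IsRicciSoliton.constant {c : M} {y : EuclideanSpace ℝ (Fin (2 * n + 1))}
    (hy : y ∈ dom (2 * n + 1) c) {b : Module.Basis (Fin (2 * n + 1)) ℝ
      (EuclideanSpace ℝ (Fin (2 * n + 1)))}
    {b' : Fin (2 * n + 1) → EuclideanSpace ℝ (Fin (2 * n + 1))}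
    (hb : IsDual b (S.g.localMetric c y) b') : lam = -2 * (n : ℝ) ∧
      divEnd b (S.g.christoffel c) b' (covVec (S.g.christoffel c) (coord c S.ξ)) y =
        - lam • coord c S.ξ y := by
  have := (S.isLocalParacontact c).soliton_constant b hy hb
    (fun z hz => S.g.exists_isDual b hz) (fun z hz => hsol.tr_curv hz b)
  refine ⟨?_, this.2⟩
  rw [this.1]
  simp

theorem IsRicciSoliton.lam_eq [Nonempty M] : lam = -2 * (n : ℝ) := by
  obtain ⟨x⟩ := ‹Nonempty M›
  obtain ⟨c, y, hy, -⟩ := exists_coord (2 * n + 1) x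
  exact (hsol.constant hy (S.g.isDual_coordFrame hy)).1

/-- The symmetric part of ∇ξ kills `ξ`, so only the term λ g of the Ricci tensor survives. -/
theorem IsRicciSoliton.ricciOp_reeb (x : M) : S.g.ricciOp x (S.ξ x) = lam • S.ξ x := by
  obtain ⟨c, y, hy, rfl⟩ := exists_coord (2 * n + 1) x
  have h := S.isLocalParacontact c
  rw [← ofCoord_toCoord (inv_mem c hy) (S.g.ricciOp _ _),
    ← ofCoord_toCoord (inv_mem c hy) (lam • S.ξ _)]
  congr 1
  have e : ∀ a : TangentSpace (𝓡 (2 * n + 1)) (inv (2 * n + 1) c y),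
      S.g.ricci _ (S.ξ _) a = lam * S.g.localMetric c y (coord c S.ξ y) (toCoord c _ a) := by
    intro a
    rw [hsol.ricci_eq hy]
    change _ - S.g.localMetric c y (covVec _ _ y (coord c S.ξ y)
      + S.localPhi c y (coord c S.ξ y)) _ = _
    rw [h.nabla_reeb_reeb hy, h.phi_reeb hy]
    simp [coord]
  rw [ricciOp, metricTrace, map_sum]
  simp only [e, map_smul, mul_smul]
  rw [← Finset.smul_sum]
  congr 1
  exact (S.g.isDual_coordFrame hy).sum_smul_dual (h.symm y hy) (h.nondeg y hy) _

/-- By `coord_lieConnection` the trace is div ∇ξ plus a contracted curvature equal to Qξ; these are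
-λξ and λξ. -/
theorem IsRicciSoliton.isInfinitesimalHarmonic : S.g.IsInfinitesimalHarmonic S.ξ := by
  refine ⟨S.smooth_ξ, fun x => ?_⟩
  obtain ⟨c, y, hy, rfl⟩ := exists_coord (2 * n + 1) x
  have h := S.isLocalParacontact c
  have hd := S.g.isDual_coordFrame hy
  have hyV : y ∈ overlap (2 * n + 1) c (inv _ c y) := ⟨hy, mem_chart_source _ _⟩
  rw [← ofCoord_toCoord (inv_mem c hy) (S.g.metricTrace _ _), metricTrace, map_sum]
  have e : ∀ a b : TangentSpace (𝓡 (2 * n + 1)) (inv (2 * n + 1) c y),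
      toCoord c _ (S.g.lieConnection S.ξ (ext a) (ext b) (inv _ c y)) =
        covEnd (S.g.christoffel c) (covVec (S.g.christoffel c) (coord c S.ξ)) y (toCoord c _ a)
          (toCoord c _ b)
        + curv (S.g.christoffel c) y (coord c S.ξ y) (toCoord c _ a) (toCoord c _ b) := by
    intro a b
    have k := S.g.coord_lieConnection (isOpen_overlap c (inv _ c y)) inter_subset_left
      ((S.smooth_ξ.contDiffOn_coord c).mono inter_subset_left)
      (contDiffOn_coord_ext c a) (contDiffOn_coord_ext c b) hyV
    rw [coord_ext, coord_ext] at k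
    exact k
  simp only [e, ← coordFrame_apply (inv_mem c hy), Finset.sum_add_distrib]
  have e1 := (hsol.constant hy hd).2
  rw [divEnd] at e1
  rw [e1]
  refine (congrArg _ ?_).trans (map_zero (ofCoord c (inv (2 * n + 1) c y)))
  refine h.nondeg y hy _ fun w => ?_
  have e2 := hsol.tr_curv hy (coordFrame (inv_mem c hy)) (coord c S.ξ y) w
  rw [hd.tr_eq, h.nabla_reeb_reeb hy, h.phi_reeb hy] at e2
  simp only [map_add, map_neg, map_smul, map_sum, add_apply, smul_apply, sum_apply, smul_eq_mul,
    neg_smul, neg_apply]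
  rw [Finset.sum_congr rfl fun i _ => ?_, e2]
  · simp
  · rw [h.curv_skew hy, IsLocalMetric.curv_swap, map_neg, neg_neg, h.symm y hy]

end ParacontactMetricStructure

/-! ### Determinants, the volume density and the divergence theorem in a chart -/

namespace FlatModel

section Det

variable {m : ℕ}

lemma differentiable_det : Differentiable ℝ
    (fun A : Fin m → Fin m → ℝ => (Matrix.of A).det) := by
  simp only [Matrix.det_apply, Matrix.of_apply]
  fun_prop

lemma contDiff_det : ContDiff ℝ ∞ (fun A : Fin m → Fin m → ℝ => (Matrix.of A).det) := by
  simp only [Matrix.det_apply, Matrix.of_apply]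
  refine ContDiff.sum fun σ _ => ContDiff.const_smul _ (contDiff_prod fun i _ => ?_)
  fun_prop

lemma hasDerivAt_det_one_add_smul (L : Matrix (Fin m) (Fin m) ℝ) :
    HasDerivAt (fun s : ℝ => (1 + s • L).det) L.trace 0 := by
  rw [show (fun s : ℝ => (1 + s • L).det) = _ from funext fun s => Matrix.det_one_add_smul s L]
  have h1 : HasDerivAt (fun s : ℝ => 1 + L.trace * s) L.trace 0 := by
    simpa using ((hasDerivAt_id (0 : ℝ)).const_mul L.trace).const_add 1
  have h2 := (((1 + (Polynomial.X : Polynomial ℝ) • L.map Polynomial.C).det.divX.divX).hasDerivAt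
    0).mul (hasDerivAt_pow 2 (0 : ℝ))
  simpa using h1.fun_add h2

/-- The derivative of the determinant in the direction of `Lᵀ M + M L`. -/
lemma fderiv_det (M L : Matrix (Fin m) (Fin m) ℝ) :
    fderiv ℝ (fun A : Fin m → Fin m → ℝ => (Matrix.of A).det) (fun i j => M i j)
      (fun i j => (L.transpose * M + M * L) i j) = 2 * L.trace * M.det := by
  -- The curve (1 + sL)ᵀ M (1 + sL) has the required velocity at 0, and its determinant is det(1 +
  -- sL)² det M. This avoids inverting `M`.
  have hp : HasDerivAt (fun s : ℝ => fun i j : Fin m =>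
      ((1 + s • L).transpose * M * (1 + s • L)) i j)
      (fun i j => (L.transpose * M + M * L) i j) 0 := by
    refine hasDerivAt_pi.2 fun i => hasDerivAt_pi.2 fun j => ?_
    have e : ∀ s : ℝ, ((1 + s • L).transpose * M * (1 + s • L)) i j =
        M i j + s * (L.transpose * M + M * L) i j + s ^ 2 * (L.transpose * M * L) i j := by
      intro s
      simp only [Matrix.transpose_add, Matrix.transpose_one, Matrix.transpose_smul, add_mul,
        mul_add, one_mul, mul_one, Matrix.smul_mul, Matrix.mul_smul, Matrix.add_apply,
        Matrix.smul_apply, smul_eq_mul]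
      ring
    simp only [e]
    have h1 := ((hasDerivAt_id (0 : ℝ)).mul_const ((L.transpose * M + M * L) i j)).const_add (M i j)
    have h2 := (hasDerivAt_pow 2 (0 : ℝ)).mul_const ((L.transpose * M * L) i j)
    simpa using h1.fun_add h2
  have e0 : (fun i j : Fin m => ((1 + (0 : ℝ) • L).transpose * M * (1 + (0 : ℝ) • L)) i j) =
      fun i j => M i j := by simp
  have h1 := (differentiable_det (m := m) _).hasFDerivAt.comp_hasDerivAt (0 : ℝ) hp
  rw [e0] at h1
  have h2 : HasDerivAt (fun s : ℝ => (1 + s • L).det * M.det * (1 + s • L).det)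
      (2 * L.trace * M.det) 0 := by
    have := hasDerivAt_det_one_add_smul L
    refine ((this.mul_const M.det).fun_mul this).congr_deriv ?_
    simp
    ring
  refine h1.unique (h2.congr_of_eventuallyEq (Filter.Eventually.of_forall fun s => ?_))
  change (Matrix.of fun i j => ((1 + s • L).transpose * M * (1 + s • L)) i j).det = _
  rw [show (Matrix.of fun i j => ((1 + s • L).transpose * M * (1 + s • L)) i j) =
    (1 + s • L).transpose * M * (1 + s • L) from rfl, Matrix.det_mul, Matrix.det_mul,
    Matrix.det_transpose]

end Det

section Density

variable {m : ℕ}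

/-- The Gram matrix of a bilinear form in the standard basis. -/
def gram (G : EuclideanSpace ℝ (Fin m) →L[ℝ] EuclideanSpace ℝ (Fin m) →L[ℝ] ℝ) :
    Matrix (Fin m) (Fin m) ℝ :=
  Matrix.of fun i j => G (EuclideanSpace.single i 1) (EuclideanSpace.single j 1)

/-- The density `√|det G_ij|` of a bilinear form. -/
def density (G : EuclideanSpace ℝ (Fin m) →L[ℝ] EuclideanSpace ℝ (Fin m) →L[ℝ] ℝ) : ℝ :=
  Real.sqrt |(gram G).det|

/-- The matrix of an endomorphism in the standard basis. -/
def stdMatrix (L : EuclideanSpace ℝ (Fin m) →L[ℝ] EuclideanSpace ℝ (Fin m)) :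
    Matrix (Fin m) (Fin m) ℝ := Matrix.of fun i j => L (EuclideanSpace.single j 1) i

lemma sum_single (v : EuclideanSpace ℝ (Fin m)) : v = ∑ i, v i • EuclideanSpace.single i (1 : ℝ) := by
  ext j
  simp [Pi.single_apply]

lemma det_stdMatrix (L : EuclideanSpace ℝ (Fin m) →L[ℝ] EuclideanSpace ℝ (Fin m)) :
    (stdMatrix L).det = L.det := by
  have : stdMatrix L = LinearMap.toMatrix (EuclideanSpace.basisFun (Fin m) ℝ).toBasis
      (EuclideanSpace.basisFun (Fin m) ℝ).toBasis (L : _ →ₗ[ℝ] _) := by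
    ext i j
    simp [stdMatrix, LinearMap.toMatrix_apply]
  rw [this, LinearMap.det_toMatrix]

lemma gram_apply_left (G : EuclideanSpace ℝ (Fin m) →L[ℝ] EuclideanSpace ℝ (Fin m) →L[ℝ] ℝ)
    (L : EuclideanSpace ℝ (Fin m) →L[ℝ] EuclideanSpace ℝ (Fin m)) (i j : Fin m) :
    G (L (EuclideanSpace.single i 1)) (EuclideanSpace.single j 1) =
      ((stdMatrix L).transpose * gram G) i j := by
  conv_lhs => rw [sum_single (L (EuclideanSpace.single i 1))]
  simp [Matrix.mul_apply, stdMatrix, gram]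

lemma gram_apply_right (G : EuclideanSpace ℝ (Fin m) →L[ℝ] EuclideanSpace ℝ (Fin m) →L[ℝ] ℝ)
    (L : EuclideanSpace ℝ (Fin m) →L[ℝ] EuclideanSpace ℝ (Fin m)) (i j : Fin m) :
    G (EuclideanSpace.single i 1) (L (EuclideanSpace.single j 1)) =
      (gram G * stdMatrix L) i j := by
  conv_lhs => rw [sum_single (L (EuclideanSpace.single j 1))]
  simp [Matrix.mul_apply, stdMatrix, gram, mul_comm]

/-- The Gram matrix transforms by congruence, so its determinant acquires (det L)². This is the
Jacobian factor that makes chart integrals agree. -/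
lemma density_comp {G G' : EuclideanSpace ℝ (Fin m) →L[ℝ] EuclideanSpace ℝ (Fin m) →L[ℝ] ℝ}
    {L : EuclideanSpace ℝ (Fin m) →L[ℝ] EuclideanSpace ℝ (Fin m)}
    (h : ∀ a b, G' a b = G (L a) (L b)) : density G' = |L.det| * density G := by
  have e : gram G' = (stdMatrix L).transpose * gram G * stdMatrix L := by
    ext i j
    have : gram G' i j = G (L (EuclideanSpace.single i 1)) (L (EuclideanSpace.single j 1)) := h _ _
    rw [this]
    conv_lhs => rw [sum_single (L (EuclideanSpace.single j 1))]
    simp only [map_sum, map_smul, gram_apply_left, smul_eq_mul]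
    rw [Matrix.mul_apply]
    simp [stdMatrix, mul_comm]
  rw [density, e, Matrix.det_mul, Matrix.det_mul, Matrix.det_transpose, det_stdMatrix, density,
    abs_mul, abs_mul, mul_right_comm, Real.sqrt_mul (by positivity), Real.sqrt_mul_self (abs_nonneg _)]

lemma det_gram_ne_zero {G : EuclideanSpace ℝ (Fin m) →L[ℝ] EuclideanSpace ℝ (Fin m) →L[ℝ] ℝ}
    (h : ∀ a, (∀ b, G a b = 0) → a = 0) : (gram G).det ≠ 0 := by
  intro h0
  obtain ⟨v, hv, hv0⟩ := Matrix.exists_vecMul_eq_zero_iff.2 h0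
  refine hv ?_
  have : WithLp.toLp 2 v = (0 : EuclideanSpace ℝ (Fin m)) := by
    refine h _ fun b => ?_
    rw [sum_single b, map_sum, Finset.sum_eq_zero]
    intro j _
    rw [map_smul]
    have e := congrFun hv0 j
    rw [sum_single (WithLp.toLp 2 v)]
    simp only [Matrix.vecMul, dotProduct, gram, Matrix.of_apply, Pi.zero_apply] at e
    simp [e]
  simpa using this

variable {U : Set (EuclideanSpace ℝ (Fin m))}
  {G : EuclideanSpace ℝ (Fin m) → EuclideanSpace ℝ (Fin m) →L[ℝ] EuclideanSpace ℝ (Fin m) →L[ℝ] ℝ}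
  {Γ : EuclideanSpace ℝ (Fin m) → EuclideanSpace ℝ (Fin m) →L[ℝ] EuclideanSpace ℝ (Fin m) →L[ℝ]
    EuclideanSpace ℝ (Fin m)}

lemma IsLocalMetric.contDiffOn_density (h : IsLocalMetric U G Γ) :
    ContDiffOn ℝ ∞ (fun y => density (G y)) U := by
  intro y hy
  have h1 : ContDiffWithinAt ℝ ∞ (fun z => (gram (G z)).det) U y := by
    refine contDiff_det.contDiffAt.comp_contDiffWithinAt (f := fun z i j =>
      G z (EuclideanSpace.single i 1) (EuclideanSpace.single j 1)) y ?_
    refine contDiffWithinAt_pi.2 fun i => contDiffWithinAt_pi.2 fun j => ?_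
    exact ((h.smooth y hy).clm_apply contDiffWithinAt_const).clm_apply contDiffWithinAt_const
  have h0 := det_gram_ne_zero (h.nondeg y hy)
  have h2 : ContDiffWithinAt ℝ ∞ (fun z => |(gram (G z)).det|) U y :=
    (contDiffAt_abs h0).comp_contDiffWithinAt (g := fun r : ℝ => |r|) y h1
  exact h2.sqrt (abs_ne_zero.2 h0)

/-- The logarithmic derivative of the density is the trace of the connection. -/
lemma IsLocalMetric.fderiv_density (h : IsLocalMetric U G Γ) {y : EuclideanSpace ℝ (Fin m)}
    (hy : y ∈ U) (u : EuclideanSpace ℝ (Fin m)) :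
    fderiv ℝ (fun y => density (G y)) y u =
      density (G y) * tr (EuclideanSpace.basisFun (Fin m) ℝ).toBasis (Γ y u) := by
  have h0 := det_gram_ne_zero (h.nondeg y hy)
  have hG := h.hasFDerivAt_metric hy
  set L := stdMatrix (Γ y u) with hL
  have htr : tr (EuclideanSpace.basisFun (Fin m) ℝ).toBasis (Γ y u) = L.trace := by
    simp [tr, hL, Matrix.trace, stdMatrix]
  have h1 : HasFDerivAt (fun z => fun i j : Fin m =>
      G z (EuclideanSpace.single i 1) (EuclideanSpace.single j 1))
      (ContinuousLinearMap.pi fun i => ContinuousLinearMap.pi fun j =>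
        ((fderiv ℝ G y).flip (EuclideanSpace.single i 1)).flip (EuclideanSpace.single j 1)) y := by
    refine hasFDerivAt_pi.2 fun i => hasFDerivAt_pi.2 fun j => ?_
    have := ((hG.clm_apply (hasFDerivAt_const (EuclideanSpace.single i (1 : ℝ)) y)).clm_apply
      (hasFDerivAt_const (EuclideanSpace.single j (1 : ℝ)) y))
    simpa using this
  have h2 := ((differentiable_det (m := m) _).hasFDerivAt.comp y h1)
  have h3 := ((h2.abs h0).sqrt (abs_ne_zero.2 h0)).fderiv
  have h4 := DFunLike.congr_fun h3 u
  refine h4.trans ?_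
  -- Metric compatibility, read on Gram matrices, with `L` the matrix of Γ in the direction `u`.
  have e : (ContinuousLinearMap.pi fun i => ContinuousLinearMap.pi fun j =>
      ((fderiv ℝ G y).flip (EuclideanSpace.single i 1)).flip (EuclideanSpace.single j 1)) u =
      fun i j => (L.transpose * gram (G y) + gram (G y) * L) i j := by
    funext i j
    simp only [ContinuousLinearMap.coe_pi', ContinuousLinearMap.flip_apply, h.compat y hy,
      Matrix.add_apply, hL, ← gram_apply_left, ← gram_apply_right]
  have k := fderiv_det (gram (G y)) L
  simp only [smul_apply, ContinuousLinearMap.comp_apply, smul_eq_mul]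
  rw [e]
  change _ * (_ * fderiv ℝ (fun A : Fin m → Fin m → ℝ => (Matrix.of A).det)
    (fun i j => gram (G y) i j) _) = _
  rw [k, htr, density]
  have hs : Real.sqrt |(gram (G y)).det| ≠ 0 := Real.sqrt_ne_zero'.2 (abs_pos.2 h0)
  have hs2 := Real.mul_self_sqrt (abs_nonneg (gram (G y)).det)
  have hsg := sign_mul_self (gram (G y)).det
  change 1 / (2 * Real.sqrt |(gram (G y)).det|) * ((SignType.sign (gram (G y)).det : ℝ) *
    (2 * L.trace * (gram (G y)).det)) = _
  rw [show (SignType.sign (gram (G y)).det : ℝ) * (2 * L.trace * (gram (G y)).det) =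
    2 * L.trace * |(gram (G y)).det| by rw [← hsg]; ring, div_mul_eq_mul_div,
    div_eq_iff (by simpa using hs)]
  linear_combination (-2 * L.trace) * hs2

end Density

section Divergence

lemma _root_.ContinuousOn.integrableOn_of_compact_support {E : Type*} [TopologicalSpace E] [T2Space E]
    [MeasurableSpace E] [OpensMeasurableSpace E] {μ : Measure E} [IsFiniteMeasureOnCompacts μ]
    {U K : Set E} {f : E → ℝ} (hU : MeasurableSet U) (hK : IsCompact K) (hKU : K ⊆ U)
    (hf : ContinuousOn f U) (h0 : ∀ y ∈ U, y ∉ K → f y = 0) : IntegrableOn f U μ :=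
  ((hf.mono hKU).integrableOn_compact hK).of_forall_sdiff_eq_zero hU fun y hy => h0 y hy.1 hy.2

/-- Extension by zero is smooth: a point outside `U` has a neighbourhood that misses `K`. -/
lemma contDiff_indicator_of_compact_support {E F : Type*} [NormedAddCommGroup E] [NormedSpace ℝ E]
    [NormedAddCommGroup F] [NormedSpace ℝ F] {U K : Set E} {f : E → F} {n : WithTop ℕ∞}
    (hU : IsOpen U) (hK : IsCompact K) (hKU : K ⊆ U) (hf : ContDiffOn ℝ n f U)
    (h0 : ∀ y ∈ U, y ∉ K → f y = 0) : ContDiff ℝ n (U.indicator f) := by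
  rw [contDiff_iff_contDiffAt]
  intro y
  by_cases hy : y ∈ U
  · refine (hf.contDiffAt (hU.mem_nhds hy)).congr_of_eventuallyEq ?_
    filter_upwards [hU.mem_nhds hy] with z hz using indicator_of_mem hz f
  · refine (contDiffAt_const (c := (0 : F))).congr_of_eventuallyEq ?_
    filter_upwards [hK.isClosed.isOpen_compl.mem_nhds fun h => hy (hKU h)] with z hz
    by_cases hzU : z ∈ U
    · rw [indicator_of_mem hzU, h0 z hzU hz]
    · exact indicator_of_notMem hzU f

variable {m : ℕ}

/-- The divergence theorem for compactly supported vector fields on `ℝᵐ`. -/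
lemma integral_tr_fderiv {Z : EuclideanSpace ℝ (Fin m) → EuclideanSpace ℝ (Fin m)}
    (hZ : ContDiff ℝ ∞ Z) (hc : HasCompactSupport Z) :
    ∫ y, tr (EuclideanSpace.basisFun (Fin m) ℝ).toBasis (fderiv ℝ Z y) = 0 := by
  have hc' := hc.fderiv (𝕜 := ℝ)
  have hZ' : Continuous (fderiv ℝ Z) := hZ.continuous_fderiv (by simp)
  have e : ∀ i y, fderiv ℝ (fun z => Z z i) y (EuclideanSpace.single i 1) =
      fderiv ℝ Z y (EuclideanSpace.single i 1) i := by
    intro i y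
    have h1 : HasFDerivAt (fun z => (EuclideanSpace.proj i : _ →L[ℝ] ℝ) (Z z))
      ((EuclideanSpace.proj i : _ →L[ℝ] ℝ) ∘L fderiv ℝ Z y) y :=
      (EuclideanSpace.proj i : EuclideanSpace ℝ (Fin m) →L[ℝ] ℝ).hasFDerivAt.comp y
        (hZ.differentiable (by simp) y).hasFDerivAt
    exact DFunLike.congr_fun h1.fderiv (EuclideanSpace.single i (1 : ℝ))
  have hint : ∀ i : Fin m, Integrable (fun y => fderiv ℝ Z y (EuclideanSpace.single i 1) i) := by
    intro i
    refine Continuous.integrable_of_hasCompactSupport (by fun_prop) ?_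
    exact hc'.comp_left (g := fun L : EuclideanSpace ℝ (Fin m) →L[ℝ] EuclideanSpace ℝ (Fin m) =>
      L (EuclideanSpace.single i 1) i) (by simp)
  have hint0 : ∀ i : Fin m, Integrable (fun y => Z y i) := fun i =>
    Continuous.integrable_of_hasCompactSupport (by have := hZ.continuous; fun_prop)
      (hc.comp_left (g := fun v : EuclideanSpace ℝ (Fin m) => v i) (by simp))
  simp only [tr, OrthonormalBasis.coe_toBasis, OrthonormalBasis.coe_toBasis_repr_apply,
    EuclideanSpace.basisFun_apply, EuclideanSpace.basisFun_repr]
  rw [integral_finsetSum _ fun i _ => hint i]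
  refine Finset.sum_eq_zero fun i _ => ?_
  -- Integration by parts against the constant function 1.
  have := integral_mul_fderiv_eq_neg_fderiv_mul_of_integrable
    (μ := (volume : Measure (EuclideanSpace ℝ (Fin m)))) (f := fun _ => (1 : ℝ))
    (g := fun z => Z z i) (v := EuclideanSpace.single i 1) (by simp) (by simpa [e] using hint i)
    (by simpa using hint0 i) (fun _ _ => differentiableAt_const _)
    (fun y _ => by
      have := hZ.differentiable (by simp) y
      fun_prop)
  simpa [e] using this

/-- The divergence theorem in a chart. -/
lemma IsLocalMetric.integral_divergence
    {U K : Set (EuclideanSpace ℝ (Fin m))}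
    {G : EuclideanSpace ℝ (Fin m) → EuclideanSpace ℝ (Fin m) →L[ℝ] EuclideanSpace ℝ (Fin m) →L[ℝ] ℝ}
    {Γ : EuclideanSpace ℝ (Fin m) → EuclideanSpace ℝ (Fin m) →L[ℝ] EuclideanSpace ℝ (Fin m) →L[ℝ]
      EuclideanSpace ℝ (Fin m)} (h : IsLocalMetric U G Γ)
    {Y : EuclideanSpace ℝ (Fin m) → EuclideanSpace ℝ (Fin m)} (hY : ContDiffOn ℝ ∞ Y U)
    (hK : IsCompact K) (hKU : K ⊆ U) (h0 : ∀ y ∈ U, y ∉ K → Y y = 0) :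
    ∫ y in U, tr (EuclideanSpace.basisFun (Fin m) ℝ).toBasis (covVec Γ Y y) * density (G y) = 0 := by
  have hw := h.contDiffOn_density
  have hf : ContDiffOn ℝ ∞ (fun y => density (G y) • Y y) U := hw.smul hY
  have hf0 : ∀ y ∈ U, y ∉ K → density (G y) • Y y = 0 := fun y hy hyK => by
    rw [h0 y hy hyK, smul_zero]
  have hZ := contDiff_indicator_of_compact_support h.isOpen hK hKU hf hf0
  have hc : HasCompactSupport (U.indicator fun y => density (G y) • Y y) := by
    refine HasCompactSupport.intro hK fun y hy => ?_
    by_cases hyU : y ∈ U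
    · rw [indicator_of_mem hyU, hf0 y hyU hy]
    · exact indicator_of_notMem hyU _
  have key := integral_tr_fderiv hZ hc
  rw [← key, ← integral_indicator h.isOpen.measurableSet]
  congr 1
  funext y
  by_cases hy : y ∈ U
  · have e : U.indicator (fun y => density (G y) • Y y) =ᶠ[𝓝 y] fun y => density (G y) • Y y := by
      filter_upwards [h.isOpen.mem_nhds hy] with z hz using indicator_of_mem hz _
    have d1 := hasFDerivAt_of_contDiffOn h.isOpen hw hy
    have d2 := hasFDerivAt_of_contDiffOn h.isOpen hY hy
    rw [indicator_of_mem hy, e.fderiv_eq, (d1.fun_smul d2).fderiv]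
    have t : ∀ u, (density (G y) • fderiv ℝ Y y +
        (fderiv ℝ (fun y => density (G y)) y).smulRight (Y y)) u =
        density (G y) • fderiv ℝ Y y u + fderiv ℝ (fun y => density (G y)) y u • Y y :=
      fun _ => rfl
    have s : ∀ L : EuclideanSpace ℝ (Fin m) → EuclideanSpace ℝ (Fin m),
        tr (EuclideanSpace.basisFun (Fin m) ℝ).toBasis (fun u => density (G y) • L u) =
          density (G y) * tr (EuclideanSpace.basisFun (Fin m) ℝ).toBasis L := fun L => by
      simp [tr, Finset.mul_sum]
    change tr _ (fun u => fderiv ℝ Y y u + Γ y u (Y y)) * _ = tr _ (fun u => _)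
    simp only [t]
    -- Euclidean divergence of √|det G| Y: the derivative of the density supplies tr Γ(Y, ·), which
    -- torsion-freeness identifies with the connection term of tr ∇Y.
    rw [tr_add, tr_add, s, tr_smul_right, h.fderiv_density hy]
    simp only [h.torsion y hy _ (Y y)]
    ring
  · have : fderiv ℝ (U.indicator fun y => density (G y) • Y y) y = 0 := by
      have e : U.indicator (fun y => density (G y) • Y y) =ᶠ[𝓝 y] fun _ => 0 := by
        filter_upwards [hK.isClosed.isOpen_compl.mem_nhds fun h => hy (hKU h)] with z hz
        by_cases hzU : z ∈ U
        · rw [indicator_of_mem hzU, hf0 z hzU hz]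
        · exact indicator_of_notMem hzU _
      rw [e.fderiv_eq, fderiv_const_apply]
    rw [indicator_of_notMem hy, this]
    simp [tr]

end Divergence

end FlatModel

/-! ### Chart integrals and the glued volume measure -/

namespace PseudoRiemannianMetric

open Coordinates FlatModel

variable {m : ℕ} {M : Type*} [TopologicalSpace M]
  [ChartedSpace (EuclideanSpace ℝ (Fin m)) M] [IsManifold (𝓡 m) ∞ M]
  (g : PseudoRiemannianMetric m M)

lemma volumeDensity_eq {c : M} {y : EuclideanSpace ℝ (Fin m)} (hy : y ∈ dom m c) :
    g.volumeDensity c y = density (g.localMetric c y) := by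
  have e := ofCoord_eq_mfderiv hy
  unfold inv at e
  rw [volumeDensity, ← e]
  rfl

/-- The integral of a function over the chart at `c`. -/
def chartIntegral (c : M) (f : M → ℝ) : ℝ :=
  ∫ y in dom m c, f (inv m c y) * density (g.localMetric c y)

lemma hasFDerivAt_transition (c d : M) {y : EuclideanSpace ℝ (Fin m)} (hy : y ∈ overlap m c d) :
    HasFDerivAt (fun z => chartAt (EuclideanSpace ℝ (Fin m)) d (inv m c z))
      (toCoord d (inv m c y) ∘L ofCoord c (inv m c y)) y := by
  have h1 : MDifferentiableAt (𝓡 m) 𝓘(ℝ, EuclideanSpace ℝ (Fin m))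
    (chartAt (EuclideanSpace ℝ (Fin m)) d) (inv m c y) :=
    (contMDiffAt_chart d hy.2).mdifferentiableAt (by simp)
  have h2 := ((Coordinates.mdifferentiableAt_iff hy.1).1 h1).hasFDerivAt
  have h3 : fderiv ℝ (chartAt (EuclideanSpace ℝ (Fin m)) d ∘ inv m c) y =
      toCoord d (inv m c y) ∘L ofCoord c (inv m c y) := by
    ext1 a
    have k := mvfderiv_eq hy.1 h1 (ofCoord c _ a)
    rw [toCoord_ofCoord (inv_mem c hy.1)] at k
    rw [← k, toCoord_eq_mfderiv hy.2]
    rfl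
  rw [← h3]
  exact h2

lemma localMetric_transition (c d : M) {y : EuclideanSpace ℝ (Fin m)} (hy : y ∈ overlap m c d)
    (a b : EuclideanSpace ℝ (Fin m)) : g.localMetric c y a b =
      g.localMetric d (chartAt (EuclideanSpace ℝ (Fin m)) d (inv m c y))
        ((toCoord d (inv m c y) ∘L ofCoord c (inv m c y)) a)
        ((toCoord d (inv m c y) ∘L ofCoord c (inv m c y)) b) := by
  have e : inv m d (chartAt (EuclideanSpace ℝ (Fin m)) d (inv m c y)) = inv m c y :=
    (chartAt _ d).left_inv hy.2
  rw [localMetric_apply, localMetric_apply, e]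
  change _ = g.inner _ (ofCoord d _ (toCoord d _ _)) (ofCoord d _ (toCoord d _ _))
  rw [ofCoord_toCoord hy.2, ofCoord_toCoord hy.2]
  rfl

/-- Integrals of functions supported in the intersection of two charts may be computed in either. -/
lemma chartIntegral_eq {c d : M} {f : M → ℝ}
    (hf : ∀ x, x ∉ (chartAt (EuclideanSpace ℝ (Fin m)) c).source ∩
      (chartAt (EuclideanSpace ℝ (Fin m)) d).source → f x = 0) :
    g.chartIntegral c f = g.chartIntegral d f := by
  have red : ∀ {c d : M}, (∀ x, x ∉ (chartAt (EuclideanSpace ℝ (Fin m)) c).source ∩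
      (chartAt (EuclideanSpace ℝ (Fin m)) d).source → f x = 0) → g.chartIntegral c f =
      ∫ y in overlap m c d, f (inv m c y) * density (g.localMetric c y) := by
    intro c d hf
    refine setIntegral_eq_of_subset_of_forall_sdiff_eq_zero (isOpen_dom c).measurableSet
      inter_subset_left fun y hy => ?_
    rw [hf _ fun h => hy.2 ⟨hy.1, h.2⟩, zero_mul]
  rw [red hf, red (d := c) (c := d) fun x hx => hf x fun h => hx ⟨h.2, h.1⟩]
  set ψ : EuclideanSpace ℝ (Fin m) → EuclideanSpace ℝ (Fin m) :=
    fun z => chartAt (EuclideanSpace ℝ (Fin m)) d (inv m c z) with hψ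
  have himg : ψ '' overlap m c d = overlap m d c := by
    ext z
    constructor
    · rintro ⟨y, hy, rfl⟩
      refine ⟨(chartAt _ d).map_source hy.2, ?_⟩
      have e : inv m d (ψ y) = inv m c y := (chartAt _ d).left_inv hy.2
      rw [mem_preimage, e]
      exact inv_mem c hy.1
    · intro hz
      refine ⟨chartAt _ c (inv m d z), ⟨(chartAt _ c).map_source hz.2, ?_⟩, ?_⟩
      · have e : inv m c (chartAt _ c (inv m d z)) = inv m d z := (chartAt _ c).left_inv hz.2
        rw [mem_preimage, e]
        exact inv_mem d hz.1
      · have e : inv m c (chartAt _ c (inv m d z)) = inv m d z := (chartAt _ c).left_inv hz.2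
        simp only [hψ, e]
        exact chart_inv d hz.1
  have hinj : InjOn ψ (overlap m c d) := by
    intro y hy z hz hyz
    have h1 := (chartAt (EuclideanSpace ℝ (Fin m)) d).injOn hy.2 hz.2 hyz
    exact (chartAt (EuclideanSpace ℝ (Fin m)) c).symm.injOn hy.1 hz.1 h1
  -- Change of variables along the transition map; its Jacobian is compensated by the transformation
  -- of the density.
  rw [← himg, integral_image_eq_integral_abs_det_fderiv_smul volume
    (isOpen_overlap c d).measurableSet
    (fun y hy => (hasFDerivAt_transition c d hy).hasFDerivWithinAt) hinj]
  refine setIntegral_congr_fun (isOpen_overlap c d).measurableSet fun y hy => ?_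
  have e : inv m d (ψ y) = inv m c y := (chartAt _ d).left_inv hy.2
  rw [e, smul_eq_mul, density_comp (g.localMetric_transition c d hy)]
  ring

lemma continuousOn_density (c : M) :
    ContinuousOn (fun y => density (g.localMetric c y)) (dom m c) :=
  (g.isLocalMetric c).contDiffOn_density.continuousOn

lemma continuousOn_inv (c : M) : ContinuousOn (inv m c) (dom m c) :=
  (contMDiffOn_inv c).continuousOn

/-- The image of a compact subset of a chart domain. -/
lemma isCompact_chart_image {m : ℕ} {M : Type*} [TopologicalSpace M]
    [ChartedSpace (EuclideanSpace ℝ (Fin m)) M] {c : M} {K : Set M} (hK : IsCompact K)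
    (hKc : K ⊆ (chartAt (EuclideanSpace ℝ (Fin m)) c).source) :
    IsCompact (chartAt (EuclideanSpace ℝ (Fin m)) c '' K) ∧
      chartAt (EuclideanSpace ℝ (Fin m)) c '' K ⊆ dom m c ∧
      ∀ y ∈ dom m c, y ∉ chartAt (EuclideanSpace ℝ (Fin m)) c '' K → inv m c y ∉ K := by
  refine ⟨hK.image_of_continuousOn ((chartAt _ c).continuousOn.mono hKc), ?_, ?_⟩
  · rintro _ ⟨x, hx, rfl⟩
    exact (chartAt _ c).map_source (hKc hx)
  · exact fun y hy hyK hK => hyK ⟨_, hK, chart_inv c hy⟩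

lemma integrableOn_chart {c : M} {K : Set M} (hK : IsCompact K)
    (hKc : K ⊆ (chartAt (EuclideanSpace ℝ (Fin m)) c).source) {f : M → ℝ}
    (hf : Continuous f) (h0 : ∀ x ∉ K, f x = 0) :
    IntegrableOn (fun y => f (inv m c y) * density (g.localMetric c y)) (dom m c) := by
  obtain ⟨h1, h2, h3⟩ := isCompact_chart_image hK hKc
  refine ContinuousOn.integrableOn_of_compact_support (isOpen_dom c).measurableSet h1 h2
    ((hf.comp_continuousOn (continuousOn_inv c)).mul (g.continuousOn_density c)) fun y hy hyK => ?_
  rw [h0 _ (h3 y hy hyK), zero_mul]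

lemma aemeasurable_inv [MeasurableSpace M] [BorelSpace M] (c : M) :
    AEMeasurable (inv m c) ((volume : Measure (EuclideanSpace ℝ (Fin m))).restrict (dom m c)) :=
  (continuousOn_inv c).aemeasurable (isOpen_dom c).measurableSet

section Partition

variable [T2Space M] [SigmaCompactSpace M]

lemma continuous_chartPartition (c : M) : Continuous (chartPartition m M c) :=
  (chartPartition m M c).contMDiff.continuous

lemma chartPartition_tsupport (c : M) :
    tsupport (chartPartition m M c) ⊆ (chartAt (EuclideanSpace ℝ (Fin m)) c).source :=
  Classical.choose_spec (SmoothPartitionOfUnity.exists_isSubordinate_chartAt_source (𝓡 m) M) c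

lemma chartPartition_eq_zero {c x : M} (hx : x ∉ (chartAt (EuclideanSpace ℝ (Fin m)) c).source) :
    chartPartition m M c x = 0 :=
  image_eq_zero_of_notMem_tsupport fun h => hx (chartPartition_tsupport c h)

lemma exists_finset_chartPartition {K : Set M} (hK : IsCompact K) :
    ∃ s : Finset M, ∀ c ∉ s, ∀ x ∈ K, chartPartition m M c x = 0 := by
  have h := (chartPartition m M).locallyFinite.finite_nonempty_inter_compact hK
  refine ⟨h.toFinset, fun c hc x hx => ?_⟩
  by_contra h0
  exact hc (h.mem_toFinset.2 ⟨x, h0, hx⟩)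

lemma sum_chartPartition {K : Set M} {s : Finset M}
    (hs : ∀ c ∉ s, ∀ x ∈ K, chartPartition m M c x = 0) {x : M} (hx : x ∈ K) :
    ∑ c ∈ s, chartPartition m M c x = 1 := by
  rw [← (chartPartition m M).sum_eq_one (mem_univ x), finsum_eq_sum_of_support_subset]
  intro c hc
  by_contra h
  exact hc (hs c h x hx)

lemma aemeasurable_chartDensity (c : M) : AEMeasurable (fun y =>
    ENNReal.ofReal (chartPartition m M c (inv m c y) * g.volumeDensity c y))
    ((volume : Measure (EuclideanSpace ℝ (Fin m))).restrict (dom m c)) := by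
  refine AEMeasurable.ennreal_ofReal (ContinuousOn.aemeasurable ?_ (isOpen_dom c).measurableSet)
  refine ContinuousOn.mul ((continuous_chartPartition c).comp_continuousOn (continuousOn_inv c))
    ((g.continuousOn_density c).congr fun y hy => g.volumeDensity_eq hy)

end Partition

section Volume

variable [T2Space M] [SigmaCompactSpace M] [MeasurableSpace M]

/-- The contribution of the chart at `c` to the volume measure. -/
def chartMeasure (c : M) : Measure M :=
  (((volume : Measure (EuclideanSpace ℝ (Fin m))).restrict (dom m c)).withDensity fun y =>
    ENNReal.ofReal (chartPartition m M c (inv m c y) * g.volumeDensity c y)).map (inv m c)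

lemma volumeMeasure_eq : g.volumeMeasure = Measure.sum g.chartMeasure := rfl

variable [BorelSpace M]

/-- Unwinds push-forward and density, turning integration against one piece of the volume into a
weighted chart integral. -/
lemma integrable_chartMeasure_and (c : M) {K : Set M} (hK : IsCompact K) {f : M → ℝ}
    (hf : Continuous f) (h0 : ∀ x ∉ K, f x = 0) : Integrable f (g.chartMeasure c) ∧
      ∫ x, f x ∂g.chartMeasure c = g.chartIntegral c (fun x => chartPartition m M c x * f x) := by
  have hm1 : AEMeasurable (inv m c) (((volume : Measure (EuclideanSpace ℝ (Fin m))).restrict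
      (dom m c)).withDensity fun y =>
        ENNReal.ofReal (chartPartition m M c (inv m c y) * g.volumeDensity c y)) :=
    (aemeasurable_inv c).mono_ac (withDensity_absolutelyContinuous _ _)
  have hm2 : AEStronglyMeasurable f (g.chartMeasure c) := hf.measurable.aestronglyMeasurable
  have hlt : ∀ᵐ y ∂((volume : Measure (EuclideanSpace ℝ (Fin m))).restrict (dom m c)),
      ENNReal.ofReal (chartPartition m M c (inv m c y) * g.volumeDensity c y) < ⊤ :=
    Filter.Eventually.of_forall fun _ => ENNReal.ofReal_lt_top
  have e : EqOn (fun y => (ENNReal.ofReal (chartPartition m M c (inv m c y)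
      * g.volumeDensity c y)).toReal • (f ∘ inv m c) y)
      (fun y => (chartPartition m M c (inv m c y) * f (inv m c y)) * density (g.localMetric c y))
      (dom m c) := by
    intro y hy
    simp only [Function.comp_apply, smul_eq_mul]
    have hw : 0 ≤ density (g.localMetric c y) := Real.sqrt_nonneg _
    rw [g.volumeDensity_eq hy, ENNReal.toReal_ofReal
      (mul_nonneg ((chartPartition m M).nonneg c _) hw)]
    ring
  constructor
  · rw [chartMeasure, integrable_map_measure hm2 hm1,
      integrable_withDensity_iff_integrable_smul₀' (g.aemeasurable_chartDensity c) hlt]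
    refine IntegrableOn.congr_fun ?_ e.symm (isOpen_dom c).measurableSet
    -- `K` need not lie in the chart; its intersection with the support of the partition function
    -- does, and is compact.
    refine g.integrableOn_chart (K := K ∩ tsupport (chartPartition m M c))
      (hK.inter_right (isClosed_tsupport _)) (inter_subset_right.trans (chartPartition_tsupport c))
      ((continuous_chartPartition c).mul hf) fun x hx => ?_
    rw [Pi.mul_apply]
    by_cases hxK : x ∈ K
    · rw [image_eq_zero_of_notMem_tsupport fun h => hx ⟨hxK, h⟩, zero_mul]
    · rw [h0 x hxK, mul_zero]
  · rw [chartMeasure, integral_map hm1 hm2,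
      integral_withDensity_eq_integral_toReal_smul₀ (g.aemeasurable_chartDensity c) hlt]
    exact setIntegral_congr_fun (isOpen_dom c).measurableSet e

lemma chartMeasure_eq_zero {c : M} {K : Set M} (hK : IsClosed K)
    (h : ∀ x ∈ K, chartPartition m M c x = 0) : (g.chartMeasure c).restrict K = 0 := by
  rw [Measure.restrict_eq_zero, chartMeasure, Measure.map_apply_of_aemeasurable
    ((aemeasurable_inv c).mono_ac (withDensity_absolutelyContinuous _ _)) hK.measurableSet]
  rw [withDensity_apply_eq_zero' (g.aemeasurable_chartDensity c)]
  convert measure_empty (μ := (volume : Measure (EuclideanSpace ℝ (Fin m))).restrict (dom m c))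
  refine eq_empty_of_forall_notMem fun y hy => hy.1 ?_
  rw [h _ hy.2, zero_mul, ENNReal.ofReal_zero]

/-- The defining sum runs over all points of `M`; on a compact set only the finitely many pieces in
`s` contribute. -/
lemma restrict_volumeMeasure {K : Set M} (hK : IsCompact K) {s : Finset M}
    (hs : ∀ c ∉ s, ∀ x ∈ K, chartPartition m M c x = 0) :
    g.volumeMeasure.restrict K = ∑ c ∈ s, (g.chartMeasure c).restrict K := by
  rw [volumeMeasure_eq, Measure.restrict_sum _ hK.measurableSet]
  ext t ht
  rw [Measure.sum_apply _ ht, Measure.finsetSum_apply, tsum_eq_sum]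
  intro c hc
  rw [g.chartMeasure_eq_zero hK.isClosed (hs c hc)]
  rfl

lemma integrable_and_integral_eq {K : Set M} (hK : IsCompact K) {s : Finset M}
    (hs : ∀ c ∉ s, ∀ x ∈ K, chartPartition m M c x = 0) {f : M → ℝ}
    (hf : Continuous f) (h0 : ∀ x ∉ K, f x = 0) : Integrable f g.volumeMeasure ∧
      ∫ x, f x ∂g.volumeMeasure =
        ∑ c ∈ s, g.chartIntegral c (fun x => chartPartition m M c x * f x) := by
  have hi := fun c => g.integrable_chartMeasure_and c hK hf h0
  have hi' : ∀ c ∈ s, Integrable f ((g.chartMeasure c).restrict K) := fun c _ => (hi c).1.restrict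
  constructor
  · rw [← integrableOn_iff_integrable_of_support_subset (s := K), IntegrableOn,
      g.restrict_volumeMeasure hK hs]
    · exact integrable_finsetSum_measure.2 hi'
    · intro x hx
      by_contra h
      exact hx (h0 x h)
  · rw [← setIntegral_eq_integral_of_forall_compl_eq_zero h0, g.restrict_volumeMeasure hK hs,
      integral_finsetSum_measure hi']
    refine Finset.sum_congr rfl fun c _ => ?_
    rw [setIntegral_eq_integral_of_forall_compl_eq_zero h0, (hi c).2]

lemma integrable_of_compact_support {K : Set M} (hK : IsCompact K) {f : M → ℝ}
    (hf : Continuous f) (h0 : ∀ x ∉ K, f x = 0) : Integrable f g.volumeMeasure := by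
  obtain ⟨s, hs⟩ := exists_finset_chartPartition (m := m) hK
  exact (g.integrable_and_integral_eq hK hs hf h0).1

/-- A compactly supported continuous function equal to 1 on `K` is integrable, so the set where it
is at least 1 has finite measure. -/
lemma volumeMeasure_lt_top {K : Set M} (hK : IsCompact K) : g.volumeMeasure K < ⊤ := by
  have : LocallyCompactSpace M := ChartedSpace.locallyCompactSpace (EuclideanSpace ℝ (Fin m)) M
  obtain ⟨f, hf1, -, hfc, -⟩ := exists_continuous_one_zero_of_isCompact hK isClosed_empty
    (disjoint_empty K)
  have h := g.integrable_of_compact_support hfc.isCompact f.continuous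
    fun x hx => image_eq_zero_of_notMem_tsupport hx
  refine (measure_mono fun x hx => ?_).trans_lt (h.measure_norm_ge_lt_top one_pos)
  simp [hf1 hx]

end Volume

end PseudoRiemannianMetric

/-! ### Divergence of vector fields and the divergence theorem on the manifold -/

namespace PseudoRiemannianMetric

open Coordinates FlatModel

variable {m : ℕ} {M : Type*} [TopologicalSpace M]
  [ChartedSpace (EuclideanSpace ℝ (Fin m)) M] [IsManifold (𝓡 m) ∞ M]
  (g : PseudoRiemannianMetric m M)

/-- The divergence of a vector field. -/
def divergence (X : VField m M) (x : M) : ℝ :=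
  g.metricTrace x fun a b => g.inner x (g.leviCivita X x a) b

lemma divergence_eq {ι : Type*} [Fintype ι] (b : Module.Basis ι ℝ (EuclideanSpace ℝ (Fin m)))
    {c : M} {y : EuclideanSpace ℝ (Fin m)} (hy : y ∈ dom m c) {X : VField m M}
    (hX : IsDiffFieldAt X (inv m c y)) : g.divergence X (inv m c y) =
      tr b (covVec (g.christoffel c) (coord c X) y) := by
  have e := g.metricTrace_eq_sum hy
    (B := fun a b => g.inner _ (g.leviCivita X (inv m c y) a) b)
    (B' := fun a b => g.localMetric c y (covVec (g.christoffel c) (coord c X) y a) b)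
    fun a b => by rw [← g.localMetric_toCoord hy, g.toCoord_leviCivita hy hX]
  rw [divergence, e, ← (g.isDual_coordFrame hy).tr_eq]
  exact (tr_eq_trace _ (covVec (g.christoffel c) (coord c X) y).toLinearMap).trans
    (tr_eq_trace _ (covVec (g.christoffel c) (coord c X) y).toLinearMap).symm

lemma contMDiff_divergence {X : VField m M} (hX : IsSmoothField X) :
    ContMDiff (𝓡 m) 𝓘(ℝ, ℝ) ∞ (g.divergence X) := by
  intro x
  obtain ⟨c, y, hy, rfl⟩ := exists_coord m x
  refine (contMDiffAt_iff le_rfl hy).2 ?_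
  have h := (g.isLocalMetric c).contDiffOn_covVec (hX.contDiffOn_coord c)
  have h2 : ContDiffOn ℝ ∞ (fun z => tr (EuclideanSpace.basisFun (Fin m) ℝ).toBasis
      (covVec (g.christoffel c) (coord c X) z)) (dom m c) := by
    simp only [tr, OrthonormalBasis.coe_toBasis, OrthonormalBasis.coe_toBasis_repr_apply,
      EuclideanSpace.basisFun_apply, EuclideanSpace.basisFun_repr]
    refine ContDiffOn.sum fun i _ => ?_
    exact (EuclideanSpace.proj i : EuclideanSpace ℝ (Fin m) →L[ℝ] ℝ).contDiff.comp_contDiffOn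
      (h.clm_apply contDiffOn_const)
  refine (h2.contDiffAt ((isOpen_dom c).mem_nhds hy)).congr_of_eventuallyEq ?_
  filter_upwards [(isOpen_dom c).mem_nhds hy] with z hz
  exact g.divergence_eq _ hz (hX.mdifferentiableAt (by simp))

lemma divergence_sum {ι : Type*} (s : Finset ι) {X : VField m M} {Y : ι → VField m M}
    (hY : ∀ i ∈ s, IsSmoothField (Y i)) (hX : IsSmoothField X)
    (h : ∀ x, X x = ∑ i ∈ s, Y i x) (x : M) :
    g.divergence X x = ∑ i ∈ s, g.divergence (Y i) x := by
  obtain ⟨c, y, hy, rfl⟩ := exists_coord m x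
  have hYd : ∀ i ∈ s, IsDiffFieldAt (Y i) (inv m c y) := fun i hi =>
    (hY i hi).mdifferentiableAt (by simp)
  have e : coord c X = fun z => ∑ i ∈ s, coord c (Y i) z := by
    funext z
    simp only [coord, h, map_sum]
  rw [g.divergence_eq (EuclideanSpace.basisFun (Fin m) ℝ).toBasis hy (hX.mdifferentiableAt (by simp)),
    Finset.sum_congr rfl fun i hi =>
      g.divergence_eq (EuclideanSpace.basisFun (Fin m) ℝ).toBasis hy (hYd i hi)]
  have e2 : ∀ u, covVec (g.christoffel c) (coord c X) y u =
      ∑ i ∈ s, covVec (g.christoffel c) (coord c (Y i)) y u := by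
    intro u
    simp only [covVec_apply]
    rw [e, fderiv_fun_sum fun i hi => (isDiffFieldAt_iff hy).1 (hYd i hi)]
    simp [Finset.sum_add_distrib]
  simp only [tr, e2, map_sum, Finsupp.finsetSum_apply]
  exact Finset.sum_comm

lemma divergence_eq_zero {X : VField m M} {K : Set M} (hX : IsSmoothField X) (hK : IsClosed K)
    (h0 : ∀ x ∉ K, X x = 0) {x : M} (hx : x ∉ K) : g.divergence X x = 0 := by
  obtain ⟨c, y, hy, rfl⟩ := exists_coord m x
  rw [g.divergence_eq (EuclideanSpace.basisFun (Fin m) ℝ).toBasis hy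
    (hX.mdifferentiableAt (by simp))]
  have e : coord c X =ᶠ[𝓝 y] fun _ => 0 := by
    have hc : ContinuousAt (inv m c) y := (contMDiffAt_inv c hy).continuousAt
    filter_upwards [hc.preimage_mem_nhds (hK.isOpen_compl.mem_nhds hx)] with z hz
    rw [coord, h0 _ hz, map_zero]
  simp [tr, covVec, e.fderiv_eq, e.eq_of_nhds]

section Volume

variable [T2Space M] [SigmaCompactSpace M] [MeasurableSpace M] [BorelSpace M]

/-- All weighted chart integrals can be moved to the one chart containing the support; there the
weights add up to 1 and the divergence theorem in coordinates applies. -/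
lemma integral_divergence_of_subset_chart {X : VField m M} (hX : IsSmoothField X) {K : Set M}
    (hK : IsCompact K) (h0 : ∀ x ∉ K, X x = 0) {d : M}
    (hd : K ⊆ (chartAt (EuclideanSpace ℝ (Fin m)) d).source) :
    ∫ x, g.divergence X x ∂g.volumeMeasure = 0 := by
  obtain ⟨s, hs⟩ := exists_finset_chartPartition (m := m) hK
  have hc := (g.contMDiff_divergence hX).continuous
  have hz : ∀ x ∉ K, g.divergence X x = 0 := fun x hx => g.divergence_eq_zero hX hK.isClosed h0 hx
  obtain ⟨k1, k2, k3⟩ := isCompact_chart_image hK hd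
  rw [(g.integrable_and_integral_eq hK hs hc hz).2, Finset.sum_congr rfl fun c _ =>
    g.chartIntegral_eq (c := c) (d := d) fun x hx => ?_]
  · simp only [chartIntegral]
    rw [← integral_finsetSum _ fun c _ => g.integrableOn_chart hK hd
      (f := fun x => chartPartition m M c x * g.divergence X x)
      ((continuous_chartPartition c).mul hc) fun x hx => by rw [hz x hx, mul_zero]]
    rw [← (g.isLocalMetric d).integral_divergence (hX.contDiffOn_coord d) k1 k2 fun y hy hyK => by
      rw [coord, h0 _ (k3 y hy hyK), map_zero]]
    refine setIntegral_congr_fun (isOpen_dom d).measurableSet fun y hy => ?_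
    simp only [← Finset.sum_mul]
    rw [← g.divergence_eq _ hy (hX.mdifferentiableAt (by simp))]
    by_cases hx : inv m d y ∈ K
    · rw [sum_chartPartition hs hx, one_mul]
    · rw [hz _ hx, mul_zero]
  · by_cases hxK : x ∈ K
    · rw [chartPartition_eq_zero fun h => hx ⟨h, hd hxK⟩, zero_mul]
    · rw [hz x hxK, mul_zero]

/-- The divergence theorem for compactly supported vector fields. -/
theorem integral_divergence {X : VField m M} (hX : IsSmoothField X) {K : Set M}
    (hK : IsCompact K) (h0 : ∀ x ∉ K, X x = 0) : ∫ x, g.divergence X x ∂g.volumeMeasure = 0 := by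
  obtain ⟨s, hs⟩ := exists_finset_chartPartition (m := m) hK
  -- Cutting `X` by the partition gives finitely many nonzero pieces, each supported in one chart.
  -- The divergences are added only after localising, so no derivative of the partition appears.
  set Y : M → VField m M := fun c x => chartPartition m M c x • X x with hY
  have hYs : ∀ c, IsSmoothField (Y c) := fun c =>
    (chartPartition m M c).contMDiff.smul_section hX
  have hY0 : ∀ c, ∀ x ∉ K ∩ tsupport (chartPartition m M c), Y c x = 0 := by
    intro c x hx
    by_cases hxK : x ∈ K
    · simp only [hY]
      rw [image_eq_zero_of_notMem_tsupport fun h => hx ⟨hxK, h⟩, zero_smul]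
    · simp only [hY]
      rw [h0 x hxK, smul_zero]
  have hKc : ∀ c, IsCompact (K ∩ tsupport (chartPartition m M c)) := fun c =>
    hK.inter_right (isClosed_tsupport _)
  have hsum : ∀ x, X x = ∑ c ∈ s, Y c x := by
    intro x
    simp only [hY, ← Finset.sum_smul]
    by_cases hx : x ∈ K
    · rw [sum_chartPartition hs hx, one_smul]
    · rw [h0 x hx, smul_zero]
  have e : g.divergence X = fun x => ∑ c ∈ s, g.divergence (Y c) x := by
    funext x
    exact g.divergence_sum s (fun c _ => hYs c) hX hsum x
  rw [e, integral_finsetSum _ fun c _ => g.integrable_of_compact_support (hKc c)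
    (g.contMDiff_divergence (hYs c)).continuous
    fun x hx => g.divergence_eq_zero (hYs c) (hKc c).isClosed (hY0 c) hx]
  exact Finset.sum_eq_zero fun c _ => g.integral_divergence_of_subset_chart (hYs c) (hKc c) (hY0 c)
    (inter_subset_right.trans (chartPartition_tsupport c))

end Volume

end PseudoRiemannianMetric

/-! ### First variation of the energy density in coordinates -/

namespace FlatModel

variable {E : Type*} [NormedAddCommGroup E] [NormedSpace ℝ E]

/-- Metric contractions of bilinear maps do not depend on the basis. -/
lemma IsDual.sum_eq {ι κ : Type*} [Fintype ι] [Fintype κ] {b : Module.Basis ι ℝ E} {b' : ι → E}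
    {f : Module.Basis κ ℝ E} {f' : κ → E} {g : E →L[ℝ] E →L[ℝ] ℝ} (hb : IsDual b g b')
    (hf : IsDual f g f') (hs : ∀ a c, g a c = g c a) (hn : ∀ a, (∀ c, g a c = 0) → a = 0)
    {W : Type*} [AddCommGroup W] [Module ℝ W] (T : E →ₗ[ℝ] E →ₗ[ℝ] W) :
    ∑ i, T (b i) (b' i) = ∑ k, T (f k) (f' k) := by
  have r : ∀ k, T (f k) (f' k) = ∑ j, g (f k) (b' j) • T (b j) (f' k) := fun k => by
    conv_lhs => rw [← hb.sum_smul_basis (f k)]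
    simp
  have l : ∀ j, T (b j) (b' j) = ∑ k, g (f k) (b' j) • T (b j) (f' k) := fun j => by
    conv_lhs => rw [← hf.sum_smul_dual hs hn (b' j)]
    simp [hs (b' j)]
  simp only [r, l]
  rw [Finset.sum_comm]

/-- The covariant derivative of a time-dependent vector field. -/
def pathCov (Γ : E → E →L[ℝ] E →L[ℝ] E) (w : ℝ × E → E) (p : ℝ × E) : E →L[ℝ] E :=
  fderiv ℝ w p ∘L ContinuousLinearMap.inr ℝ ℝ E + (Γ p.2).flip (w p)

lemma covVec_slice {Γ : E → E →L[ℝ] E →L[ℝ] E} {w : ℝ × E → E} {t : ℝ} {y : E}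
    (h : DifferentiableAt ℝ w (t, y)) : covVec Γ (fun z => w (t, z)) y = pathCov Γ w (t, y) := by
  have : HasFDerivAt (fun z => w (t, z)) (fderiv ℝ w (t, y) ∘L ContinuousLinearMap.inr ℝ ℝ E) y :=
    h.hasFDerivAt.comp y (hasFDerivAt_prodMk_right t y)
  rw [covVec, this.fderiv]
  rfl

variable {U : Set E} {G : E → E →L[ℝ] E →L[ℝ] ℝ} {Γ : E → E →L[ℝ] E →L[ℝ] E}

lemma IsLocalMetric.contDiffOn_pathCov (h : IsLocalMetric U G Γ) {I : Set ℝ} (hI : IsOpen I)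
    {w : ℝ × E → E} (hw : ContDiffOn ℝ ∞ w (I ×ˢ U)) :
    ContDiffOn ℝ ∞ (pathCov Γ w) (I ×ˢ U) := by
  have h1 := hw.fderiv_of_isOpen (hI.prod h.isOpen) (m := ∞) (by simp)
  have h2 : ContDiffOn ℝ ∞ (fun p : ℝ × E => Γ p.2) (I ×ˢ U) :=
    h.smooth_conn.comp contDiffOn_snd fun p hp => hp.2
  exact (h1.clm_comp contDiffOn_const).add
    (((ContinuousLinearMap.flipₗᵢ ℝ E E E).contDiff.comp_contDiffOn h2).clm_apply hw)

/-- The first variation of the covariant derivative. -/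
lemma hasDerivAt_pathCov {I : Set ℝ} (hI : IsOpen I) (hU : IsOpen U) {w : ℝ × E → E}
    (hw : ContDiffOn ℝ ∞ w (I ×ˢ U)) {t : ℝ} (ht : t ∈ I) {y : E} (hy : y ∈ U) (a : E) :
    HasDerivAt (fun s => pathCov Γ w (s, y) a)
      (covVec Γ (fun z => fderiv ℝ w (t, z) (1, 0)) y a) t := by
  have hp : (t, y) ∈ I ×ˢ U := ⟨ht, hy⟩
  have hIU := hI.prod hU
  have d0 := hasFDerivAt_of_contDiffOn hIU hw hp
  have d1 := hasFDerivAt_fderiv_of_contDiffOn hIU hw hp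
  have hc : HasDerivAt (fun s : ℝ => (s, y)) ((1 : ℝ), (0 : E)) t :=
    (hasDerivAt_id t).prodMk (hasDerivAt_const t y)
  have e0 : HasDerivAt (fun s => w (s, y)) (fderiv ℝ w (t, y) (1, 0)) t := d0.comp_hasDerivAt t hc
  have e1 : HasDerivAt (fun s => fderiv ℝ w (s, y)) (fderiv ℝ (fderiv ℝ w) (t, y) (1, 0)) t :=
    d1.comp_hasDerivAt t hc
  have e2 : HasFDerivAt (fun z => fderiv ℝ w (t, z))
    (fderiv ℝ (fderiv ℝ w) (t, y) ∘L ContinuousLinearMap.inr ℝ ℝ E) y :=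
    d1.comp y (hasFDerivAt_prodMk_right t y)
  have e3 := (e2.clm_apply (hasFDerivAt_const ((1 : ℝ), (0 : E)) y)).fderiv
  have e4 := (e1.clm_apply (hasDerivAt_const t ((0 : ℝ), a))).add
    ((Γ y a).hasFDerivAt.comp_hasDerivAt t e0)
  refine e4.congr_deriv ?_
  rw [covVec_apply, e3]
  simp only [map_zero, add_zero, zero_add, add_apply, ContinuousLinearMap.comp_apply, zero_apply,
    ContinuousLinearMap.flip_apply, ContinuousLinearMap.inr_apply]
  -- Time and space derivatives commute.
  rw [fderiv_fderiv_comm hIU hw hp]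

namespace IsLocalParacontact

variable {ξ : E → E} {φ : E → E →L[ℝ] E}

/-- The first variation of the energy density at a Reeb field with `Δξ ∥ ξ` is a divergence. -/
lemma hasDerivAt_energy (h : IsLocalParacontact U G Γ ξ φ) {y : E} (hy : y ∈ U)
    {ι : Type*} [Fintype ι] {b : Module.Basis ι ℝ E} {b' : ι → E} (hb : IsDual b (G y) b')
    {r : ℝ} (hΔ : divEnd b Γ b' (covVec Γ ξ) y = r • ξ y)
    {I : Set ℝ} (hI : IsOpen I) (h0 : (0 : ℝ) ∈ I) {w : ℝ × E → E}
    (hw : ContDiffOn ℝ ∞ w (I ×ˢ U)) (hw0 : ∀ z ∈ U, w (0, z) = ξ z)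
    (hw1 : ∀ t ∈ I, G y (w (t, y)) (w (t, y)) = 1) :
    HasDerivAt (fun t => ∑ i, G y (pathCov Γ w (t, y) (b i)) (pathCov Γ w (t, y) (b' i)))
      (2 * tr b (covVec Γ (fun z => (covVec Γ ξ z + φ z + φ z) (fderiv ℝ w (0, z) (1, 0))) y))
      0 := by
  set V : E → E := fun z => fderiv ℝ w (0, z) (1, 0) with hV
  set C : E → E →L[ℝ] E := fun z => covVec Γ ξ z + φ z + φ z with hC
  have hs := h.symm y hy
  have hIU := hI.prod h.isOpen
  have hp : ((0 : ℝ), y) ∈ I ×ˢ U := ⟨h0, hy⟩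
  have hA := h.contDiffOn_covVec h.smooth_reeb
  have hCs : ContDiffOn ℝ ∞ C U := (hA.add h.smooth_phi).add h.smooth_phi
  have d0 := hasFDerivAt_of_contDiffOn hIU hw hp
  have e0 : HasDerivAt (fun s => w (s, y)) (V y) 0 :=
    d0.comp_hasDerivAt (0 : ℝ) ((hasDerivAt_id (0 : ℝ)).prodMk (hasDerivAt_const (0 : ℝ) y))
  -- `V` is orthogonal to `ξ`
  have hVξ : G y (V y) (ξ y) = 0 := by
    have k := ((G y).hasFDerivAt.comp_hasDerivAt (0 : ℝ) e0).clm_apply e0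
    have k' : HasDerivAt (fun s => G y (w (s, y)) (w (s, y))) 0 0 := by
      refine (hasDerivAt_const (0 : ℝ) (1 : ℝ)).congr_of_eventuallyEq ?_
      filter_upwards [hI.mem_nhds h0] with s hs using hw1 s hs
    have := k.unique k'
    simp only [Function.comp_apply, hw0 y hy] at this
    rw [hs (ξ y)] at this
    linarith
  have hA0 : ∀ a, pathCov Γ w (0, y) a = covVec Γ ξ y a := by
    intro a
    rw [← covVec_slice d0.differentiableAt]
    have : (fun z => w (0, z)) =ᶠ[𝓝 y] ξ := by
      filter_upwards [h.isOpen.mem_nhds hy] with z hz using hw0 z hz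
    simp only [covVec_apply, this.fderiv_eq, hw0 y hy]
  have hsum : HasDerivAt
      (fun t => ∑ i, G y (pathCov Γ w (t, y) (b i)) (pathCov Γ w (t, y) (b' i)))
      (∑ i, (G y (covVec Γ V y (b i)) (covVec Γ ξ y (b' i))
        + G y (covVec Γ ξ y (b i)) (covVec Γ V y (b' i)))) 0 := by
    refine HasDerivAt.fun_sum fun i _ => ?_
    have k := ((G y).hasFDerivAt.comp_hasDerivAt (0 : ℝ)
      (hasDerivAt_pathCov (Γ := Γ) hI h.isOpen hw h0 hy (b i))).clm_apply
      (hasDerivAt_pathCov (Γ := Γ) hI h.isOpen hw h0 hy (b' i))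
    simp only [Function.comp_apply, hA0] at k
    exact k
  refine hsum.congr_deriv ?_
  -- The product rule gives two sums, equal by symmetry of the contraction; hence the factor 2.
  have swap := hb.sum_swap hs (LinearMap.mk₂ ℝ (fun a c => G y (covVec Γ ξ y a) (covVec Γ V y c))
    (by simp) (by simp) (by simp) (by simp))
  simp only [LinearMap.mk₂_apply] at swap
  rw [Finset.sum_add_distrib, ← swap, ← Finset.sum_add_distrib]
  -- the divergence of `C V`
  have hVd : HasFDerivAt V (fderiv ℝ V y) y := by
    have hVs : ContDiffOn ℝ ∞ V U := by
      have h1 := hw.fderiv_of_isOpen hIU (m := ∞) (by simp)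
      have h2 : ContDiffOn ℝ ∞ (fun z => fderiv ℝ w (0, z)) U :=
        h1.comp (contDiff_prodMk_right (0 : ℝ)).contDiffOn fun z hz => ⟨h0, hz⟩
      exact h2.clm_apply contDiffOn_const
    exact hasFDerivAt_of_contDiffOn h.isOpen hVs hy
  have hCd := hasFDerivAt_of_contDiffOn h.isOpen hCs hy
  have div : ∀ u, covVec Γ (fun z => C z (V z)) y u = covEnd Γ C y u (V y) + C y (covVec Γ V y u) := by
    intro u
    rw [covVec_apply, (hCd.clm_apply hVd).fderiv]
    simp only [covEnd_apply, covVec_apply, add_apply, ContinuousLinearMap.comp_apply,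
      ContinuousLinearMap.flip_apply, map_add]
    abel
  -- The difference between div(A*V) and tr(A*∇V), where A = ∇ξ and A* = `C`. Taking the adjoint
  -- turns it into g(V, div A), zero because div A is parallel to `ξ` and V is orthogonal to it.
  have t1 : tr b (fun u => covEnd Γ C y u (V y)) = 0 := by
    rw [hb.tr_eq, Finset.sum_congr rfl fun i _ =>
      (show G y (covEnd Γ C y (b i) (V y)) (b' i) = G y (V y) (covEnd Γ (covVec Γ ξ) y (b i) (b' i))
        from by
        rw [hs, ← h.covEnd_adjoint hA hCs (fun z hz a c => h.nabla_adjoint hz a c) hy, hs])]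
    rw [← map_sum]
    change G y (V y) (divEnd b Γ b' (covVec Γ ξ) y) = 0
    rw [hΔ, map_smul, hVξ, smul_zero]
  have t2 : tr b (covVec Γ (fun z => C z (V z)) y) = tr b (fun u => C y (covVec Γ V y u)) := by
    change tr b (fun u => covVec Γ (fun z => C z (V z)) y u) = _
    simp only [div]
    rw [tr_add, t1, zero_add]
  rw [t2, hb.tr_eq, Finset.mul_sum]
  refine Finset.sum_congr rfl fun i _ => ?_
  have e1 : G y (C y (covVec Γ V y (b i))) (b' i) =
      G y (covVec Γ V y (b i)) (covVec Γ ξ y (b' i)) := by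
    rw [hs, hs _ (covVec Γ ξ y (b' i))]
    exact (h.nabla_adjoint hy _ _).symm
  rw [e1, hs (covVec Γ ξ y (b' i))]
  ring

end IsLocalParacontact

end FlatModel

/-! ### Smooth families of vector fields and differentiation of the energy -/

namespace PseudoRiemannianMetric

open Coordinates FlatModel

variable {m : ℕ} {M : Type*} [TopologicalSpace M]
  [ChartedSpace (EuclideanSpace ℝ (Fin m)) M]

section Charts

/-- Continuity of a time-dependent function may be checked in charts. -/
lemma continuousOn_of_charts {I : Set ℝ} (hI : IsOpen I) {f : ℝ × M → ℝ}
    (h : ∀ c, ContinuousOn (fun p : ℝ × EuclideanSpace ℝ (Fin m) => f (p.1, inv m c p.2))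
      (I ×ˢ dom m c)) : ContinuousOn f (I ×ˢ univ) := by
  rintro ⟨t, x⟩ ⟨ht, -⟩
  have hx := mem_chart_source (EuclideanSpace ℝ (Fin m)) x
  have h1 : ContinuousAt (fun p : ℝ × EuclideanSpace ℝ (Fin m) => f (p.1, inv m x p.2))
      (t, chartAt (EuclideanSpace ℝ (Fin m)) x x) :=
    (h x).continuousAt ((hI.prod (isOpen_dom x)).mem_nhds ⟨ht, (chartAt _ x).map_source hx⟩)
  have h2 : ContinuousAt (fun p : ℝ × M => (p.1, chartAt (EuclideanSpace ℝ (Fin m)) x p.2))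
      (t, x) :=
    continuousAt_fst.prodMk (((chartAt _ x).continuousAt hx).comp continuousAt_snd)
  have h3 := ContinuousAt.comp (x := (t, x)) h1 h2
  refine (h3.congr ?_).continuousWithinAt
  have hn : ∀ᶠ p : ℝ × M in 𝓝 (t, x), p.2 ∈ (chartAt (EuclideanSpace ℝ (Fin m)) x).source :=
    continuousAt_snd.preimage_mem_nhds ((chartAt _ x).open_source.mem_nhds hx)
  filter_upwards [hn] with p hp
  simp only [Function.comp_apply, inv, (chartAt _ x).left_inv hp]

lemma hasDerivAt_of_charts {I : Set ℝ} (hI : IsOpen I) {f : ℝ × M → ℝ}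
    (h : ∀ c, ContDiffOn ℝ ∞ (fun p : ℝ × EuclideanSpace ℝ (Fin m) => f (p.1, inv m c p.2))
      (I ×ˢ dom m c)) {t : ℝ} (ht : t ∈ I) {c : M} {y : EuclideanSpace ℝ (Fin m)}
    (hy : y ∈ dom m c) : HasDerivAt (fun s => f (s, inv m c y))
      (fderiv ℝ (fun p : ℝ × EuclideanSpace ℝ (Fin m) => f (p.1, inv m c p.2)) (t, y) (1, 0)) t :=
  (hasFDerivAt_of_contDiffOn (hI.prod (isOpen_dom c)) (h c) ⟨ht, hy⟩).comp_hasDerivAt t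
    ((hasDerivAt_id t).prodMk (hasDerivAt_const t y))

/-- The time derivative of a smooth function is continuous. -/
lemma continuousOn_deriv_of_charts {I : Set ℝ} (hI : IsOpen I) {f : ℝ × M → ℝ}
    (h : ∀ c, ContDiffOn ℝ ∞ (fun p : ℝ × EuclideanSpace ℝ (Fin m) => f (p.1, inv m c p.2))
      (I ×ˢ dom m c)) :
    ContinuousOn (fun p : ℝ × M => deriv (fun s => f (s, p.2)) p.1) (I ×ˢ univ) := by
  refine continuousOn_of_charts (m := m) hI fun c => ?_
  have h1 := (h c).continuousOn_fderiv_of_isOpen (hI.prod (isOpen_dom c)) (by simp)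
  refine (h1.clm_apply (continuousOn_const (c := ((1 : ℝ), (0 : EuclideanSpace ℝ (Fin m)))))).congr
    ?_
  rintro ⟨t, y⟩ ⟨ht, hy⟩
  exact (hasDerivAt_of_charts hI h ht hy).deriv

end Charts

variable [IsManifold (𝓡 m) ∞ M] (g : PseudoRiemannianMetric m M)

lemma contDiffOn_pathCoord {I : Set ℝ} {W : ℝ → VField m M}
    (hW : ContMDiffOn (𝓘(ℝ, ℝ).prod (𝓡 m)) (𝓡 m).tangent ∞
      (fun p : ℝ × M => (⟨p.2, W p.1 p.2⟩ : TangentBundle (𝓡 m) M)) (I ×ˢ univ)) (c : M) :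
    ContDiffOn ℝ ∞ (fun p : ℝ × EuclideanSpace ℝ (Fin m) => coord c (W p.1) p.2)
      (I ×ˢ dom m c) := by
  have h1 : ContMDiffOn (𝓘(ℝ, ℝ).prod 𝓘(ℝ, EuclideanSpace ℝ (Fin m))) (𝓘(ℝ, ℝ).prod (𝓡 m)) ∞
      (fun p : ℝ × EuclideanSpace ℝ (Fin m) => (p.1, inv m c p.2)) (I ×ˢ dom m c) :=
    contMDiffOn_fst.prodMk ((contMDiffOn_inv c).comp contMDiffOn_snd fun p hp => hp.2)
  have h2 := hW.comp h1 fun p hp => ⟨hp.1, mem_univ _⟩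
  have h3 := ((trivializationAt (EuclideanSpace ℝ (Fin m)) (TangentSpace (𝓡 m)) c).contMDiffOn_iff
    (IB := 𝓡 m) (fun p hp => (Trivialization.mem_source _).2 (inv_mem c hp.2))).1 h2
  rw [← contMDiffOn_iff_contDiffOn, modelWithCornersSelf_prod, ← chartedSpaceSelf_prod]
  refine h3.2.congr fun p hp => ?_
  exact (section_eq (inv_mem c hp.2) (W p.1)).symm

/-- The frame dual to the coordinate frame of the chart at `c`. -/
def coordDual (c : M) (y : EuclideanSpace ℝ (Fin m)) (i : Fin m) : EuclideanSpace ℝ (Fin m) :=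
  g.localSharp c y (EuclideanSpace.proj i)

lemma isDual_coordDual {c : M} {y : EuclideanSpace ℝ (Fin m)} (hy : y ∈ dom m c) :
    IsDual (EuclideanSpace.basisFun (Fin m) ℝ).toBasis (g.localMetric c y) (g.coordDual c y) := by
  intro w i
  rw [localMetric_symm, coordDual, g.localMetric_localSharp hy]
  simp

/-- The energy density in coordinates. -/
lemma metricTrace_sasakiPullback {c : M} {y : EuclideanSpace ℝ (Fin m)} (hy : y ∈ dom m c)
    {X : VField m M} (hX : IsDiffFieldAt X (inv m c y)) :
    g.metricTrace (inv m c y) (g.sasakiPullback X (inv m c y)) =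
      m + ∑ i, g.localMetric c y
        (covVec (g.christoffel c) (coord c X) y ((EuclideanSpace.basisFun (Fin m) ℝ).toBasis i))
        (covVec (g.christoffel c) (coord c X) y (g.coordDual c y i)) := by
  have hL := g.isLocalMetric c
  rw [g.metricTrace_eq_sum hy (B' := fun a b => g.localMetric c y a b + g.localMetric c y
    (covVec (g.christoffel c) (coord c X) y a) (covVec (g.christoffel c) (coord c X) y b))
    fun u v => by
      rw [sasakiPullback, ← g.toCoord_leviCivita hy hX, ← g.toCoord_leviCivita hy hX,
        g.localMetric_toCoord hy, g.localMetric_toCoord hy], Finset.sum_add_distrib]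
  congr 1
  · have := (g.isDual_coordFrame hy).tr_eq fun a => a
    rw [← this, tr_id, Fintype.card_fin]
  -- Trades the frame chosen separately at each point for the coordinate frame and its dual, which
  -- vary smoothly in the chart.
  · have := (g.isDual_coordFrame hy).sum_eq (g.isDual_coordDual hy) (hL.symm y hy) (hL.nondeg y hy)
      (LinearMap.mk₂ ℝ (fun a b => g.localMetric c y (covVec (g.christoffel c) (coord c X) y a)
        (covVec (g.christoffel c) (coord c X) y b)) (by simp) (by simp) (by simp) (by simp))
    exact this

section Variation

variable {I : Set ℝ} (hI : IsOpen I) {W : ℝ → VField m M}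
  (hW : ContMDiffOn (𝓘(ℝ, ℝ).prod (𝓡 m)) (𝓡 m).tangent ∞
    (fun p : ℝ × M => (⟨p.2, W p.1 p.2⟩ : TangentBundle (𝓡 m) M)) (I ×ˢ univ))
include hI hW

lemma differentiableAt_pathCoord {t : ℝ} (ht : t ∈ I) {c : M} {y : EuclideanSpace ℝ (Fin m)}
    (hy : y ∈ dom m c) : DifferentiableAt ℝ
      (fun p : ℝ × EuclideanSpace ℝ (Fin m) => coord c (W p.1) p.2) (t, y) :=
  (hasFDerivAt_of_contDiffOn (hI.prod (isOpen_dom c)) (contDiffOn_pathCoord hW c)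
    ⟨ht, hy⟩).differentiableAt

lemma energyDensity_eq {t : ℝ} (ht : t ∈ I) {c : M} {y : EuclideanSpace ℝ (Fin m)}
    (hy : y ∈ dom m c) : g.metricTrace (inv m c y) (g.sasakiPullback (W t) (inv m c y)) =
      m + ∑ i, g.localMetric c y
        (pathCov (g.christoffel c) (fun p => coord c (W p.1) p.2) (t, y)
          ((EuclideanSpace.basisFun (Fin m) ℝ).toBasis i))
        (pathCov (g.christoffel c) (fun p => coord c (W p.1) p.2) (t, y) (g.coordDual c y i)) := by
  have hd := differentiableAt_pathCoord hI hW ht hy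
  have hX : IsDiffFieldAt (W t) (inv m c y) := by
    refine (isDiffFieldAt_iff hy).2 ?_
    exact DifferentiableAt.comp y hd (differentiableAt_const t |>.prodMk differentiableAt_id)
  rw [g.metricTrace_sasakiPullback hy hX, ← covVec_slice hd]

lemma contDiffOn_energyDensity (c : M) : ContDiffOn ℝ ∞
    (fun p : ℝ × EuclideanSpace ℝ (Fin m) => g.metricTrace (inv m c p.2)
      (g.sasakiPullback (W p.1) (inv m c p.2))) (I ×ˢ dom m c) := by
  have hL := g.isLocalMetric c
  have hB := hL.contDiffOn_pathCov hI (contDiffOn_pathCoord hW c)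
  have snd : MapsTo (Prod.snd : ℝ × EuclideanSpace ℝ (Fin m) → _) (I ×ˢ dom m c) (dom m c) :=
    fun p hp => hp.2
  have hG : ContDiffOn ℝ ∞ (fun p : ℝ × EuclideanSpace ℝ (Fin m) => g.localMetric c p.2)
    (I ×ˢ dom m c) := hL.smooth.comp contDiffOn_snd snd
  have hS : ∀ i, ContDiffOn ℝ ∞ (fun p : ℝ × EuclideanSpace ℝ (Fin m) => g.coordDual c p.2 i)
    (I ×ˢ dom m c) := fun i =>
    ((g.contDiffOn_localSharp c).clm_apply contDiffOn_const).comp contDiffOn_snd snd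
  have key : ContDiffOn ℝ ∞ (fun p : ℝ × EuclideanSpace ℝ (Fin m) => (m : ℝ) +
      ∑ i, g.localMetric c p.2
        (pathCov (g.christoffel c) (fun p => coord c (W p.1) p.2) p
          ((EuclideanSpace.basisFun (Fin m) ℝ).toBasis i))
        (pathCov (g.christoffel c) (fun p => coord c (W p.1) p.2) p (g.coordDual c p.2 i)))
      (I ×ˢ dom m c) :=
    contDiffOn_const.add (ContDiffOn.sum fun i _ => (hG.clm_apply (hB.clm_apply
      contDiffOn_const)).clm_apply (hB.clm_apply (hS i)))
  exact key.congr fun p hp => g.energyDensity_eq hI hW hp.1 hp.2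

end Variation

section Volume

variable [T2Space M] [SigmaCompactSpace M] [MeasurableSpace M] [BorelSpace M]

/-- Differentiation of the energy under the integral sign. -/
lemma hasDerivAt_energy {W : ℝ → VField m M} {ε : ℝ} (hε : 0 < ε)
    (hW : ContMDiffOn (𝓘(ℝ, ℝ).prod (𝓡 m)) (𝓡 m).tangent ∞
      (fun p : ℝ × M => (⟨p.2, W p.1 p.2⟩ : TangentBundle (𝓡 m) M)) (Ioo (-ε) ε ×ˢ univ))
    {D : Set M} (hD : IsOpen D) (hDc : IsCompact (closure D)) :
    HasDerivAt (fun t => g.energy D (W t)) ((1 / 2) * ∫ x in D,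
      deriv (fun t => g.metricTrace x (g.sasakiPullback (W t) x)) 0 ∂g.volumeMeasure) 0 := by
  have hI : IsOpen (Ioo (-ε) ε) := isOpen_Ioo
  set f : ℝ × M → ℝ := fun p => g.metricTrace p.2 (g.sasakiPullback (W p.1) p.2) with hf
  have hfc : ∀ c, ContDiffOn ℝ ∞ (fun p : ℝ × EuclideanSpace ℝ (Fin m) => f (p.1, inv m c p.2))
    (Ioo (-ε) ε ×ˢ dom m c) := g.contDiffOn_energyDensity hI hW
  have hcont : ContinuousOn f (Ioo (-ε) ε ×ˢ univ) :=
    continuousOn_of_charts (m := m) hI fun c => (hfc c).continuousOn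
  have hcont' := continuousOn_deriv_of_charts (m := m) hI hfc
  have hft : ∀ t ∈ Ioo (-ε) ε, Continuous fun x => f (t, x) := fun t ht =>
    hcont.comp_continuous (by fun_prop) fun x => ⟨ht, mem_univ x⟩
  have hft' : ∀ t ∈ Ioo (-ε) ε, Continuous fun x => deriv (fun s => f (s, x)) t := fun t ht =>
    hcont'.comp_continuous (f := fun x : M => (t, x)) (by fun_prop) fun x => ⟨ht, mem_univ x⟩
  have h0 : (0 : ℝ) ∈ Ioo (-ε) ε := ⟨by linarith, hε⟩
  have hfin : g.volumeMeasure D ≠ ⊤ :=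
    ((measure_mono subset_closure).trans_lt (g.volumeMeasure_lt_top hDc)).ne
  have : IsFiniteMeasureOnCompacts g.volumeMeasure := ⟨fun _ hK => g.volumeMeasure_lt_top hK⟩
  have : IsFiniteMeasure (g.volumeMeasure.restrict D) := isFiniteMeasure_restrict.2 hfin
  -- The interval is halved so that the time derivative is continuous on a compact set, [-ε/2, ε/2]
  -- × closure D; its bound is the dominating constant on D, which has finite volume.
  obtain ⟨C, hC⟩ := (isCompact_Icc (a := -(ε / 2)) (b := ε / 2)).prod hDc
    |>.exists_bound_of_continuousOn (hcont'.mono (prod_mono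
      (fun t ht => ⟨by linarith [ht.1], by linarith [ht.2]⟩) (subset_univ _)))
  obtain ⟨C0, hC0⟩ := hDc.exists_bound_of_continuousOn (hft 0 h0).continuousOn
  have hs : Ioo (-(ε / 2)) (ε / 2) ∈ 𝓝 (0 : ℝ) := Ioo_mem_nhds (by linarith) (by linarith)
  have key := hasDerivAt_integral_of_dominated_loc_of_deriv_le (μ := g.volumeMeasure.restrict D)
    (F := fun t x => f (t, x)) (F' := fun t x => deriv (fun s => f (s, x)) t) (x₀ := (0 : ℝ))
    (bound := fun _ => C) hs
    (by
      filter_upwards [hI.mem_nhds h0] with t ht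
      exact (hft t ht).measurable.aestronglyMeasurable)
    (Integrable.of_bound (hft 0 h0).measurable.aestronglyMeasurable C0
      (ae_restrict_of_forall_mem hD.measurableSet fun x hx => hC0 x (subset_closure hx)))
    (hft' 0 h0).measurable.aestronglyMeasurable
    (ae_restrict_of_forall_mem hD.measurableSet fun x hx t ht =>
      hC (t, x) ⟨⟨ht.1.le, ht.2.le⟩, subset_closure hx⟩)
    (integrable_const C)
    (ae_restrict_of_forall_mem hD.measurableSet fun x hx t ht => by
      obtain ⟨c, y, hy, rfl⟩ := exists_coord m x
      exact (hasDerivAt_of_charts hI hfc ⟨by linarith [ht.1], by linarith [ht.2]⟩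
        hy).differentiableAt.hasDerivAt)
  exact key.2.const_mul (1 / 2)

end Volume

end PseudoRiemannianMetric

/-! ### The velocity field of a variation -/

namespace PseudoRiemannianMetric

open Coordinates

variable {m : ℕ} {M : Type*} [TopologicalSpace M]
  [ChartedSpace (EuclideanSpace ℝ (Fin m)) M] [IsManifold (𝓡 m) ∞ M]

/-- The initial velocity of a family of vector fields. -/
def variationField (W : ℝ → VField m M) : VField m M := fun x =>
  ofCoord x x (deriv (fun t => toCoord x x (W t x)) 0)

section

variable {I : Set ℝ} (hI : IsOpen I) (h0 : (0 : ℝ) ∈ I) {W : ℝ → VField m M}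
  (hW : ContMDiffOn (𝓘(ℝ, ℝ).prod (𝓡 m)) (𝓡 m).tangent ∞
    (fun p : ℝ × M => (⟨p.2, W p.1 p.2⟩ : TangentBundle (𝓡 m) M)) (I ×ˢ univ))
include hI h0 hW

/-- The velocity at `x` is defined in the chart at `x`. At a fixed point, change of chart is a fixed
linear map and commutes with the time derivative, so any chart gives the same vector. -/
lemma coord_variationField {c : M} {y : EuclideanSpace ℝ (Fin m)} (hy : y ∈ dom m c) :
    coord c (variationField W) y =
      fderiv ℝ (fun p : ℝ × EuclideanSpace ℝ (Fin m) => coord c (W p.1) p.2) (0, y) (1, 0) := by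
  have hd : HasDerivAt (fun s => coord c (W s) y) (fderiv ℝ
      (fun p : ℝ × EuclideanSpace ℝ (Fin m) => coord c (W p.1) p.2) (0, y) (1, 0)) 0 :=
    (FlatModel.hasFDerivAt_of_contDiffOn (hI.prod (isOpen_dom c)) (contDiffOn_pathCoord hW c)
      ⟨h0, hy⟩).comp_hasDerivAt (0 : ℝ) ((hasDerivAt_id (0 : ℝ)).prodMk (hasDerivAt_const (0 : ℝ) y))
  have hd' := (toCoord (inv m c y) (inv m c y) ∘L
    ofCoord c (inv m c y)).hasFDerivAt.comp_hasDerivAt (0 : ℝ) hd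
  have e : (fun s => toCoord (inv m c y) (inv m c y) (W s (inv m c y))) =
      (toCoord (inv m c y) (inv m c y) ∘L ofCoord c (inv m c y)) ∘ fun s => coord c (W s) y := by
    funext s
    simp only [Function.comp_apply, ContinuousLinearMap.comp_apply, coord,
      ofCoord_toCoord (inv_mem c hy)]
  rw [coord, variationField, e, hd'.deriv, ContinuousLinearMap.comp_apply,
    ofCoord_toCoord (mem_chart_source _ _), toCoord_ofCoord (inv_mem c hy)]

lemma isSmoothField_variationField : IsSmoothField (variationField W) := by
  intro x
  obtain ⟨c, y, hy, rfl⟩ := exists_coord m x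
  refine (contMDiffAt_field_iff hy).2 ?_
  have h1 := (contDiffOn_pathCoord hW c).fderiv_of_isOpen (hI.prod (isOpen_dom c)) (m := ∞)
    (by simp)
  have h2 : ContDiffOn ℝ ∞ (fun z => fderiv ℝ
      (fun p : ℝ × EuclideanSpace ℝ (Fin m) => coord c (W p.1) p.2) (0, z) (1, 0)) (dom m c) :=
    (h1.comp (contDiffOn_const.prodMk contDiffOn_id) fun z hz => ⟨h0, hz⟩).clm_apply
      contDiffOn_const
  refine (h2.contDiffAt ((isOpen_dom c).mem_nhds hy)).congr_of_eventuallyEq ?_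
  filter_upwards [(isOpen_dom c).mem_nhds hy] with z hz
  exact coord_variationField hI h0 hW hz

end

lemma variationField_eq_zero {I : Set ℝ} (hI : I ∈ 𝓝 (0 : ℝ)) {W : ℝ → VField m M} {X : VField m M}
    {x : M} (h : ∀ t ∈ I, W t x = X x) : variationField W x = 0 := by
  have e : (fun t => toCoord x x (W t x)) =ᶠ[𝓝 0] fun _ => toCoord x x (X x) := by
    filter_upwards [hI] with t ht
    rw [h t ht]
  rw [variationField, e.deriv_eq, deriv_const, map_zero]

end PseudoRiemannianMetric

/-! ### Harmonicity of the Reeb field -/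

namespace ParacontactMetricStructure

open Coordinates FlatModel PseudoRiemannianMetric

variable {n : ℕ} {M : Type*} [TopologicalSpace M]
  [ChartedSpace (EuclideanSpace ℝ (Fin (2 * n + 1))) M] [IsManifold (𝓡 (2 * n + 1)) ∞ M]
  (S : ParacontactMetricStructure n M)

/-- The field `∇_V ξ + 2 φ V`, whose divergence is the first variation of the energy density at `ξ`
in the direction `V` for a paracontact Ricci soliton. -/
def variationFlux (V : VField (2 * n + 1) M) : VField (2 * n + 1) M := fun x =>
  S.g.leviCivita S.ξ x (V x) + S.φ x (V x) + S.φ x (V x)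

lemma coord_variationFlux (V : VField (2 * n + 1) M) {c : M}
    {y : EuclideanSpace ℝ (Fin (2 * n + 1))} (hy : y ∈ dom (2 * n + 1) c) :
    coord c (S.variationFlux V) y =
      (covVec (S.g.christoffel c) (coord c S.ξ) y + S.localPhi c y + S.localPhi c y)
        (coord c V y) := by
  have hξ : IsDiffFieldAt S.ξ (inv _ c y) := S.smooth_ξ.mdifferentiableAt (by simp)
  simp only [coord, variationFlux, map_add, add_apply, S.localPhi_apply,
    ofCoord_toCoord (inv_mem c hy)]
  rw [S.g.toCoord_leviCivita hy hξ]

lemma isSmoothField_variationFlux {V : VField (2 * n + 1) M} (hV : IsSmoothField V) :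
    IsSmoothField (S.variationFlux V) := by
  intro x
  obtain ⟨c, y, hy, rfl⟩ := exists_coord (2 * n + 1) x
  refine (contMDiffAt_field_iff hy).2 ?_
  have h := S.isLocalParacontact c
  have hs := (((h.contDiffOn_covVec h.smooth_reeb).add h.smooth_phi).add h.smooth_phi).clm_apply
    (hV.contDiffOn_coord c)
  refine (hs.contDiffAt ((isOpen_dom c).mem_nhds hy)).congr_of_eventuallyEq ?_
  filter_upwards [(isOpen_dom c).mem_nhds hy] with z hz
  exact S.coord_variationFlux V hz

lemma hasSquaredLength_reeb : S.g.HasSquaredLength S.ξ 1 := fun x => by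
  rw [← S.η_eq, S.η_ξ]

variable {S} {lam : ℝ} (hsol : S.IsRicciSoliton lam)
include hsol

/-- Globalises the coordinate first variation: the term g(u, w) of the Sasaki metric contributes the
constant dimension, and the rest is a divergence because div ∇ξ = -λξ. -/
lemma IsRicciSoliton.hasDerivAt_energyDensity {I : Set ℝ} (hI : IsOpen I) (h0 : (0 : ℝ) ∈ I)
    {W : ℝ → VField (2 * n + 1) M}
    (hW : ContMDiffOn (𝓘(ℝ, ℝ).prod (𝓡 (2 * n + 1))) (𝓡 (2 * n + 1)).tangent ∞
      (fun p : ℝ × M => (⟨p.2, W p.1 p.2⟩ : TangentBundle (𝓡 (2 * n + 1)) M)) (I ×ˢ univ))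
    (hW0 : W 0 = S.ξ) (hW1 : ∀ t ∈ I, S.g.HasSquaredLength (W t) 1) (x : M) :
    HasDerivAt (fun t => S.g.metricTrace x (S.g.sasakiPullback (W t) x))
      (2 * S.g.divergence (S.variationFlux (variationField W)) x) 0 := by
  obtain ⟨c, y, hy, rfl⟩ := exists_coord (2 * n + 1) x
  have h := S.isLocalParacontact c
  have hd := S.g.isDual_coordDual hy
  have hX := S.isSmoothField_variationFlux (isSmoothField_variationField hI h0 hW)
  have k := h.hasDerivAt_energy hy hd (hsol.constant hy hd).2 hI h0 (contDiffOn_pathCoord hW c)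
    (fun z _ => by rw [hW0]) fun t ht => by
      rw [coord, S.g.localMetric_toCoord hy]
      exact hW1 t ht _
  have e : coord c (S.variationFlux (variationField W)) =ᶠ[𝓝 y] fun z =>
      (covVec (S.g.christoffel c) (coord c S.ξ) z + S.localPhi c z + S.localPhi c z)
        (fderiv ℝ (fun p : ℝ × EuclideanSpace ℝ (Fin (2 * n + 1)) => coord c (W p.1) p.2) (0, z)
          (1, 0)) := by
    filter_upwards [(isOpen_dom c).mem_nhds hy] with z hz
    rw [S.coord_variationFlux _ hz, coord_variationField hI h0 hW hz]
  have e' : covVec (S.g.christoffel c) (coord c (S.variationFlux (variationField W))) y =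
      covVec (S.g.christoffel c) (fun z =>
      (covVec (S.g.christoffel c) (coord c S.ξ) z + S.localPhi c z + S.localPhi c z)
        (fderiv ℝ (fun p : ℝ × EuclideanSpace ℝ (Fin (2 * n + 1)) => coord c (W p.1) p.2) (0, z)
          (1, 0))) y := by
    rw [covVec, covVec, e.fderiv_eq, e.eq_of_nhds]
  rw [S.g.divergence_eq (EuclideanSpace.basisFun (Fin (2 * n + 1)) ℝ).toBasis hy
    (hX.mdifferentiableAt (by simp)), e']
  refine (k.const_add (((2 * n + 1 : ℕ) : ℝ))).congr_of_eventuallyEq ?_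
  filter_upwards [hI.mem_nhds h0] with t ht
  exact S.g.energyDensity_eq hI hW ht hy

/-- The first variation integrates the divergence of a field vanishing off `K`, hence vanishes. -/
theorem IsRicciSoliton.isHParacontact [T2Space M] [SigmaCompactSpace M] [MeasurableSpace M]
    [BorelSpace M] : S.IsHParacontact := by
  refine ⟨S.smooth_ξ, 1, one_ne_zero, S.hasSquaredLength_reeb, fun D hD hDc ε hε W hW => ?_⟩
  have h0 : (0 : ℝ) ∈ Ioo (-ε) ε := ⟨neg_lt_zero.2 hε, hε⟩
  obtain ⟨K, hK, hKD, hKW⟩ := hW.support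
  have hX := S.isSmoothField_variationFlux (isSmoothField_variationField isOpen_Ioo h0 hW.smooth)
  have hX0 : ∀ x ∉ K, S.variationFlux (variationField W) x = 0 := fun x hx => by
    have : variationField W x = 0 :=
      variationField_eq_zero (isOpen_Ioo.mem_nhds h0) fun t ht => hKW t ht x hx
    simp [variationFlux, this]
  have key := S.g.hasDerivAt_energy hε hW.smooth hD hDc
  simp only [fun x => (hsol.hasDerivAt_energyDensity isOpen_Ioo h0 hW.smooth hW.zero hW.length
    x).deriv] at key
  -- Since K ⊆ D, the integral over D is the integral over all of M, so no boundary term of D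
  -- arises.
  rw [setIntegral_eq_integral_of_forall_compl_eq_zero fun x hx => by
    rw [S.g.divergence_eq_zero hX hK.isClosed hX0 fun h => hx (hKD h), mul_zero],
    integral_const_mul, S.g.integral_divergence hX hK hX0, mul_zero, mul_zero] at key
  exact key

end ParacontactMetricStructure

end

theorem theorem5p4 (n : ℕ) {M : Type*} [TopologicalSpace M] [T2Space M] [SigmaCompactSpace M]
    [ConnectedSpace M] [ChartedSpace (EuclideanSpace ℝ (Fin (2 * n + 1))) M]
    [IsManifold (𝓡 (2 * n + 1)) ∞ M] [MeasurableSpace M] [BorelSpace M]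
    (S : ParacontactMetricStructure n M) (lam : ℝ) (hsol : S.IsRicciSoliton lam) :
    (∀ x, S.g.ricciOp x (S.ξ x) = lam • S.ξ x) ∧
    S.g.IsInfinitesimalHarmonic S.ξ ∧
    S.IsHParacontact ∧
    lam = -2 * (n : ℝ) ∧
    (1 ≤ n → lam < 0) := by
  exact ⟨hsol.ricciOp_reeb, hsol.isInfinitesimalHarmonic, hsol.isHParacontact, hsol.lam_eq,
    fun hn => by
      have : (1 : ℝ) ≤ n := by exact_mod_cast hn
      rw [hsol.lam_eq]
      linarith⟩
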